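/- **Setting.** Let $\pi:E\to M$ be a smooth fibre bundle, $\dim M=n\ge 1$, $\dim E=n+m$, and let $l\ge 0$. Write $J^k=J^k\pi$, $\pi_k:J^k\to M$, $\pi_{l+1,l}:J^{l+1}\to J^l$. For a bundle $\xi:N\to M$, the fibre of $J^1\xi\to N$ over $p$ is identified with the set of right inverses $z:T_{\xi(p)}M\to T_pN$ of $T_p\xi$; for an $(n+1)$-form $\Omega$ at $p$, write $i^{1,n}(z)(\Omega)=0$ if $\Omega(v,zX_1,\dots,zX_n)=0$ for all $\xi$-vertical $v\in T_pN$ and all $X_i\in T_{\xi(p)}M$. A bundle morphism $\Phi$ over $M$ induces $\Phi_{[1]}(z)=T\Phi\circ z$ on first jets. Let $\tau_0^\dagger:J^\dagger\to J^l$ be the reduced multimomentum bundle of $\pi_l$, with fibre $V_y^*\pi_l\otimes\Lambda^{n-1}T^*_{\pi_l(y)}M$ over $y\in J^l$, and put $\tau^\dagger=\pi_l\circ\tau_0^\dagger$. Let $\mathscr M\to J^l$ be the multimomentum bundle (the $n$-forms on $J^l$ that vanish on any two vertical vectors), with tautological $n$-form $\Theta$. A first jet $\gamma\in J^1\pi_l$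 at $y$ defines a linear map $e^{1,n-1}(\gamma):J^\dagger_y\to\mathscr M_y$, $\alpha\otimes\beta\mapsto(\alpha\circ(\mathrm{id}-\gamma\circ T_y\pi_l))\wedge\pi_l^*\beta$. Let $N^\dagger=\pi_{l+1,l}^\circ(J^\dagger)=J^{l+1}\times_{J^l}J^\dagger$, let $\mathfrak p:N^\dagger\to J^{l+1}$ be the projection, let $\mathscr C:J^{l+1}\to J^1\pi_l$, $j_{l+1}s(x)\mapsto j_1(j_ls)(x)$, and let $h:N^\dagger\to\mathscr M$ be $h(w,P)=e^{1,n-1}(\mathscr C(w))(P)$. Let $\mathscr L$ be a smooth Lagrangian density of order $l+1$, i.e. a horizontal $n$-form on $J^{l+1}$. Put $\theta'=h^*\Theta+\mathfrak p^*\mathscr L$ and let $\mathscr P\subset N^\dagger$ be the set of points $w$ for which there is a first jet $z$ of $N^\dagger\to M$ at $w$ with $i^{1,n}(z)(d\theta'|_w)=0$. Assume that $(\pi,\mathscr L)$ is hyperregular: the projection $\mathscr P\to J^\dagger$ is a diffeomorphism. Let $\mathfrak s:J^\dagger\to\mathscr P\subset N^\dagger$ be its inverse, and put $\theta=\mathfrak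 s^*\theta'$, $\omega=d\theta$ and $$\operatorname{Ker}\omega|_P=\{z\in J^1\tau^\dagger \text{ at } P : i^{1,n}(z)(\omega|_P)=0\}.$$ Let $\mathbb L:N^\dagger\to\mathscr M$ be given by the pull-back of $\mathscr L$ along $T\pi_l$, and let $\mathscr H=(h+\mathbb L)\circ\mathfrak s:J^\dagger\to\mathscr M$ be the Hamiltonian section. **Proposition.** For every $P\in J^\dagger$ the set $\operatorname{Ker}\omega|_P$ is non-empty, and $(\tau_0^\dagger)_{[1]}(z)\in J^1\pi_l$ is the same for all $z\in\operatorname{Ker}\omega|_P$. Consequently $$\mathbb F\mathscr H:J^\dagger\to J^1\pi_l,\qquad P\mapsto(\tau_0^\dagger)_{[1]}(z),\quad z\in\operatorname{Ker}\omega|_P,$$ is a well-defined smooth morphism of bundles over $J^l$. Moreover it is the fibre derivative of $\mathscr H$: for $P\in J^\dagger_y$ and $Q\in J^\dagger_y$, $$\frac{d}{dt}\Big|_{t=0}\mathscr H(P+tQ)=e^{1,n-1}\big(\mathbb F\mathscr H(P)\big)(Q)\in\mathscr M_y .$$ (In standard coordinates, where $\mathscr{H}$ is given by $p=H$, this says $u^\alpha_I{}_{|i}\circ\mathbb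 F\mathscr H=\partial H/\partial p^{I.i}_\alpha$.) -/

import Mathlib

open Set Filter Manifold
open scoped Topology ContDiff

noncomputable section

namespace HigherField

section Analysis

variable {X Y Z : Type*} [NormedAddCommGroup X] [NormedSpace ℝ X]
  [NormedAddCommGroup Y] [NormedSpace ℝ Y] [NormedAddCommGroup Z] [NormedSpace ℝ Z]

/-- Iterated derivatives of a smooth function are symmetric. -/
theorem iteratedFDeriv_perm {f : X → Y} {x : X} {j : ℕ}
    (hf : ∀ᶠ y in 𝓝 x, ContDiffAt ℝ ∞ f y) (σ : Equiv.Perm (Fin j)) (v : Fin j → X) :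
    iteratedFDeriv ℝ j f x (v ∘ σ) = iteratedFDeriv ℝ j f x v := by
  induction j generalizing x with
  | zero => congr 1; exact Subsingleton.elim _ _
  | succ j ih =>
    have hσ : σ ∈ Submonoid.closure
        (range fun i : Fin j => Equiv.swap i.castSucc i.succ) := by
      rw [Equiv.Perm.mclosure_swap_castSucc_succ]; trivial
    induction hσ using Submonoid.closure_induction generalizing v with
    | one => rfl
    | mul a b _ _ ha hb =>
      have : v ∘ (a * b : Equiv.Perm (Fin (j + 1))) = (v ∘ a) ∘ b := rfl
      rw [this, hb, ha]
    | mem a ha =>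
      obtain ⟨i, rfl⟩ := ha
      cases j with
      | zero => exact i.elim0
      | succ j =>
        refine Fin.cases ?_ (fun i => ?_) i
        · have h2 : IsSymmSndFDerivAt ℝ (iteratedFDeriv ℝ j f) x := by
            apply ContDiffAt.isSymmSndFDerivAt (n := ∞)
            · exact hf.self_of_nhds.iteratedFDeriv_right (by exact_mod_cast le_top)
            · rw [minSmoothness_of_isRCLikeNormedField]
              exact WithTop.coe_le_coe.2 (le_top : (2 : ℕ∞) ≤ ⊤)
          have key : ∀ w : Fin (j + 2) → X, iteratedFDeriv ℝ (j + 2) f x w =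
              (fderiv ℝ (fderiv ℝ (iteratedFDeriv ℝ j f)) x (w 0) (w 1))
                (Fin.tail (Fin.tail w)) := by
            intro w
            rw [iteratedFDeriv_succ_apply_left]
            have hd' : DifferentiableAt ℝ (fderiv ℝ (iteratedFDeriv ℝ j f)) x :=
              ((hf.self_of_nhds.iteratedFDeriv_right (m := ∞) (i := j)
                (by exact_mod_cast le_top)).fderiv_right (m := ∞) (by simp)).differentiableAt (by simp)
            have hd : DifferentiableAt ℝ (iteratedFDeriv ℝ (j + 1) f) x :=
              (hf.self_of_nhds.iteratedFDeriv_right (m := 1)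
                (by exact_mod_cast le_top)).differentiableAt (by simp)
            have h3 := ((ContinuousMultilinearMap.apply ℝ (fun _ : Fin (j + 1) => X) Y
              (Fin.tail w)).hasFDerivAt.comp x hd.hasFDerivAt).fderiv
            have h6 := hd'.hasFDerivAt.clm_apply (hasFDerivAt_const (w 1) x)
            have h4 := ((ContinuousMultilinearMap.apply ℝ (fun _ : Fin j => X) Y
              (Fin.tail (Fin.tail w))).hasFDerivAt.comp x h6).fderiv
            have h5 := h3.symm.trans h4
            have h7 := congrArg (fun L => L (w 0)) h5
            simpa using h7
          rw [key, key, h2]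
          rfl
        · have h1 : ∀ᶠ y in 𝓝 x, ∀ w : Fin (j + 1) → X,
              iteratedFDeriv ℝ (j + 1) f y (w ∘ Equiv.swap i.castSucc i.succ) =
                iteratedFDeriv ℝ (j + 1) f y w := by
            filter_upwards [hf.eventually_nhds] with y hy w
            exact ih hy _ w
          have hd : DifferentiableAt ℝ (iteratedFDeriv ℝ (j + 1) f) x :=
            (hf.self_of_nhds.iteratedFDeriv_right (m := 1) (by exact_mod_cast le_top)).differentiableAt
              (by simp)
          have h3 : ∀ (u : X) (w : Fin (j + 1) → X),
              fderiv ℝ (iteratedFDeriv ℝ (j + 1) f) x u w =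
                fderiv ℝ (fun y => iteratedFDeriv ℝ (j + 1) f y w) x u := by
            intro u w
            have := (ContinuousMultilinearMap.apply ℝ (fun _ : Fin (j + 1) => X) Y w).hasFDerivAt.comp
              x hd.hasFDerivAt
            exact (congrArg (fun L => L u) this.fderiv).symm
          rw [iteratedFDeriv_succ_apply_left, iteratedFDeriv_succ_apply_left]
          have e0 : (v ∘ Equiv.swap i.succ.castSucc i.succ.succ) 0 = v 0 := by
            exact congrArg v (Equiv.swap_apply_of_ne_of_ne
              (by simp [Fin.ext_iff]) (by simp [Fin.ext_iff]))
          have e1 : Fin.tail (v ∘ Equiv.swap i.succ.castSucc i.succ.succ) =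
              Fin.tail v ∘ Equiv.swap i.castSucc i.succ := by
            funext q
            simp only [Fin.tail, Function.comp]
            congr 1
            rw [← Fin.succ_castSucc]
            exact (Function.Injective.swap_apply (Fin.succ_injective _) _ _ _)
          rw [e0, e1, h3, h3]
          refine congrArg (fun L : X →L[ℝ] Y => L (v 0)) ?_
          apply Filter.EventuallyEq.fderiv_eq
          filter_upwards [h1] with y hy
          exact hy _

/-- The derivatives of `g ∘ f` up to order `k` only depend on those of `f`. -/
theorem iteratedFDeriv_comp_congr {g : Y → Z} {f f' : X → Y} {x : X} {k : ℕ}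
    (hg : ContDiffAt ℝ ∞ g (f x)) (hf : ContDiffAt ℝ ∞ f x) (hf' : ContDiffAt ℝ ∞ f' x)
    (h : ∀ j ≤ k, iteratedFDeriv ℝ j f x = iteratedFDeriv ℝ j f' x) {j : ℕ} (hj : j ≤ k) :
    iteratedFDeriv ℝ j (g ∘ f) x = iteratedFDeriv ℝ j (g ∘ f') x := by
  have h0 : f x = f' x := by
    have := congrArg (fun L => L 0) (h 0 (Nat.zero_le _))
    simpa using this
  rw [iteratedFDeriv_comp hg hf (by exact_mod_cast le_top),
    iteratedFDeriv_comp (h0 ▸ hg) hf' (by exact_mod_cast le_top)]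
  unfold FormalMultilinearSeries.taylorComp
  refine Finset.sum_congr rfl fun c _ => ?_
  unfold FormalMultilinearSeries.compAlongOrderedFinpartition
  rw [h0]
  congr 1
  funext m
  exact h _ ((c.partSize_le m).trans hj)

theorem iteratedFDeriv_comp_congr_right {g g' : Y → Z} {f : X → Y} {x : X} {k : ℕ}
    (hg : ContDiffAt ℝ ∞ g (f x)) (hg' : ContDiffAt ℝ ∞ g' (f x)) (hf : ContDiffAt ℝ ∞ f x)
    (h : ∀ j ≤ k, iteratedFDeriv ℝ j g (f x) = iteratedFDeriv ℝ j g' (f x)) {j : ℕ}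
    (hj : j ≤ k) :
    iteratedFDeriv ℝ j (g ∘ f) x = iteratedFDeriv ℝ j (g' ∘ f) x := by
  rw [iteratedFDeriv_comp hg hf (by exact_mod_cast le_top),
    iteratedFDeriv_comp hg' hf (by exact_mod_cast le_top)]
  unfold FormalMultilinearSeries.taylorComp
  refine Finset.sum_congr rfl fun c _ => ?_
  unfold FormalMultilinearSeries.compAlongOrderedFinpartition
  congr 1
  exact h _ (c.length_le.trans hj)

/-- Smooth dependence of the iterated derivatives in the second variable on all variables. -/
theorem contDiffAt_iteratedFDeriv_param {G : X → Y → Z} (j : ℕ) {q : X} {b : Y}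
    (h : ContDiffAt ℝ ∞ (Function.uncurry G) (q, b)) :
    ContDiffAt ℝ ∞ (fun r : X × Y => iteratedFDeriv ℝ j (G r.1) r.2) (q, b) := by
  induction j with
  | zero =>
    exact ((continuousMultilinearCurryFin0 ℝ Y Z).symm.contDiff.contDiffAt).comp (q, b) h
  | succ j ih =>
    have : ContDiffAt ℝ ∞ (fun r : X × Y => fderiv ℝ (iteratedFDeriv ℝ j (G r.1)) r.2) (q, b) := by
      apply ContDiffAt.fderiv (n := ∞) (f := fun (r : X × Y) (b' : Y) => iteratedFDeriv ℝ j (G r.1) b')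
      · exact ContDiffAt.comp ((q, b), b) (f := fun s : (X × Y) × Y => (s.1.1, s.2)) ih
          (contDiffAt_fst.fst.prodMk contDiffAt_snd)
      · exact contDiffAt_snd
      · simp
    exact ((continuousMultilinearCurryLeftEquiv ℝ (fun _ : Fin (j + 1) => Y) Z).symm.contDiff.contDiffAt).comp
      (q, b) this

theorem contDiffAt_iteratedFDeriv_comp {G : X → Y → Z} (j : ℕ) {q : X} {β : X → Y}
    (h : ContDiffAt ℝ ∞ (Function.uncurry G) (q, β q)) (hβ : ContDiffAt ℝ ∞ β q) :
    ContDiffAt ℝ ∞ (fun r => iteratedFDeriv ℝ j (G r) (β r)) q :=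
  ContDiffAt.comp q (g := fun r : X × Y => iteratedFDeriv ℝ j (G r.1) r.2)
    (contDiffAt_iteratedFDeriv_param j h) (contDiffAt_id.prodMk hβ)

/-- Pull-back of alternating forms depends smoothly on the linear map. -/
theorem contDiff_pullback (d : ℕ) :
    ContDiff ℝ ∞ (fun g : Y →L[ℝ] X => (ContinuousAlternatingMap.compContinuousLinearMapCLM g :
      (X [⋀^Fin d]→L[ℝ] ℝ) →L[ℝ] (Y [⋀^Fin d]→L[ℝ] ℝ))) := by
  let alt : (Y [×d]→L[ℝ] ℝ) →L[ℝ] (Y [⋀^Fin d]→L[ℝ] ℝ) :=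
    { toFun := fun f => ContinuousMultilinearMap.alternatization f
      map_add' := fun f g => map_add _ f g
      map_smul' := fun c f => by
        ext v
        simp only [ContinuousMultilinearMap.alternatization_apply_apply,
          _root_.smul_apply, ContinuousAlternatingMap.smul_apply,
          RingHom.id_apply, Finset.smul_sum]
        exact Finset.sum_congr rfl fun σ _ => smul_comm _ _ _
      cont := by
        rw [ContinuousAlternatingMap.isEmbedding_toContinuousMultilinearMap.continuous_iff]
        show Continuous fun f : Y [×d]→L[ℝ] ℝ =>
          ∑ σ : Equiv.Perm (Fin d), Equiv.Perm.sign σ • f.domDomCongr σ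
        refine continuous_finsetSum _ fun σ _ => ?_
        exact ((ContinuousMultilinearMap.domDomCongrₗᵢ ℝ Y ℝ σ).continuous).const_smul
          (Equiv.Perm.sign σ) }
  have h1 : ContDiff ℝ ∞ (fun g : Y →L[ℝ] X =>
      ContinuousMultilinearMap.compContinuousLinearMapContinuousMultilinear ℝ
        (fun _ : Fin d => Y) (fun _ => X) ℝ (fun _ => g)) :=
    (ContinuousMultilinearMap.contDiff _).comp (contDiff_pi.2 fun _ => contDiff_id)
  have h2 : ContDiff ℝ ∞ (fun g : Y →L[ℝ] X => ((d.factorial : ℝ)⁻¹ • alt).comp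
      ((ContinuousMultilinearMap.compContinuousLinearMapContinuousMultilinear ℝ
        (fun _ : Fin d => Y) (fun _ => X) ℝ (fun _ => g)).comp
        (ContinuousAlternatingMap.toContinuousMultilinearMapCLM ℝ))) :=
    contDiff_const.clm_comp (h1.clm_comp contDiff_const)
  convert h2 using 1
  funext g
  ext f v
  show f (fun i => g (v i)) = (d.factorial : ℝ)⁻¹ •
    (ContinuousMultilinearMap.alternatization _ : Y [⋀^Fin d]→L[ℝ] ℝ) v
  rw [ContinuousMultilinearMap.alternatization_apply_apply]
  have h3 : ∀ σ : Equiv.Perm (Fin d), Equiv.Perm.sign σ •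
      ((ContinuousMultilinearMap.compContinuousLinearMapContinuousMultilinear ℝ
        (fun _ : Fin d => Y) (fun _ => X) ℝ (fun _ => g)
        (ContinuousAlternatingMap.toContinuousMultilinearMapCLM ℝ f)) (v ∘ σ)) =
        f (fun i => g (v i)) := by
    intro σ
    have h4 : (ContinuousMultilinearMap.compContinuousLinearMapContinuousMultilinear ℝ
        (fun _ : Fin d => Y) (fun _ => X) ℝ (fun _ => g)
        (ContinuousAlternatingMap.toContinuousMultilinearMapCLM ℝ f)) (v ∘ σ) =
        f ((fun i => g (v i)) ∘ σ) := rfl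
    rw [h4, show f ((fun i => g (v i)) ∘ σ) = Equiv.Perm.sign σ • f (fun i => g (v i)) from
      f.toAlternatingMap.map_perm _ σ, smul_smul, Int.units_mul_self, one_smul]
  refine Eq.symm ?_
  refine (congrArg ((d.factorial : ℝ)⁻¹ • ·) (Finset.sum_congr rfl fun σ _ => h3 σ)).trans ?_
  rw [Finset.sum_const, Finset.card_univ,
    Fintype.card_perm, Fintype.card_fin, ← Nat.cast_smul_eq_nsmul ℝ, smul_smul,
    inv_mul_cancel₀ (by exact_mod_cast d.factorial_ne_zero), one_smul]

variable (X Y) in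
/-- Symmetric `j`-linear maps. -/
def SymMult (j : ℕ) : Submodule ℝ (X [×j]→L[ℝ] Y) where
  carrier := {p | ∀ (σ : Equiv.Perm (Fin j)) (v : Fin j → X), p (v ∘ σ) = p v}
  zero_mem' := fun _ _ => rfl
  add_mem' := fun {a b} ha hb σ v => by simp [ha σ v, hb σ v]
  smul_mem' := fun c a ha σ v => by simp [ha σ v]

variable (X Y) in
/-- Fibre coordinates on a jet space of order `k`: the derivatives of orders `0, …, k`. -/
def JetFib (k : ℕ) : Type _ := ∀ j : Fin (k + 1), SymMult X Y j

instance (k : ℕ) : NormedAddCommGroup (JetFib X Y k) :=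
  inferInstanceAs (NormedAddCommGroup (∀ j : Fin (k + 1), SymMult X Y j))
instance (k : ℕ) : NormedSpace ℝ (JetFib X Y k) :=
  inferInstanceAs (NormedSpace ℝ (∀ j : Fin (k + 1), SymMult X Y j))

/-- The Taylor polynomial centred at `a` with prescribed derivatives. -/
def taylorPoly {k : ℕ} (p : JetFib X Y k) (a b : X) : Y :=
  ∑ j : Fin (k + 1), ((j : ℕ).factorial : ℝ)⁻¹ • (p j : X [×(j : ℕ)]→L[ℝ] Y) fun _ => b - a

theorem contDiff_taylorPoly {k : ℕ} :
    ContDiff ℝ ∞ (fun r : (X × JetFib X Y k) × X => taylorPoly r.1.2 r.1.1 r.2) := by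
  unfold taylorPoly
  refine ContDiff.sum fun j _ => ContDiff.const_smul _ ?_
  have h1 : ContDiff ℝ ∞ (fun r : (X [×(j : ℕ)]→L[ℝ] Y) × (Fin (j : ℕ) → X) => r.1 r.2) :=
    ((ContinuousLinearMap.id ℝ (X [×(j : ℕ)]→L[ℝ] Y)).analyticOnNhd_uncurry_of_multilinear
      (s := univ)).contDiff
  refine h1.comp (ContDiff.prodMk ?_ ?_)
  · exact ((SymMult X Y j).subtypeL.contDiff).comp
      (contDiff_pi.1 (contDiff_fst.snd :
        ContDiff ℝ ∞ (fun r : (X × JetFib X Y k) × X => r.1.2)) j)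
  · exact contDiff_pi.2 fun _ => contDiff_snd.sub contDiff_fst.fst

theorem iteratedFDeriv_taylorPoly {k : ℕ} (p : JetFib X Y k) (a : X) (j : Fin (k + 1)) :
    iteratedFDeriv ℝ j (taylorPoly p a) a = p j := by
  let q : FormalMultilinearSeries ℝ X Y := fun i =>
    if h : i < k + 1 then ((i.factorial : ℝ)⁻¹) • (p ⟨i, h⟩ : X [×i]→L[ℝ] Y) else 0
  have hq : ∀ i : Fin (k + 1), q i = (((i : ℕ).factorial : ℝ)⁻¹) • (p i : X [×(i : ℕ)]→L[ℝ] Y) :=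
    fun i => dif_pos i.2
  have h1 : HasFiniteFPowerSeriesOnBall (taylorPoly p a) q a (k + 1) ⊤ := by
    apply HasFiniteFPowerSeriesOnBall.mk'
    · intro m hm
      exact dif_neg (by omega)
    · exact ENNReal.coe_lt_top
    · intro y _
      rw [Finset.sum_range]
      unfold taylorPoly
      refine Finset.sum_congr rfl fun i _ => ?_
      rw [hq]
      simp
  have h2 : AnalyticOn ℝ (taylorPoly p a) univ := by
    have := h1.toHasFPowerSeriesOnBall
    have h3 := HasFiniteFPowerSeriesOnBall.cpolynomialOn h1
    simp only [Metric.eball_top] at h3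
    exact h3.analyticOnNhd.analyticOn
  ext v
  rw [h1.toHasFPowerSeriesOnBall.iteratedFDeriv_eq_sum h2, hq]
  have h3 : ∀ σ : Equiv.Perm (Fin (j : ℕ)),
      ((((j : ℕ).factorial : ℝ)⁻¹) • (p j : X [×(j : ℕ)]→L[ℝ] Y)) (fun i => v (σ i)) =
        (((j : ℕ).factorial : ℝ)⁻¹) • (p j : X [×(j : ℕ)]→L[ℝ] Y) v := by
    intro σ
    rw [_root_.smul_apply]
    congr 1
    exact (p j).2 σ v
  rw [Finset.sum_congr rfl fun σ _ => h3 σ, Finset.sum_const, Finset.card_univ,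
    Fintype.card_perm, Fintype.card_fin, ← Nat.cast_smul_eq_nsmul ℝ, smul_smul,
    mul_inv_cancel₀ (by exact_mod_cast (Nat.factorial_ne_zero _)), one_smul]

end Analysis

section Atlas

/-- A smooth atlas on a bare set `N`, with values in the normed space `V`. -/
structure SmoothAtlas (V : Type*) [NormedAddCommGroup V] [NormedSpace ℝ V] (N : Type*) where
  Index : Type*
  chart : Index → PartialEquiv N V
  index : N → Index
  mem_source : ∀ x, x ∈ (chart (index x)).source
  open_source : ∀ i j, IsOpen ((chart i).symm.trans (chart j)).source
  smooth : ∀ i j, ContDiffOn ℝ ∞ ((chart i).symm.trans (chart j))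
    ((chart i).symm.trans (chart j)).source

namespace SmoothAtlas

variable {V : Type*} [NormedAddCommGroup V] [NormedSpace ℝ V] {N : Type*} (a : SmoothAtlas V N)

/-- The underlying topological atlas. -/
def core : ChartedSpaceCore V N where
  atlas := range a.chart
  chartAt x := a.chart (a.index x)
  mem_chart_source := a.mem_source
  chart_mem_atlas x := ⟨_, rfl⟩
  open_source := by rintro _ _ ⟨i, rfl⟩ ⟨j, rfl⟩; exact a.open_source i j
  continuousOn_toFun := by rintro _ _ ⟨i, rfl⟩ ⟨j, rfl⟩; exact (a.smooth i j).continuousOn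

/-- The manifold topology of a smooth atlas. -/
abbrev topology : TopologicalSpace N := a.core.toTopologicalSpace

/-- The charted space of a smooth atlas. -/
abbrev chartedSpace : @ChartedSpace V _ N a.topology := a.core.toChartedSpace

theorem isManifold :
    @IsManifold ℝ _ V _ _ V _ 𝓘(ℝ, V) ∞ N a.topology a.chartedSpace := by
  letI := a.topology
  letI := a.chartedSpace
  apply isManifold_of_contDiffOn
  intro e e' he he'
  have he : e ∈ ⋃ (e : PartialEquiv N V) (he : e ∈ a.core.atlas),
    {a.core.openPartialHomeomorph e he} := he
  have he' : e' ∈ ⋃ (e : PartialEquiv N V) (he : e ∈ a.core.atlas),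
    {a.core.openPartialHomeomorph e he} := he'
  simp only [mem_iUnion, mem_singleton_iff] at he he'
  obtain ⟨_, ⟨i, rfl⟩, rfl⟩ := he
  obtain ⟨_, ⟨j, rfl⟩, rfl⟩ := he'
  simp only [modelWithCornersSelf_coe, modelWithCornersSelf_coe_symm, Function.comp_id,
    Function.id_comp, preimage_id, range_id, inter_univ]
  exact a.smooth i j

/-- The chart with a given index as an open partial homeomorphism. -/
def homeo (i : a.Index) : @OpenPartialHomeomorph N V a.topology _ :=
  a.core.openPartialHomeomorph (a.chart i) ⟨i, rfl⟩

theorem homeo_mem (i : a.Index) :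
    a.homeo i ∈ @IsManifold.maximalAtlas ℝ _ V _ _ V _ 𝓘(ℝ, V) ∞ N a.topology a.chartedSpace := by
  letI := a.topology
  letI := a.chartedSpace
  haveI := a.isManifold
  apply IsManifold.subset_maximalAtlas
  show a.homeo i ∈ ⋃ (e : PartialEquiv N V) (he : e ∈ a.core.atlas),
    {a.core.openPartialHomeomorph e he}
  simp only [mem_iUnion, mem_singleton_iff]
  exact ⟨_, ⟨i, rfl⟩, rfl⟩

end SmoothAtlas

/-- Smoothness at a point, read in charts. -/
theorem contMDiffAt_of_charts {V W N N' : Type*} [NormedAddCommGroup V] [NormedSpace ℝ V]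
    [NormedAddCommGroup W] [NormedSpace ℝ W]
    [TopologicalSpace N] [ChartedSpace V N] [IsManifold 𝓘(ℝ, V) ∞ N]
    [TopologicalSpace N'] [ChartedSpace W N'] [IsManifold 𝓘(ℝ, W) ∞ N']
    {f : N → N'} {x : N} (e : OpenPartialHomeomorph N V) (e' : OpenPartialHomeomorph N' W)
    (he : e ∈ IsManifold.maximalAtlas 𝓘(ℝ, V) ∞ N)
    (he' : e' ∈ IsManifold.maximalAtlas 𝓘(ℝ, W) ∞ N') (hx : x ∈ e.source) (g : V → W)
    (hg : ContDiffAt ℝ ∞ g (e x))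
    (h : ∀ᶠ y in 𝓝 x, f y ∈ e'.source ∧ e' (f y) = g (e y)) :
    ContMDiffAt 𝓘(ℝ, V) 𝓘(ℝ, W) ∞ f x := by
  have h0 := h.self_of_nhds
  have h1 : ContMDiffAt 𝓘(ℝ, V) 𝓘(ℝ, W) ∞ (e'.symm ∘ g ∘ e) x := by
    refine ContMDiffAt.comp x (contMDiffAt_symm_of_mem_maximalAtlas he' ?_)
      (hg.contMDiffAt.comp x (contMDiffAt_of_mem_maximalAtlas he hx))
    simp only [Function.comp]
    rw [← h0.2]
    exact e'.map_source h0.1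
  refine h1.congr_of_eventuallyEq ?_
  filter_upwards [h] with y hy
  simp only [Function.comp]
  rw [← hy.2, e'.left_inv hy.1]

end Atlas

section Bundle

/-- A smooth fibre bundle `proj : E → M` with typical fibre `F`. -/
structure SmoothFiberBundle (X Y A M E F : Type*)
    [NormedAddCommGroup X] [NormedSpace ℝ X] [NormedAddCommGroup Y] [NormedSpace ℝ Y]
    [NormedAddCommGroup A] [NormedSpace ℝ A]
    [TopologicalSpace M] [ChartedSpace X M] [TopologicalSpace E] [ChartedSpace A E]
    [TopologicalSpace F] [ChartedSpace Y F] where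
  proj : E → M
  smooth : ContMDiff 𝓘(ℝ, A) 𝓘(ℝ, X) ∞ proj
  locally_trivial : ∀ x : M, ∃ (U : Set M) (Φ : OpenPartialHomeomorph E (M × F)),
    IsOpen U ∧ x ∈ U ∧ Φ.source = proj ⁻¹' U ∧ Φ.target = U ×ˢ univ ∧
    ContMDiffOn 𝓘(ℝ, A) (𝓘(ℝ, X).prod 𝓘(ℝ, Y)) ∞ Φ Φ.source ∧
    ContMDiffOn (𝓘(ℝ, X).prod 𝓘(ℝ, Y)) 𝓘(ℝ, A) ∞ Φ.symm Φ.target ∧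
    ∀ e ∈ Φ.source, (Φ e).1 = proj e

variable {X Y A M E F : Type*}
  [NormedAddCommGroup X] [NormedSpace ℝ X] [NormedAddCommGroup Y] [NormedSpace ℝ Y]
  [NormedAddCommGroup A] [NormedSpace ℝ A]
  [TopologicalSpace M] [ChartedSpace X M] [TopologicalSpace E] [ChartedSpace A E]
  [TopologicalSpace F] [ChartedSpace Y F]

/-- Bundle coordinates: a chart `base` of `M` and a smooth chart `total` of `E` whose first
component is `base ∘ proj`. -/
structure BundleChart (π : SmoothFiberBundle X Y A M E F) where
  base : OpenPartialHomeomorph M X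
  total : OpenPartialHomeomorph E (X × Y)
  base_mem : base ∈ IsManifold.maximalAtlas 𝓘(ℝ, X) ∞ M
  smooth : ContMDiffOn 𝓘(ℝ, A) 𝓘(ℝ, X × Y) ∞ total total.source
  smooth_symm : ContMDiffOn 𝓘(ℝ, X × Y) 𝓘(ℝ, A) ∞ total.symm total.target
  maps : ∀ e ∈ total.source, π.proj e ∈ base.source
  compat : ∀ e ∈ total.source, (total e).1 = base (π.proj e)

variable [IsManifold 𝓘(ℝ, X) ∞ M] [IsManifold 𝓘(ℝ, Y) ∞ F]

theorem exists_bundleChart (π : SmoothFiberBundle X Y A M E F) (e : E) :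
    ∃ c : BundleChart π, e ∈ c.total.source := by
  obtain ⟨U, Φ, hU, hx, hs, ht, h1, h2, h3⟩ := π.locally_trivial (π.proj e)
  have he : e ∈ Φ.source := by rw [hs]; exact hx
  let b := chartAt X (π.proj e)
  let f := chartAt Y (Φ e).2
  let T : OpenPartialHomeomorph E (X × Y) := Φ.trans (b.prod f)
  have hT : ∀ z ∈ T.source, z ∈ Φ.source ∧ (Φ z).1 ∈ b.source ∧ (Φ z).2 ∈ f.source := by
    intro z hz
    simpa [T, OpenPartialHomeomorph.trans_source] using hz
  have hT' : ∀ p ∈ T.target, p.1 ∈ b.target ∧ p.2 ∈ f.target ∧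
      (b.symm p.1, f.symm p.2) ∈ Φ.target := by
    intro p hp
    have := hp
    simp only [T, OpenPartialHomeomorph.trans_target, OpenPartialHomeomorph.prod_target,
      mem_inter_iff, mem_prod, mem_preimage] at this
    exact ⟨this.1.1, this.1.2, this.2⟩
  refine ⟨⟨b, T, IsManifold.chart_mem_maximalAtlas _, ?_, ?_, ?_, ?_⟩, ?_⟩
  · have g1 : ContMDiffOn 𝓘(ℝ, A) 𝓘(ℝ, X) ∞ (fun z => b (Φ z).1) T.source :=
      contMDiffOn_chart.comp ((contMDiff_fst.comp_contMDiffOn h1).mono fun z hz => (hT z hz).1)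
        fun z hz => (hT z hz).2.1
    have g2 : ContMDiffOn 𝓘(ℝ, A) 𝓘(ℝ, Y) ∞ (fun z => f (Φ z).2) T.source :=
      contMDiffOn_chart.comp ((contMDiff_snd.comp_contMDiffOn h1).mono fun z hz => (hT z hz).1)
        fun z hz => (hT z hz).2.2
    exact g1.prodMk_space g2
  · have g1 : ContMDiffOn 𝓘(ℝ, X × Y) 𝓘(ℝ, X) ∞ (fun p : X × Y => b.symm p.1) T.target :=
      contMDiffOn_chart_symm.comp contDiff_fst.contMDiff.contMDiffOn fun p hp => (hT' p hp).1
    have g2 : ContMDiffOn 𝓘(ℝ, X × Y) 𝓘(ℝ, Y) ∞ (fun p : X × Y => f.symm p.2) T.target :=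
      contMDiffOn_chart_symm.comp contDiff_snd.contMDiff.contMDiffOn fun p hp => (hT' p hp).2.1
    exact h2.comp (g1.prodMk g2) fun p hp => (hT' p hp).2.2
  · intro z hz
    rw [← h3 z (hT z hz).1]
    exact (hT z hz).2.1
  · intro z hz
    show b (Φ z).1 = _
    rw [h3 z (hT z hz).1]
  · simp [T, OpenPartialHomeomorph.trans_source, he, h3 e he, b, f]

end Bundle

section Symmetrization

variable {X Y : Type*} [NormedAddCommGroup X] [NormedSpace ℝ X]
  [NormedAddCommGroup Y] [NormedSpace ℝ Y]

variable (X Y) in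
/-- The symmetrization projection; it fixes symmetric maps. -/
def symmetrize (j : ℕ) : (X [×j]→L[ℝ] Y) →L[ℝ] SymMult X Y j where
  toFun p := ⟨((j.factorial : ℝ)⁻¹) • ∑ σ : Equiv.Perm (Fin j), p.domDomCongr σ, fun τ v => by
    simp only [_root_.smul_apply, _root_.sum_apply,
      ContinuousMultilinearMap.domDomCongr_apply]
    congr 1
    exact Fintype.sum_equiv (Equiv.mulLeft τ) _ _ fun σ => rfl⟩
  map_add' p q := by
    ext v
    simp [Finset.sum_add_distrib]
  map_smul' c p := by
    ext v
    simp only [Submodule.coe_smul, _root_.smul_apply, _root_.sum_apply,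
      ContinuousMultilinearMap.domDomCongr_apply, RingHom.id_apply, ← Finset.smul_sum]
    exact smul_comm _ _ _
  cont := by
    refine Continuous.subtype_mk ?_ _
    refine Continuous.const_smul (g := fun p : X [×j]→L[ℝ] Y =>
      ∑ σ : Equiv.Perm (Fin j), p.domDomCongr σ) ?_ ((j.factorial : ℝ)⁻¹)
    refine continuous_finsetSum _ fun σ _ => ?_
    exact (ContinuousMultilinearMap.domDomCongrₗᵢ ℝ X Y σ).continuous

theorem symmetrize_of_mem {j : ℕ} {p : X [×j]→L[ℝ] Y} (hp : p ∈ SymMult X Y j) :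
    (symmetrize X Y j p : X [×j]→L[ℝ] Y) = p := by
  ext v
  have h : ∀ σ : Equiv.Perm (Fin j), p (fun i => v (σ i)) = p v := fun σ => hp σ v
  show (((j.factorial : ℝ)⁻¹) • ∑ σ : Equiv.Perm (Fin j), p.domDomCongr σ) v = p v
  simp only [_root_.smul_apply, _root_.sum_apply,
      ContinuousMultilinearMap.domDomCongr_apply]
  rw [Finset.sum_congr rfl fun σ _ => h σ, Finset.sum_const, Finset.card_univ,
    Fintype.card_perm, Fintype.card_fin, ← Nat.cast_smul_eq_nsmul ℝ, smul_smul,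
    inv_mul_cancel₀ (by exact_mod_cast (Nat.factorial_ne_zero _)), one_smul]

theorem contDiff_symmetrize (j : ℕ) :
    ContDiff ℝ ∞ (fun p : X [×j]→L[ℝ] Y => symmetrize X Y j p) :=
  ContinuousLinearMap.contDiff _

end Symmetrization

section Taylor

variable {X Y : Type*} [NormedAddCommGroup X] [NormedSpace ℝ X]
  [NormedAddCommGroup Y] [NormedSpace ℝ Y] {k : ℕ}

theorem contDiff_taylorPoly_right (p : JetFib X Y k) (a : X) :
    ContDiff ℝ ∞ (taylorPoly p a) :=
  contDiff_taylorPoly.comp (contDiff_const.prodMk contDiff_id : ContDiff ℝ ∞ fun b => ((a, p), b))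

theorem taylorPoly_self (p : JetFib X Y k) (a : X) :
    taylorPoly p a a = (p 0 : X [×((0 : Fin (k + 1)) : ℕ)]→L[ℝ] Y) 0 := by
  have h := iteratedFDeriv_taylorPoly p a 0
  rw [← h]
  rfl

end Taylor

section Jets

variable {X Y A M E F : Type*}
  [NormedAddCommGroup X] [NormedSpace ℝ X] [NormedAddCommGroup Y] [NormedSpace ℝ Y]
  [NormedAddCommGroup A] [NormedSpace ℝ A]
  [TopologicalSpace M] [ChartedSpace X M] [TopologicalSpace E] [ChartedSpace A E]
  [TopologicalSpace F] [ChartedSpace Y F]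
  {π : SmoothFiberBundle X Y A M E F}

/-- A smooth local section of `π` near the point `base` (values far from `base` are irrelevant). -/
structure SectionAt (π : SmoothFiberBundle X Y A M E F) where
  base : M
  toFun : M → E
  smooth : ∀ᶠ y in 𝓝 base, ContMDiffAt 𝓘(ℝ, X) 𝓘(ℝ, A) ∞ toFun y
  isSection : ∀ᶠ y in 𝓝 base, π.proj (toFun y) = y

/-- The value of a local section at its base point. -/
def SectionAt.value (s : SectionAt π) : E := s.toFun s.base

theorem SectionAt.proj_value (s : SectionAt π) : π.proj s.value = s.base :=
  s.isSection.self_of_nhds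

namespace BundleChart

variable (c c' : BundleChart π)

/-- Coordinate expression of a section. -/
def rep (s : M → E) : X → Y := fun a => (c.total (s (c.base.symm a))).2

theorem base_trans {x : M} (hx : x ∈ c.base.source) (hx' : x ∈ c'.base.source) :
    ContDiffAt ℝ ∞ (c'.base ∘ c.base.symm) (c.base x) := by
  have h1 := contMDiffAt_symm_of_mem_maximalAtlas c.base_mem (c.base.map_source hx)
  have h2 : ContMDiffAt 𝓘(ℝ, X) 𝓘(ℝ, X) ∞ c'.base (c.base.symm (c.base x)) := by
    rw [c.base.left_inv hx]; exact contMDiffAt_of_mem_maximalAtlas c'.base_mem hx'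
  exact (h2.comp _ h1).contDiffAt

theorem total_trans {e : E} (he : e ∈ c.total.source) (he' : e ∈ c'.total.source) :
    ContDiffAt ℝ ∞ (c'.total ∘ c.total.symm) (c.total e) := by
  have h1 := (c.smooth_symm _ (c.total.map_source he)).contMDiffAt
    (c.total.open_target.mem_nhds (c.total.map_source he))
  have h2 : ContMDiffAt 𝓘(ℝ, A) 𝓘(ℝ, X × Y) ∞ c'.total (c.total.symm (c.total e)) := by
    rw [c.total.left_inv he]
    exact (c'.smooth _ he').contMDiffAt (c'.total.open_source.mem_nhds he')
  exact (h2.comp _ h1).contDiffAt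

theorem base_mem_source {s : SectionAt π} (hs : s.value ∈ c.total.source) :
    s.base ∈ c.base.source := by
  rw [← s.proj_value]; exact c.maps _ hs

theorem eventually_mem {s : SectionAt π} (hs : s.value ∈ c.total.source) :
    ∀ᶠ y in 𝓝 s.base, s.toFun y ∈ c.total.source :=
  s.smooth.self_of_nhds.continuousAt.eventually_mem (c.total.open_source.mem_nhds hs)

theorem tendsto_symm {x : M} (hx : x ∈ c.base.source) :
    Tendsto c.base.symm (𝓝 (c.base x)) (𝓝 x) := by
  have := c.base.continuousAt_symm (c.base.map_source hx)
  rwa [ContinuousAt, c.base.left_inv hx] at this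

theorem fst_mem_target {q : X × Y} (hq : q ∈ c.total.target) : q.1 ∈ c.base.target := by
  have h := c.compat _ (c.total.map_target hq)
  rw [c.total.right_inv hq] at h
  rw [h]
  exact c.base.map_source (c.maps _ (c.total.map_target hq))

theorem rep_smooth {s : SectionAt π} (hs : s.value ∈ c.total.source) :
    ∀ᶠ a in 𝓝 (c.base s.base), ContDiffAt ℝ ∞ (c.rep s.toFun) a := by
  have hb := c.base_mem_source hs
  filter_upwards [(c.tendsto_symm hb).eventually s.smooth,
    (c.tendsto_symm hb).eventually (c.eventually_mem hs),
    c.base.open_target.mem_nhds (c.base.map_source hb)] with a h1 h2 h3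
  have h4 := contMDiffAt_symm_of_mem_maximalAtlas c.base_mem h3
  have h5 := (c.smooth _ h2).contMDiffAt (c.total.open_source.mem_nhds h2)
  have h6 := ((h5.comp _ h1).comp _ h4).contDiffAt
  exact contDiffAt_snd.comp a h6

theorem rep_change {s : SectionAt π} (hs : s.value ∈ c.total.source)
    (hs' : s.value ∈ c'.total.source) :
    c'.rep s.toFun =ᶠ[𝓝 (c'.base s.base)] fun b =>
      ((c'.total ∘ c.total.symm) (((c.base ∘ c'.base.symm) b),
        c.rep s.toFun ((c.base ∘ c'.base.symm) b))).2 := by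
  have hb := c.base_mem_source hs
  have hb' := c'.base_mem_source hs'
  filter_upwards [(c'.tendsto_symm hb').eventually s.isSection,
    (c'.tendsto_symm hb').eventually (c.eventually_mem hs),
    (c'.tendsto_symm hb').eventually (c.base.open_source.mem_nhds hb)] with b h1 h2 h3
  have h4 : c.base.symm (c.base (c'.base.symm b)) = c'.base.symm b := c.base.left_inv h3
  have h5 : c.total (s.toFun (c'.base.symm b)) =
      (c.base (c'.base.symm b), (c.total (s.toFun (c'.base.symm b))).2) := by
    refine Prod.ext ?_ rfl
    rw [c.compat _ h2, h1]
  simp only [rep, Function.comp, h4]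
  rw [← h5, c.total.left_inv h2]

/-- Agreement of derivatives up to order `k` does not depend on the bundle chart. -/
theorem iteratedFDeriv_rep_congr {s t : SectionAt π} {k : ℕ} (hst : s.base = t.base)
    (hv : s.value = t.value) (hs : s.value ∈ c.total.source) (hs' : s.value ∈ c'.total.source)
    (h : ∀ j ≤ k, iteratedFDeriv ℝ j (c.rep s.toFun) (c.base s.base) =
      iteratedFDeriv ℝ j (c.rep t.toFun) (c.base t.base)) {j : ℕ} (hj : j ≤ k) :
    iteratedFDeriv ℝ j (c'.rep s.toFun) (c'.base s.base) =
      iteratedFDeriv ℝ j (c'.rep t.toFun) (c'.base t.base) := by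
  have hb := c.base_mem_source hs
  have hb' := c'.base_mem_source hs'
  have e0 : (c.base ∘ c'.base.symm) (c'.base s.base) = c.base s.base := by
    simp only [Function.comp]; rw [c'.base.left_inv hb']
  have main : ∀ u : SectionAt π, u.base = s.base → u.value = s.value →
      (ContDiffAt ℝ ∞ (fun b => (b, c.rep u.toFun b)) (c.base s.base)) ∧
      c.total s.value = (c.base s.base, c.rep u.toFun (c.base s.base)) ∧
      (c'.rep u.toFun =ᶠ[𝓝 (c'.base s.base)] (fun p => ((c'.total ∘ c.total.symm) p).2) ∘
        ((fun b => (b, c.rep u.toFun b)) ∘ (c.base ∘ c'.base.symm))) := by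
    intro u hu hu'
    have k1 := (c.rep_smooth (s := u) (hu' ▸ hs)).self_of_nhds
    have k2 := c.rep_change c' (s := u) (hu' ▸ hs) (hu' ▸ hs')
    rw [hu] at k1 k2
    refine ⟨contDiffAt_id.prodMk k1, ?_, k2⟩
    refine Prod.ext ?_ ?_
    · show _ = c.base s.base
      rw [c.compat _ hs, s.proj_value]
    · show _ = c.rep u.toFun (c.base s.base)
      simp only [rep]
      rw [c.base.left_inv hb, ← hu', ← hu]
      rfl
  obtain ⟨s1, s2, s3⟩ := main s rfl rfl
  obtain ⟨t1, t2, t3⟩ := main t hst.symm hv.symm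
  rw [← hst]
  rw [(Filter.EventuallyEq.iteratedFDeriv ℝ s3 j).eq_of_nhds,
    (Filter.EventuallyEq.iteratedFDeriv ℝ t3 j).eq_of_nhds]
  have hκ := c'.base_trans c hb' hb
  have hΨ : ContDiffAt ℝ ∞ (fun p => ((c'.total ∘ c.total.symm) p).2) (c.total s.value) :=
    contDiffAt_snd.comp _ (c.total_trans c' hs hs')
  refine iteratedFDeriv_comp_congr (k := k) ?_ ?_ ?_ ?_ hj
  · simp only [Function.comp] at e0 ⊢
    rw [e0, ← s2]; exact hΨ
  · exact ContDiffAt.comp _ (by rw [e0]; exact s1) hκ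
  · exact ContDiffAt.comp _ (by rw [e0]; exact t1) hκ
  · intro i hi
    refine iteratedFDeriv_comp_congr_right (k := k) (by rw [e0]; exact s1) (by rw [e0]; exact t1)
      hκ ?_ hi
    intro i hi
    have hprod : ∀ u : SectionAt π, ContDiffAt ℝ ∞ (fun b => (b, c.rep u.toFun b))
        (c.base s.base) → iteratedFDeriv ℝ i (fun b => (b, c.rep u.toFun b)) (c.base s.base) =
        (iteratedFDeriv ℝ i (fun b => b) (c.base s.base)).prod
          (iteratedFDeriv ℝ i (c.rep u.toFun) (c.base s.base)) := fun u hu =>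
      iteratedFDeriv_prodMk (n := ∞) contDiffAt_id (contDiffAt_snd.comp _ hu)
        (by exact_mod_cast le_top)
    have := h i hi
    rw [← hst] at this
    rw [e0, hprod s s1, hprod t t1, this]

end BundleChart

/-- Contact of order `k` of local sections at a point: same base point, same value, and same
derivatives up to order `k` in all bundle coordinates around the value. -/
def jetSetoid (π : SmoothFiberBundle X Y A M E F) (k : ℕ) : Setoid (SectionAt π) where
  r s t := s.base = t.base ∧ s.value = t.value ∧ ∀ c : BundleChart π, s.value ∈ c.total.source →
    ∀ j ≤ k, iteratedFDeriv ℝ j (c.rep s.toFun) (c.base s.base) =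
      iteratedFDeriv ℝ j (c.rep t.toFun) (c.base t.base)
  iseqv :=
    { refl := fun _ => ⟨rfl, rfl, fun _ _ _ _ => rfl⟩
      symm := fun h => ⟨h.1.symm, h.2.1.symm, fun c hc j hj => (h.2.2 c (h.2.1 ▸ hc) j hj).symm⟩
      trans := fun h h' => ⟨h.1.trans h'.1, h.2.1.trans h'.2.1, fun c hc j hj =>
        (h.2.2 c hc j hj).trans (h'.2.2 c (h.2.1 ▸ hc) j hj)⟩ }

/-- The space `J^k π` of `k`-jets of local sections of `π`. -/
def Jet (π : SmoothFiberBundle X Y A M E F) (k : ℕ) : Type _ := Quotient (jetSetoid π k)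

namespace Jet

variable {k : ℕ}

/-- The jet `j_k s (x)` of a local section `s` near `x`. -/
def mk (k : ℕ) (s : SectionAt π) : Jet π k := Quotient.mk (jetSetoid π k) s

/-- A local section representing a jet. -/
def rep (z : Jet π k) : SectionAt π := Quotient.out (s := jetSetoid π k) z

theorem mk_rep (z : Jet π k) : mk k z.rep = z := Quotient.out_eq (s := jetSetoid π k) z

/-- The projection `π_k : J^k π → M`. -/
def base (z : Jet π k) : M := Quotient.lift (s := jetSetoid π k) SectionAt.base
  (fun _ _ h => h.1) z

/-- The projection `π_{k,0} : J^k π → E`. -/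
def value (z : Jet π k) : E := Quotient.lift (s := jetSetoid π k) SectionAt.value
  (fun _ _ h => h.2.1) z

/-- The projection `π_{k+1,k} : J^{k+1} π → J^k π`. -/
def trunc (z : Jet π (k + 1)) : Jet π k := Quotient.lift (s := jetSetoid π (k + 1)) (mk k)
  (fun _ _ h => Quotient.sound (s := jetSetoid π k)
    ⟨h.1, h.2.1, fun c hc j hj => h.2.2 c hc j (hj.trans (Nat.le_succ k))⟩) z

@[simp] theorem base_mk (s : SectionAt π) : (mk k s).base = s.base := rfl
@[simp] theorem value_mk (s : SectionAt π) : (mk k s).value = s.value := rfl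
@[simp] theorem trunc_mk (s : SectionAt π) : (mk (k + 1) s).trunc = mk k s := rfl
theorem base_trunc (z : Jet π (k + 1)) : z.trunc.base = z.base := by
  rw [← mk_rep z]; rfl
theorem value_trunc (z : Jet π (k + 1)) : z.trunc.value = z.value := by
  rw [← mk_rep z]; rfl
theorem proj_value (z : Jet π k) : π.proj z.value = z.base := by
  rw [← mk_rep z]; exact z.rep.proj_value

theorem mk_eq_iff {s t : SectionAt π} : mk k s = mk k t ↔ (jetSetoid π k).r s t :=
  Quotient.eq (r := jetSetoid π k)

/-- Coordinates of a local section: the base point and the derivatives up to order `k`. -/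
def secCoord (c : BundleChart π) (k : ℕ) (s : SectionAt π) : X × JetFib X Y k :=
  (c.base s.base, fun j => symmetrize X Y j (iteratedFDeriv ℝ j (c.rep s.toFun) (c.base s.base)))

theorem secCoord_coe {c : BundleChart π} {s : SectionAt π} (hs : s.value ∈ c.total.source)
    (j : Fin (k + 1)) :
    ((secCoord c k s).2 j : X [×(j : ℕ)]→L[ℝ] Y) =
      iteratedFDeriv ℝ j (c.rep s.toFun) (c.base s.base) :=
  symmetrize_of_mem fun σ v => iteratedFDeriv_perm (c.rep_smooth hs) σ v

/-- Jet coordinates on `J^k π` associated with bundle coordinates. -/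
def coord (c : BundleChart π) (z : Jet π k) : X × JetFib X Y k := secCoord c k z.rep

theorem coord_mk (c : BundleChart π) {s : SectionAt π} (hs : s.value ∈ c.total.source) :
    coord c (mk k s) = secCoord c k s := by
  have h : (jetSetoid π k).r s (mk k s).rep := mk_eq_iff.1 (mk_rep (mk k s)).symm
  unfold coord secCoord
  refine Prod.ext ?_ ?_
  · show c.base _ = c.base _
    rw [h.1]
  · funext j
    show symmetrize X Y j _ = symmetrize X Y j _
    rw [h.2.2 c hs j (Nat.lt_succ_iff.1 j.2)]

/-- The local section with prescribed Taylor polynomial in bundle coordinates. -/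
def taylorSection (c : BundleChart π) (q : X × JetFib X Y k)
    (hq : (q.1, taylorPoly q.2 q.1 q.1) ∈ c.total.target) : SectionAt π where
  base := c.base.symm q.1
  toFun y := c.total.symm (c.base y, taylorPoly q.2 q.1 (c.base y))
  smooth := by
    have hb : q.1 ∈ c.base.target := c.fst_mem_target hq
    have hx : c.base.symm q.1 ∈ c.base.source := c.base.map_target hb
    have h1 : ∀ᶠ y in 𝓝 (c.base.symm q.1),
        (c.base y, taylorPoly q.2 q.1 (c.base y)) ∈ c.total.target := by
      have h2 : ContinuousAt (fun y => (c.base y, taylorPoly q.2 q.1 (c.base y)))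
          (c.base.symm q.1) :=
        (c.base.continuousAt hx).prodMk
          (ContinuousAt.comp (g := taylorPoly q.2 q.1)
            (contDiff_taylorPoly_right q.2 q.1).continuous.continuousAt (c.base.continuousAt hx))
      refine h2.eventually_mem (c.total.open_target.mem_nhds ?_)
      simp only [c.base.right_inv hb]
      exact hq
    filter_upwards [h1, c.base.open_source.mem_nhds hx] with y hy hy'
    have h3 := contMDiffAt_of_mem_maximalAtlas c.base_mem hy'
    have h4 : ContMDiffAt 𝓘(ℝ, X) 𝓘(ℝ, X × Y) ∞ (fun a => (a, taylorPoly q.2 q.1 a)) (c.base y) :=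
      (contDiff_id.prodMk (contDiff_taylorPoly_right q.2 q.1)).contMDiff.contMDiffAt
    have h5 := (c.smooth_symm _ hy).contMDiffAt (c.total.open_target.mem_nhds hy)
    exact ContMDiffAt.comp y (g := c.total.symm) h5 (ContMDiffAt.comp y h4 h3)
  isSection := by
    have hb : q.1 ∈ c.base.target := c.fst_mem_target hq
    have hx : c.base.symm q.1 ∈ c.base.source := c.base.map_target hb
    have h1 : ∀ᶠ y in 𝓝 (c.base.symm q.1),
        (c.base y, taylorPoly q.2 q.1 (c.base y)) ∈ c.total.target := by
      have h2 : ContinuousAt (fun y => (c.base y, taylorPoly q.2 q.1 (c.base y)))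
          (c.base.symm q.1) :=
        (c.base.continuousAt hx).prodMk
          (ContinuousAt.comp (g := taylorPoly q.2 q.1)
            (contDiff_taylorPoly_right q.2 q.1).continuous.continuousAt (c.base.continuousAt hx))
      refine h2.eventually_mem (c.total.open_target.mem_nhds ?_)
      simp only [c.base.right_inv hb]
      exact hq
    filter_upwards [h1, c.base.open_source.mem_nhds hx] with y hy hy'
    have h3 := c.compat _ (c.total.map_target hy)
    rw [c.total.right_inv hy] at h3
    exact (c.base.injOn hy' (c.maps _ (c.total.map_target hy)) h3).symm

theorem taylorSection_value (c : BundleChart π) (q : X × JetFib X Y k)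
    (hq : (q.1, taylorPoly q.2 q.1 q.1) ∈ c.total.target) :
    (taylorSection c q hq).value = c.total.symm (q.1, taylorPoly q.2 q.1 q.1) := by
  show c.total.symm (c.base (c.base.symm q.1), _) = _
  simp only [taylorSection]
  rw [c.base.right_inv (c.fst_mem_target hq)]

theorem taylorSection_mem (c : BundleChart π) (q : X × JetFib X Y k)
    (hq : (q.1, taylorPoly q.2 q.1 q.1) ∈ c.total.target) :
    (taylorSection c q hq).value ∈ c.total.source := by
  rw [taylorSection_value]; exact c.total.map_target hq

theorem rep_taylorSection (c : BundleChart π) (q : X × JetFib X Y k)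
    (hq : (q.1, taylorPoly q.2 q.1 q.1) ∈ c.total.target) :
    c.rep (taylorSection c q hq).toFun =ᶠ[𝓝 q.1] taylorPoly q.2 q.1 := by
  have hb : q.1 ∈ c.base.target := c.fst_mem_target hq
  have h2 : ContinuousAt (fun a => (a, taylorPoly q.2 q.1 a)) q.1 :=
    (continuous_id.prodMk (contDiff_taylorPoly_right q.2 q.1).continuous).continuousAt
  filter_upwards [h2.eventually_mem (c.total.open_target.mem_nhds hq),
    c.base.open_target.mem_nhds hb] with a ha ha'
  simp only [BundleChart.rep, taylorSection]
  rw [c.base.right_inv ha', c.total.right_inv ha]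

theorem secCoord_taylorSection (c : BundleChart π) (q : X × JetFib X Y k)
    (hq : (q.1, taylorPoly q.2 q.1 q.1) ∈ c.total.target) :
    secCoord c k (taylorSection c q hq) = q := by
  have hb : c.base (taylorSection c q hq).base = q.1 := c.base.right_inv (c.fst_mem_target hq)
  refine Prod.ext hb ?_
  funext j
  apply Subtype.ext
  rw [secCoord_coe (taylorSection_mem c q hq), hb,
    (Filter.EventuallyEq.iteratedFDeriv ℝ (rep_taylorSection c q hq) j).eq_of_nhds,
    iteratedFDeriv_taylorPoly]

theorem taylorPoly_secCoord (c : BundleChart π) {s : SectionAt π} (hs : s.value ∈ c.total.source) :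
    ((secCoord c k s).1, taylorPoly (secCoord c k s).2 (secCoord c k s).1 (secCoord c k s).1) =
      c.total s.value := by
  refine Prod.ext ?_ ?_
  · show c.base s.base = _
    rw [c.compat _ hs, s.proj_value]
  · rw [taylorPoly_self, secCoord_coe hs]
    show (c.total (s.toFun (c.base.symm (c.base s.base)))).2 = _
    rw [c.base.left_inv (c.base_mem_source hs)]
    rfl

open Classical in
/-- The jet chart of a bundle chart. The jet `z₀` only supplies values off the target. -/
def chart (c : BundleChart π) (z₀ : Jet π k) : PartialEquiv (Jet π k) (X × JetFib X Y k) where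
  toFun := coord c
  invFun q := if h : (q.1, taylorPoly q.2 q.1 q.1) ∈ c.total.target then
    mk k (taylorSection c q h) else z₀
  source := {z | z.value ∈ c.total.source}
  target := {q | (q.1, taylorPoly q.2 q.1 q.1) ∈ c.total.target}
  map_source' z hz := by
    have hz : z.rep.value ∈ c.total.source := by
      rw [← mk_rep z] at hz; exact hz
    show (((coord c z).1, taylorPoly (coord c z).2 (coord c z).1 (coord c z).1) : X × Y) ∈
      c.total.target
    unfold coord
    rw [taylorPoly_secCoord c hz]
    exact c.total.map_source hz
  map_target' q hq := by
    have hq : (q.1, taylorPoly q.2 q.1 q.1) ∈ c.total.target := hq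
    rw [dif_pos hq]
    exact taylorSection_mem c q hq
  left_inv' z hz := by
    have hz : z.rep.value ∈ c.total.source := by
      rw [← mk_rep z] at hz; exact hz
    have hq : ((coord c z).1, taylorPoly (coord c z).2 (coord c z).1 (coord c z).1) ∈
        c.total.target := by
      unfold coord
      rw [taylorPoly_secCoord c hz]
      exact c.total.map_source hz
    rw [dif_pos hq]
    conv_rhs => rw [← mk_rep z]
    rw [mk_eq_iff]
    have hs := taylorSection_mem c (coord c z) hq
    have e1 : (taylorSection c (coord c z) hq).base = z.rep.base :=
      c.base.left_inv (c.base_mem_source hz)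
    have e2 : (taylorSection c (coord c z) hq).value = z.rep.value := by
      rw [taylorSection_value]
      unfold coord
      rw [taylorPoly_secCoord c hz, c.total.left_inv hz]
    refine ⟨e1, e2, fun c' hc' j hj => ?_⟩
    refine BundleChart.iteratedFDeriv_rep_congr c c' (k := k) e1 e2 hs hc' ?_ hj
    intro i hi
    have h1 := secCoord_coe (k := k) hs ⟨i, Nat.lt_succ_of_le hi⟩
    have h2 := secCoord_coe (k := k) hz ⟨i, Nat.lt_succ_of_le hi⟩
    rw [secCoord_taylorSection] at h1
    exact h1.symm.trans h2
  right_inv' q hq := by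
    have hq : (q.1, taylorPoly q.2 q.1 q.1) ∈ c.total.target := hq
    rw [dif_pos hq, coord_mk c (taylorSection_mem c q hq), secCoord_taylorSection]

theorem isOpen_target (c : BundleChart π) (z₀ : Jet π k) : IsOpen (chart c z₀).target :=
  c.total.open_target.preimage
    (continuous_fst.prodMk ((contDiff_taylorPoly (X := X) (Y := Y) (k := k)).continuous.comp
      (continuous_id.prodMk continuous_fst)))

theorem chart_symm_of_mem (c : BundleChart π) (z₀ : Jet π k) {q : X × JetFib X Y k}
    (hq : (q.1, taylorPoly q.2 q.1 q.1) ∈ c.total.target) :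
    (chart c z₀).symm q = mk k (taylorSection c q hq) := dif_pos hq

theorem mem_trans_source (c c' : BundleChart π) (z₀ z₁ : Jet π k) (q : X × JetFib X Y k) :
    q ∈ ((chart c z₀).symm.trans (chart c' z₁)).source ↔
      (q.1, taylorPoly q.2 q.1 q.1) ∈ (c.total.symm.trans c'.total).source := by
  rw [PartialEquiv.trans_source, OpenPartialHomeomorph.trans_source]
  constructor
  · rintro ⟨h1, h2⟩
    have h1 : (q.1, taylorPoly q.2 q.1 q.1) ∈ c.total.target := h1
    refine ⟨h1, ?_⟩
    rw [mem_preimage, chart_symm_of_mem c z₀ h1] at h2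
    have h2 : (taylorSection c q h1).value ∈ c'.total.source := h2
    rwa [taylorSection_value] at h2
  · rintro ⟨h1, h2⟩
    have h1 : (q.1, taylorPoly q.2 q.1 q.1) ∈ c.total.target := h1
    refine ⟨h1, ?_⟩
    rw [mem_preimage, chart_symm_of_mem c z₀ h1]
    show (taylorSection c q h1).value ∈ c'.total.source
    rw [taylorSection_value]
    exact h2

theorem trans_smooth (c c' : BundleChart π) (z₀ z₁ : Jet π k) :
    ContDiffOn ℝ ∞ ((chart c z₀).symm.trans (chart c' z₁))
      ((chart c z₀).symm.trans (chart c' z₁)).source := by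
  intro q hq
  have hq' := (mem_trans_source c c' z₀ z₁ q).1 hq
  rw [OpenPartialHomeomorph.trans_source] at hq'
  have hq1 : (q.1, taylorPoly q.2 q.1 q.1) ∈ c.total.target := hq'.1
  have hq2 : c.total.symm (q.1, taylorPoly q.2 q.1 q.1) ∈ c'.total.source := hq'.2
  have hval := taylorSection_value c q hq1
  have hs : (taylorSection c q hq1).value ∈ c.total.source := taylorSection_mem c q hq1
  have hs' : (taylorSection c q hq1).value ∈ c'.total.source := hval ▸ hq2
  have hb : c.base.symm q.1 ∈ c.base.source := c.base_mem_source hs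
  have hb' : c.base.symm q.1 ∈ c'.base.source := c'.base_mem_source hs'
  have hbt : c.base (c.base.symm q.1) = q.1 := c.base.right_inv (c.fst_mem_target hq1)
  have hβ : ContDiffAt ℝ ∞ (c'.base ∘ c.base.symm) q.1 := by
    have := c.base_trans c' hb hb'
    rwa [hbt] at this
  have hκ : ContDiffAt ℝ ∞ (c.base ∘ c'.base.symm) (c'.base (c.base.symm q.1)) :=
    c'.base_trans c hb' hb
  have hκv : (c.base ∘ c'.base.symm) (c'.base (c.base.symm q.1)) = q.1 := by
    simp only [Function.comp]; rw [c'.base.left_inv hb', hbt]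
  have hΨ : ContDiffAt ℝ ∞ (c'.total ∘ c.total.symm) (q.1, taylorPoly q.2 q.1 q.1) := by
    have := c.total_trans c' hs hs'
    rwa [hval, c.total.right_inv hq1] at this
  let G : X × JetFib X Y k → X → Y := fun r b =>
    ((c'.total ∘ c.total.symm) ((c.base ∘ c'.base.symm) b,
      taylorPoly r.2 r.1 ((c.base ∘ c'.base.symm) b))).2
  have hG : ContDiffAt ℝ ∞ (Function.uncurry G) (q, (c'.base ∘ c.base.symm) q.1) := by
    have k1 : ContDiffAt ℝ ∞ (fun r : (X × JetFib X Y k) × X => (c.base ∘ c'.base.symm) r.2)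
        (q, (c'.base ∘ c.base.symm) q.1) :=
      ContDiffAt.comp (q, (c'.base ∘ c.base.symm) q.1) (g := c.base ∘ c'.base.symm) hκ
        contDiffAt_snd
    have k2 : ContDiffAt ℝ ∞ (fun r : (X × JetFib X Y k) × X =>
        taylorPoly r.1.2 r.1.1 ((c.base ∘ c'.base.symm) r.2))
        (q, (c'.base ∘ c.base.symm) q.1) :=
      contDiff_taylorPoly.contDiffAt.comp (q, (c'.base ∘ c.base.symm) q.1)
        (contDiffAt_fst.prodMk k1)
    refine contDiffAt_snd.comp _ (ContDiffAt.comp (q, (c'.base ∘ c.base.symm) q.1)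
      (g := c'.total ∘ c.total.symm) ?_ (k1.prodMk k2))
    simp only [Function.comp] at hκv hΨ ⊢
    rw [hκv]
    exact hΨ
  have hmain : ContDiffAt ℝ ∞ (fun r : X × JetFib X Y k =>
      (((c'.base ∘ c.base.symm) r.1, fun j : Fin (k + 1) => symmetrize X Y j
        (iteratedFDeriv ℝ j (G r) ((c'.base ∘ c.base.symm) r.1))) : X × JetFib X Y k)) q := by
    have k1 : ContDiffAt ℝ ∞ (fun r : X × JetFib X Y k => (c'.base ∘ c.base.symm) r.1) q :=
      ContDiffAt.comp q (g := c'.base ∘ c.base.symm) hβ contDiffAt_fst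
    refine k1.prodMk (contDiffAt_pi.2 fun j => ?_)
    have k2 := contDiffAt_iteratedFDeriv_comp (G := G)
      (β := fun r : X × JetFib X Y k => (c'.base ∘ c.base.symm) r.1) (j : ℕ) hG k1
    exact (contDiff_symmetrize (X := X) (Y := Y) (j : ℕ)).contDiffAt.comp q k2
  refine hmain.contDiffWithinAt.congr_of_mem ?_ hq
  intro r hr
  have hr' := (mem_trans_source c c' z₀ z₁ r).1 hr
  rw [OpenPartialHomeomorph.trans_source] at hr'
  have hr1 : (r.1, taylorPoly r.2 r.1 r.1) ∈ c.total.target := hr'.1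
  have hr2 : (taylorSection c r hr1).value ∈ c'.total.source := by
    rw [taylorSection_value]; exact hr'.2
  show coord c' ((chart c z₀).symm r) = _
  rw [chart_symm_of_mem c z₀ hr1, coord_mk c' hr2]
  rfl

open Classical in
/-- The jet prolongation `j_k s` of a local section (constant where `s` is not a section). -/
def prolong (k : ℕ) (s : SectionAt π) (x : M) : Jet π k :=
  if h : (∀ᶠ y in 𝓝 x, ContMDiffAt 𝓘(ℝ, X) 𝓘(ℝ, A) ∞ s.toFun y) ∧
      (∀ᶠ y in 𝓝 x, π.proj (s.toFun y) = y) then mk k ⟨x, s.toFun, h.1, h.2⟩ else mk k s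

theorem prolong_base (s : SectionAt π) : prolong k s s.base = mk k s :=
  dif_pos ⟨s.smooth, s.isSection⟩

theorem base_prolong (s : SectionAt π) : ∀ᶠ y in 𝓝 s.base, (prolong k s y).base = y := by
  filter_upwards [s.smooth.eventually_nhds, s.isSection.eventually_nhds] with y h1 h2
  have e : prolong k s y = mk k ⟨y, s.toFun, h1, h2⟩ := dif_pos ⟨h1, h2⟩
  rw [e]
  rfl

variable [IsManifold 𝓘(ℝ, X) ∞ M] [IsManifold 𝓘(ℝ, Y) ∞ F]

/-- The smooth atlas of jet coordinates on `J^k π`. -/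
def atlas (π : SmoothFiberBundle X Y A M E F) (k : ℕ) :
    SmoothAtlas (X × JetFib X Y k) (Jet π k) where
  Index := BundleChart π × Jet π k
  chart i := chart i.1 i.2
  index z := ((exists_bundleChart π z.value).choose, z)
  mem_source z := (exists_bundleChart π z.value).choose_spec
  open_source i j := by
    have : ((chart i.1 i.2).symm.trans (chart j.1 j.2)).source =
        (fun q : X × JetFib X Y k => (q.1, taylorPoly q.2 q.1 q.1)) ⁻¹'
          (i.1.total.symm.trans j.1.total).source := by
      ext q; exact mem_trans_source _ _ _ _ q
    rw [this]
    exact (i.1.total.symm.trans j.1.total).open_source.preimage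
      (continuous_fst.prodMk ((contDiff_taylorPoly (X := X) (Y := Y) (k := k)).continuous.comp
        (continuous_id.prodMk continuous_fst)))
  smooth i j := trans_smooth _ _ _ _

instance : TopologicalSpace (Jet π k) := (atlas π k).topology
instance : ChartedSpace (X × JetFib X Y k) (Jet π k) := (atlas π k).chartedSpace
instance : IsManifold 𝓘(ℝ, X × JetFib X Y k) ∞ (Jet π k) := (atlas π k).isManifold

/-- Jet coordinates as an open partial homeomorphism. -/
def homeo (c : BundleChart π) (z₀ : Jet π k) :
    OpenPartialHomeomorph (Jet π k) (X × JetFib X Y k) := (atlas π k).homeo (c, z₀)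

theorem homeo_mem (c : BundleChart π) (z₀ : Jet π k) :
    homeo c z₀ ∈ IsManifold.maximalAtlas 𝓘(ℝ, X × JetFib X Y k) ∞ (Jet π k) :=
  (atlas π k).homeo_mem (c, z₀)

theorem contMDiff_base : ContMDiff 𝓘(ℝ, X × JetFib X Y k) 𝓘(ℝ, X) ∞ (base : Jet π k → M) := by
  intro z
  obtain ⟨c, hc⟩ := exists_bundleChart π z.value
  refine contMDiffAt_of_charts (homeo c z) c.base (homeo_mem c z) c.base_mem hc Prod.fst
    contDiffAt_fst ?_
  filter_upwards [(homeo c z).open_source.mem_nhds hc] with y hy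
  have hy : y.value ∈ c.total.source := hy
  refine ⟨?_, ?_⟩
  · rw [← proj_value]; exact c.maps _ hy
  · conv_lhs => rw [← mk_rep y]
    rfl

theorem contMDiff_trunc : ContMDiff 𝓘(ℝ, X × JetFib X Y (k + 1)) 𝓘(ℝ, X × JetFib X Y k) ∞
    (trunc : Jet π (k + 1) → Jet π k) := by
  intro z
  obtain ⟨c, hc⟩ := exists_bundleChart π z.value
  refine contMDiffAt_of_charts (homeo c z) (homeo c z.trunc) (homeo_mem c z) (homeo_mem c _) hc
    (fun q => (q.1, fun j => q.2 j.castSucc)) ?_ ?_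
  · refine contDiffAt_fst.prodMk (contDiffAt_pi.2 fun j => ?_)
    exact (contDiffAt_pi.1 (contDiffAt_snd :
      ContDiffAt ℝ ∞ (Prod.snd : X × JetFib X Y (k + 1) → JetFib X Y (k + 1)) _) j.castSucc)
  filter_upwards [(homeo c z).open_source.mem_nhds hc] with y hy
  have hy : y.value ∈ c.total.source := hy
  refine ⟨?_, ?_⟩
  · show y.trunc.value ∈ c.total.source
    rw [value_trunc]; exact hy
  · show coord c y.trunc = _
    have hy' : y.rep.value ∈ c.total.source := by rw [← mk_rep y] at hy; exact hy
    conv_lhs => rw [← mk_rep y]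
    rw [trunc_mk, coord_mk c hy']
    rfl

theorem contMDiffAt_prolong (s : SectionAt π) :
    ContMDiffAt 𝓘(ℝ, X) 𝓘(ℝ, X × JetFib X Y k) ∞ (prolong k s) s.base := by
  obtain ⟨c, hc⟩ := exists_bundleChart π s.value
  have hb := c.base_mem_source hc
  refine contMDiffAt_of_charts c.base (homeo c (mk k s)) c.base_mem (homeo_mem c _) hb
    (fun a => (a, fun j => symmetrize X Y j (iteratedFDeriv ℝ j (c.rep s.toFun) a))) ?_ ?_
  · refine contDiffAt_id.prodMk (contDiffAt_pi.2 fun j => ?_)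
    exact (contDiff_symmetrize (j : ℕ)).contDiffAt.comp _
      ((c.rep_smooth hc).self_of_nhds.iteratedFDeriv_right (m := ∞) (i := (j : ℕ)) (by exact_mod_cast le_top))
  · filter_upwards [s.smooth.eventually_nhds, s.isSection.eventually_nhds, c.eventually_mem hc]
      with y h1 h2 h3
    have e : prolong k s y = mk k ⟨y, s.toFun, h1, h2⟩ := dif_pos ⟨h1, h2⟩
    rw [e]
    refine ⟨h3, ?_⟩
    show coord c _ = _
    rw [coord_mk (s := ⟨y, s.toFun, h1, h2⟩) c h3]
    rfl

end Jet
end Jets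

section ChartDerivative

variable {V N : Type*} [NormedAddCommGroup V] [NormedSpace ℝ V]
  [TopologicalSpace N] [ChartedSpace V N]

theorem mdifferentiable_of_mem {e : OpenPartialHomeomorph N V}
    (he : e ∈ IsManifold.maximalAtlas 𝓘(ℝ, V) ∞ N) :
    e.MDifferentiable 𝓘(ℝ, V) 𝓘(ℝ, V) :=
  ⟨(contMDiffOn_of_mem_maximalAtlas he).mdifferentiableOn (by simp),
    (contMDiffOn_symm_of_mem_maximalAtlas he).mdifferentiableOn (by simp)⟩

/-- The differential at `x` of a chart, as a map to the model space. -/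
def dchart (e : OpenPartialHomeomorph N V) (x : N) : TangentSpace 𝓘(ℝ, V) x →L[ℝ] V :=
  mfderiv 𝓘(ℝ, V) 𝓘(ℝ, V) e x

theorem dchart_invertible [IsManifold 𝓘(ℝ, V) ∞ N] {e : OpenPartialHomeomorph N V}
    (he : e ∈ IsManifold.maximalAtlas 𝓘(ℝ, V) ∞ N) {x : N} (hx : x ∈ e.source) :
    (dchart e x).IsInvertible :=
  ⟨(mdifferentiable_of_mem he).mfderiv hx, rfl⟩

/-- The inverse differential of a chart. -/
def dchartInv (e : OpenPartialHomeomorph N V) (x : N) : V →L[ℝ] TangentSpace 𝓘(ℝ, V) x :=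
  (dchart e x).inverse

variable [IsManifold 𝓘(ℝ, V) ∞ N] 

theorem dchart_dchartInv {e : OpenPartialHomeomorph N V}
    (he : e ∈ IsManifold.maximalAtlas 𝓘(ℝ, V) ∞ N) {x : N} (hx : x ∈ e.source) (v : V) :
    dchart e x (dchartInv e x v) = v := by
  obtain ⟨L, hL⟩ := dchart_invertible he hx
  unfold dchartInv
  rw [← hL, ContinuousLinearMap.inverse_equiv]
  exact L.apply_symm_apply v

theorem dchartInv_dchart {e : OpenPartialHomeomorph N V}
    (he : e ∈ IsManifold.maximalAtlas 𝓘(ℝ, V) ∞ N) {x : N} (hx : x ∈ e.source)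
    (v : TangentSpace 𝓘(ℝ, V) x) :
    dchartInv e x (dchart e x v) = v := by
  obtain ⟨L, hL⟩ := dchart_invertible he hx
  unfold dchartInv
  rw [← hL, ContinuousLinearMap.inverse_equiv]
  exact L.symm_apply_apply v

theorem contDiffAt_trans {e e' : OpenPartialHomeomorph N V}
    (he : e ∈ IsManifold.maximalAtlas 𝓘(ℝ, V) ∞ N)
    (he' : e' ∈ IsManifold.maximalAtlas 𝓘(ℝ, V) ∞ N) {x : N} (hx : x ∈ e.source)
    (hx' : x ∈ e'.source) : ContDiffAt ℝ ∞ (e ∘ e'.symm) (e' x) := by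
  have h1 := contMDiffAt_symm_of_mem_maximalAtlas he' (e'.map_source hx')
  have h2 : ContMDiffAt 𝓘(ℝ, V) 𝓘(ℝ, V) ∞ e (e'.symm (e' x)) := by
    rw [e'.left_inv hx']; exact contMDiffAt_of_mem_maximalAtlas he hx
  exact (h2.comp _ h1).contDiffAt

theorem dchart_trans {e e' : OpenPartialHomeomorph N V}
    (he : e ∈ IsManifold.maximalAtlas 𝓘(ℝ, V) ∞ N)
    (he' : e' ∈ IsManifold.maximalAtlas 𝓘(ℝ, V) ∞ N) {x : N} (hx : x ∈ e.source)
    (hx' : x ∈ e'.source) :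
    (dchart e x).comp (dchartInv e' x) = fderiv ℝ (e ∘ e'.symm) (e' x) := by
  have h1 : MDifferentiableAt 𝓘(ℝ, V) 𝓘(ℝ, V) (e ∘ e'.symm) (e' x) :=
    ((contDiffAt_trans he he' hx hx').differentiableAt (by simp)).mdifferentiableAt
  have h2 : MDifferentiableAt 𝓘(ℝ, V) 𝓘(ℝ, V) e' x :=
    (contMDiffAt_of_mem_maximalAtlas he' hx').mdifferentiableAt (by simp)
  have h3 : mfderiv 𝓘(ℝ, V) 𝓘(ℝ, V) ((e ∘ e'.symm) ∘ e') x = mfderiv 𝓘(ℝ, V) 𝓘(ℝ, V) e x := by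
    apply Filter.EventuallyEq.mfderiv_eq
    filter_upwards [e'.open_source.mem_nhds hx'] with y hy
    simp only [Function.comp]
    rw [e'.left_inv hy]
  have h4 := mfderiv_comp x h1 h2
  rw [mfderiv_eq_fderiv] at h4
  ext v
  show dchart e x (dchartInv e' x v) = _
  have h5 : ∀ u, dchart e x u = fderiv ℝ (e ∘ e'.symm) (e' x) (dchart e' x u) := fun u =>
    congrArg (fun L => L u) (h3.symm.trans h4)
  rw [h5, dchart_dchartInv he' hx']

end ChartDerivative

section Dag

variable {X Y A M E F : Type*}
  [NormedAddCommGroup X] [NormedSpace ℝ X] [NormedAddCommGroup Y] [NormedSpace ℝ Y]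
  [NormedAddCommGroup A] [NormedSpace ℝ A]
  [TopologicalSpace M] [ChartedSpace X M] [TopologicalSpace E] [ChartedSpace A E]
  [TopologicalSpace F] [ChartedSpace Y F]
  [IsManifold 𝓘(ℝ, X) ∞ M] [IsManifold 𝓘(ℝ, Y) ∞ F]
  {π : SmoothFiberBundle X Y A M E F} {l : ℕ}

/-- The vertical tangent space at `y` of the bundle `π_l : J^l π → M`. -/
def verticalSpace (y : Jet π l) : Submodule ℝ (TangentSpace 𝓘(ℝ, X × JetFib X Y l) y) :=
  LinearMap.ker (mfderiv 𝓘(ℝ, X × JetFib X Y l) 𝓘(ℝ, X) Jet.base y).toLinearMap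

/-- The fibre `V*_y π_l ⊗ Λ^d T*_x M` over `y ∈ J^l π` (with `x = π_l(y)`) of the reduced
multimomentum bundle `J†π_l`, where `d + 1 = dim M`. -/
abbrev DagFiber (d : ℕ) (y : Jet π l) : Type _ :=
  verticalSpace y →L[ℝ] (TangentSpace 𝓘(ℝ, X) y.base [⋀^Fin d]→L[ℝ] ℝ)

/-- The differential of the jet coordinates at `y`. -/
def djet (c : BundleChart π) (y : Jet π l) :
    TangentSpace 𝓘(ℝ, X × JetFib X Y l) y →L[ℝ] X × JetFib X Y l := dchart (Jet.homeo c y) y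

/-- The inverse differential of the jet coordinates at `y`. -/
def djetInv (c : BundleChart π) (y : Jet π l) :
    X × JetFib X Y l →L[ℝ] TangentSpace 𝓘(ℝ, X × JetFib X Y l) y := dchartInv (Jet.homeo c y) y

theorem Jet.base_mem (c : BundleChart π) {y : Jet π l} (hy : y.value ∈ c.total.source) :
    y.base ∈ c.base.source := by
  rw [← y.proj_value]; exact c.maps _ hy

theorem dchart_mfderiv_base (c : BundleChart π) {y : Jet π l} (hy : y.value ∈ c.total.source)
    (v : TangentSpace 𝓘(ℝ, X × JetFib X Y l) y) :
    dchart c.base y.base (mfderiv 𝓘(ℝ, X × JetFib X Y l) 𝓘(ℝ, X) Jet.base y v) =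
      (djet c y v).1 := by
  have hs : y ∈ (Jet.homeo c y).source := hy
  have h1 : MDifferentiableAt 𝓘(ℝ, X) 𝓘(ℝ, X) c.base y.base :=
    (contMDiffAt_of_mem_maximalAtlas c.base_mem (Jet.base_mem c hy)).mdifferentiableAt (by simp)
  have h2 : MDifferentiableAt 𝓘(ℝ, X × JetFib X Y l) 𝓘(ℝ, X) (Jet.base : Jet π l → M) y :=
    (Jet.contMDiff_base y).mdifferentiableAt (by simp)
  have h3 : MDifferentiableAt 𝓘(ℝ, X × JetFib X Y l) 𝓘(ℝ, X × JetFib X Y l) (Jet.homeo c y) y :=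
    (contMDiffAt_of_mem_maximalAtlas (Jet.homeo_mem c y) hs).mdifferentiableAt (by simp)
  have h4 := mfderiv_comp y h1 h2
  have h5 := mfderiv_comp (I := 𝓘(ℝ, X × JetFib X Y l)) (I' := 𝓘(ℝ, X × JetFib X Y l))
    (I'' := 𝓘(ℝ, X)) y (g := (Prod.fst : X × JetFib X Y l → X))
    (f := Jet.homeo c y) differentiableAt_fst.mdifferentiableAt h3
  have h6 : (c.base ∘ Jet.base : Jet π l → X) = Prod.fst ∘ (Jet.homeo c y) := by
    funext z
    show c.base z.base = c.base z.rep.base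
    conv_lhs => rw [← Jet.mk_rep z]
    rfl
  rw [h6, h5] at h4
  have h7 := congrArg (fun L => L v) h4
  rw [mfderiv_eq_fderiv, fderiv_fst] at h7
  exact h7.symm

theorem mem_verticalSpace (c : BundleChart π) {y : Jet π l} (hy : y.value ∈ c.total.source)
    (v : TangentSpace 𝓘(ℝ, X × JetFib X Y l) y) :
    v ∈ verticalSpace y ↔ (djet c y v).1 = 0 := by
  rw [← dchart_mfderiv_base c hy]
  constructor
  · intro h
    have h : mfderiv 𝓘(ℝ, X × JetFib X Y l) 𝓘(ℝ, X) Jet.base y v = 0 := h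
    rw [h, map_zero]
  · intro h
    have h1 := dchartInv_dchart c.base_mem (Jet.base_mem c hy)
      (mfderiv 𝓘(ℝ, X × JetFib X Y l) 𝓘(ℝ, X) Jet.base y v)
    rw [h, map_zero] at h1
    exact h1.symm

theorem djet_djetInv (c : BundleChart π) {y : Jet π l} (hy : y.value ∈ c.total.source)
    (v : X × JetFib X Y l) : djet c y (djetInv c y v) = v :=
  dchart_dchartInv (Jet.homeo_mem c y) hy v

theorem djetInv_djet (c : BundleChart π) {y : Jet π l} (hy : y.value ∈ c.total.source)
    (v : TangentSpace 𝓘(ℝ, X × JetFib X Y l) y) : djetInv c y (djet c y v) = v :=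
  dchartInv_dchart (Jet.homeo_mem c y) hy v

/-- Vertical vectors with prescribed coordinates. -/
def vertIn (c : BundleChart π) (y : Jet π l) (hy : y.value ∈ c.total.source) :
    JetFib X Y l →L[ℝ] verticalSpace y :=
  ((djetInv c y).comp (ContinuousLinearMap.inr ℝ X (JetFib X Y l))).codRestrict _ fun v => by
    rw [mem_verticalSpace c hy]
    show (djet c y (djetInv c y (0, v))).1 = 0
    rw [djet_djetInv c hy]

/-- Coordinates of vertical vectors. -/
def vertOut (c : BundleChart π) (y : Jet π l) : verticalSpace y →L[ℝ] JetFib X Y l :=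
  ((ContinuousLinearMap.snd ℝ X (JetFib X Y l)).comp (djet c y)).comp
    (verticalSpace y).subtypeL

theorem vertOut_vertIn (c : BundleChart π) {y : Jet π l} (hy : y.value ∈ c.total.source)
    (v : JetFib X Y l) : vertOut c y (vertIn c y hy v) = v := by
  show (djet c y (djetInv c y (0, v))).2 = v
  rw [djet_djetInv c hy]

theorem vertIn_vertOut (c : BundleChart π) {y : Jet π l} (hy : y.value ∈ c.total.source)
    (v : verticalSpace y) : vertIn c y hy (vertOut c y v) = v := by
  apply Subtype.ext
  show djetInv c y (0, (djet c y v).2) = v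
  rw [← (mem_verticalSpace c hy v).1 v.2]
  exact djetInv_djet c hy _

/-- Coordinates on the fibre of `J†π_l` induced by bundle coordinates. -/
def fibCoord (d : ℕ) (c : BundleChart π) (y : Jet π l) (hy : y.value ∈ c.total.source)
    (p : DagFiber d y) : JetFib X Y l →L[ℝ] (X [⋀^Fin d]→L[ℝ] ℝ) :=
  (ContinuousAlternatingMap.compContinuousLinearMapCLM (dchartInv c.base y.base)).comp
    (p.comp (vertIn c y hy))

/-- The element of the fibre of `J†π_l` with given coordinates. -/
def fibCoordInv {d : ℕ} (c : BundleChart π) (y : Jet π l)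
    (p : JetFib X Y l →L[ℝ] (X [⋀^Fin d]→L[ℝ] ℝ)) : DagFiber d y :=
  (ContinuousAlternatingMap.compContinuousLinearMapCLM (dchart c.base y.base)).comp
    (p.comp (vertOut c y))

theorem fibCoordInv_fibCoord {d : ℕ} (c : BundleChart π) (y : Jet π l)
    (hy : y.value ∈ c.total.source) (p : DagFiber d y) :
    fibCoordInv c y (fibCoord d c y hy p) = p := by
  ext v w
  show p (vertIn c y hy (vertOut c y v))
    (fun i => dchartInv c.base y.base (dchart c.base y.base (w i))) = p v w
  rw [vertIn_vertOut]
  congr 1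
  funext i
  exact dchartInv_dchart c.base_mem (Jet.base_mem c hy) _

theorem fibCoord_fibCoordInv {d : ℕ} (c : BundleChart π) (y : Jet π l)
    (hy : y.value ∈ c.total.source) (p : JetFib X Y l →L[ℝ] (X [⋀^Fin d]→L[ℝ] ℝ)) :
    fibCoord d c y hy (fibCoordInv c y p) = p := by
  ext v w
  show p (vertOut c y (vertIn c y hy v))
    (fun i => dchart c.base y.base (dchartInv c.base y.base (w i))) = p v w
  rw [vertOut_vertIn]
  congr 1
  funext i
  exact dchart_dchartInv c.base_mem (Jet.base_mem c hy) _

/-- Transition functions on the fibres of `J†π_l`, in terms of jet coordinates. -/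
def fibTrans (d : ℕ) (c c' : BundleChart π) (y₀ y₁ : Jet π l) (r : X × JetFib X Y l)
    (p : JetFib X Y l →L[ℝ] (X [⋀^Fin d]→L[ℝ] ℝ)) : JetFib X Y l →L[ℝ] (X [⋀^Fin d]→L[ℝ] ℝ) :=
  (ContinuousAlternatingMap.compContinuousLinearMapCLM
    (fderiv ℝ (c.base ∘ c'.base.symm) r.1)).comp
    (p.comp ((ContinuousLinearMap.snd ℝ X (JetFib X Y l)).comp
      ((fderiv ℝ (Jet.homeo c y₀ ∘ (Jet.homeo c' y₁).symm) r).comp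
        (ContinuousLinearMap.inr ℝ X (JetFib X Y l)))))

theorem fibCoord_change {d : ℕ} (c c' : BundleChart π) (y₀ y₁ y : Jet π l)
    (hy : y.value ∈ c.total.source) (hy' : y.value ∈ c'.total.source)
    (p : JetFib X Y l →L[ℝ] (X [⋀^Fin d]→L[ℝ] ℝ)) :
    fibCoord d c' y hy' (fibCoordInv c y p) =
      fibTrans d c c' y₀ y₁ (Jet.homeo c' y₁ y) p := by
  have h1 := dchart_trans c.base_mem c'.base_mem (Jet.base_mem c hy) (Jet.base_mem c' hy')
  have h2 := dchart_trans (Jet.homeo_mem c y₀) (Jet.homeo_mem c' y₁) (x := y) hy hy'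
  have h3 : (Jet.homeo c' y₁ y).1 = c'.base y.base := by
    show c'.base y.rep.base = _
    conv_rhs => rw [← Jet.mk_rep y]
    rfl
  unfold fibTrans
  rw [h3, ← h1, ← h2]
  rfl

theorem contDiffAt_fibTrans {d : ℕ} (c c' : BundleChart π) (y₀ y₁ y : Jet π l)
    (hy : y.value ∈ c.total.source) (hy' : y.value ∈ c'.total.source)
    (p : JetFib X Y l →L[ℝ] (X [⋀^Fin d]→L[ℝ] ℝ)) :
    ContDiffAt ℝ ∞ (fun q : (X × JetFib X Y l) × (JetFib X Y l →L[ℝ] (X [⋀^Fin d]→L[ℝ] ℝ)) =>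
      fibTrans d c c' y₀ y₁ q.1 q.2) (Jet.homeo c' y₁ y, p) := by
  have h1 := contDiffAt_trans c.base_mem c'.base_mem (Jet.base_mem c hy) (Jet.base_mem c' hy')
  have h2 := contDiffAt_trans (Jet.homeo_mem c y₀) (Jet.homeo_mem c' y₁) (x := y) hy hy'
  have h3 : (Jet.homeo c' y₁ y).1 = c'.base y.base := by
    show c'.base y.rep.base = _
    conv_rhs => rw [← Jet.mk_rep y]
    rfl
  rw [← h3] at h1
  have k1 : ContDiffAt ℝ ∞ (fun q : (X × JetFib X Y l) ×
      (JetFib X Y l →L[ℝ] (X [⋀^Fin d]→L[ℝ] ℝ)) =>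
      fderiv ℝ (c.base ∘ c'.base.symm) q.1.1) (Jet.homeo c' y₁ y, p) :=
    ContDiffAt.comp (Jet.homeo c' y₁ y, p) (g := fderiv ℝ (c.base ∘ c'.base.symm))
      (h1.fderiv_right (m := ∞) (by simp)) (contDiffAt_fst.comp _ contDiffAt_fst)
  have k2 : ContDiffAt ℝ ∞ (fun q : (X × JetFib X Y l) ×
      (JetFib X Y l →L[ℝ] (X [⋀^Fin d]→L[ℝ] ℝ)) =>
      fderiv ℝ (Jet.homeo c y₀ ∘ (Jet.homeo c' y₁).symm) q.1) (Jet.homeo c' y₁ y, p) :=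
    ContDiffAt.comp (Jet.homeo c' y₁ y, p)
      (g := fderiv ℝ (Jet.homeo c y₀ ∘ (Jet.homeo c' y₁).symm))
      (h2.fderiv_right (m := ∞) (by simp)) contDiffAt_fst
  have k3 := ContDiffAt.comp (Jet.homeo c' y₁ y, p) (contDiff_pullback d).contDiffAt k1
  exact k3.clm_comp (contDiffAt_snd.clm_comp (contDiffAt_const.clm_comp
    (k2.clm_comp contDiffAt_const)))

end Dag

section DagOver

variable {X Y A M E F : Type*}
  [NormedAddCommGroup X] [NormedSpace ℝ X] [NormedAddCommGroup Y] [NormedSpace ℝ Y]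
  [NormedAddCommGroup A] [NormedSpace ℝ A]
  [TopologicalSpace M] [ChartedSpace X M] [TopologicalSpace E] [ChartedSpace A E]
  [TopologicalSpace F] [ChartedSpace Y F]
  [IsManifold 𝓘(ℝ, X) ∞ M] [IsManifold 𝓘(ℝ, Y) ∞ F]
  {π : SmoothFiberBundle X Y A M E F} {l d : ℕ}
  {V N : Type*} [NormedAddCommGroup V] [NormedSpace ℝ V]
  [TopologicalSpace N] [ChartedSpace V N]

/-- The pull-back of the bundle `J†π_l → J^l π` along a map `f : N → J^l π`. -/
@[ext] structure DagOver (d : ℕ) (f : N → Jet π l) where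
  point : N
  form : DagFiber d (f point)

/-- The model space of the fibres of `J†π_l`. -/
abbrev DagModel (X Y : Type*) [NormedAddCommGroup X] [NormedSpace ℝ X] [NormedAddCommGroup Y]
    [NormedSpace ℝ Y] (l d : ℕ) : Type _ := JetFib X Y l →L[ℝ] (X [⋀^Fin d]→L[ℝ] ℝ)

namespace DagOver

theorem mk_congr (f : N → Jet π l) (c : BundleChart π) (p : DagModel X Y l d) {x x' : N}
    (h : x' = x) : (⟨x', fibCoordInv c (f x') p⟩ : DagOver d f) = ⟨x, fibCoordInv c (f x) p⟩ := by
  subst h; rfl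

open Classical in
/-- The chart of the pulled-back bundle given by a chart of the base and bundle coordinates. -/
def chart (f : N → Jet π l) (e : OpenPartialHomeomorph N V) (c : BundleChart π) :
    PartialEquiv (DagOver d f) (V × DagModel X Y l d) where
  toFun w := (e w.point,
    if h : (f w.point).value ∈ c.total.source then fibCoord d c (f w.point) h w.form else 0)
  invFun q := ⟨e.symm q.1, fibCoordInv c (f (e.symm q.1)) q.2⟩
  source := {w | w.point ∈ e.source ∧ (f w.point).value ∈ c.total.source}
  target := {q | q.1 ∈ e.target ∧ (f (e.symm q.1)).value ∈ c.total.source}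
  map_source' w hw := by
    refine ⟨e.map_source hw.1, ?_⟩
    show (f (e.symm (e w.point))).value ∈ _
    rw [e.left_inv hw.1]
    exact hw.2
  map_target' q hq := ⟨e.map_target hq.1, hq.2⟩
  left_inv' w hw := by
    show (⟨e.symm (e w.point), fibCoordInv c (f (e.symm (e w.point))) _⟩ : DagOver d f) = w
    rw [mk_congr f c _ (e.left_inv hw.1), dif_pos hw.2, fibCoordInv_fibCoord]
  right_inv' q hq := by
    refine Prod.ext (e.right_inv hq.1) ?_
    show (if h : (f (e.symm q.1)).value ∈ c.total.source then _ else _) = q.2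
    rw [dif_pos hq.2]
    exact fibCoord_fibCoordInv c _ hq.2 q.2

theorem mem_trans_source (f : N → Jet π l) (e e' : OpenPartialHomeomorph N V)
    (c c' : BundleChart π) (q : V × DagModel X Y l d) :
    q ∈ ((chart f e c).symm.trans (chart f e' c')).source ↔
      (q.1 ∈ e.target ∧ (f (e.symm q.1)).value ∈ c.total.source) ∧
      e.symm q.1 ∈ e'.source ∧ (f (e.symm q.1)).value ∈ c'.total.source := Iff.rfl

end DagOver
end DagOver

section DagOver

variable {X Y A M E F : Type*}
  [NormedAddCommGroup X] [NormedSpace ℝ X] [NormedAddCommGroup Y] [NormedSpace ℝ Y]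
  [NormedAddCommGroup A] [NormedSpace ℝ A]
  [TopologicalSpace M] [ChartedSpace X M] [TopologicalSpace E] [ChartedSpace A E]
  [TopologicalSpace F] [ChartedSpace Y F]
  [IsManifold 𝓘(ℝ, X) ∞ M] [IsManifold 𝓘(ℝ, Y) ∞ F]
  {π : SmoothFiberBundle X Y A M E F} {l d : ℕ}
  {V N : Type*} [NormedAddCommGroup V] [NormedSpace ℝ V]
  [TopologicalSpace N] [ChartedSpace V N] [IsManifold 𝓘(ℝ, V) ∞ N]

namespace DagOver

theorem isOpen_trans_source {f : N → Jet π l} (hf : Continuous f) (e e' : OpenPartialHomeomorph N V)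
    (c c' : BundleChart π) :
    IsOpen ((chart (d := d) f e c).symm.trans (chart f e' c')).source := by
  have h1 : IsOpen {x : N | (f x).value ∈ c.total.source} := by
    have : {x : N | (f x).value ∈ c.total.source} =
        ⋃ z : Jet π l, f ⁻¹' (Jet.homeo c z).source := by
      ext x
      simp only [mem_iUnion, mem_setOf_eq]
      exact ⟨fun h => ⟨f x, h⟩, fun ⟨_, h⟩ => h⟩
    rw [this]
    exact isOpen_iUnion fun z => (Jet.homeo c z).open_source.preimage hf
  have h1' : IsOpen {x : N | (f x).value ∈ c'.total.source} := by
    have : {x : N | (f x).value ∈ c'.total.source} =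
        ⋃ z : Jet π l, f ⁻¹' (Jet.homeo c' z).source := by
      ext x
      simp only [mem_iUnion, mem_setOf_eq]
      exact ⟨fun h => ⟨f x, h⟩, fun ⟨_, h⟩ => h⟩
    rw [this]
    exact isOpen_iUnion fun z => (Jet.homeo c' z).open_source.preimage hf
  have h2 := e.isOpen_inter_preimage_symm (h1.inter (e'.open_source.inter h1'))
  have h3 : ((chart (d := d) f e c).symm.trans (chart f e' c')).source =
      Prod.fst ⁻¹' (e.target ∩ e.symm ⁻¹' ({x : N | (f x).value ∈ c.total.source} ∩
        (e'.source ∩ {x : N | (f x).value ∈ c'.total.source}))) := by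
    ext q
    rw [mem_trans_source]
    simp only [mem_preimage, mem_inter_iff, mem_setOf_eq]
    tauto
  rw [h3]
  exact h2.preimage continuous_fst

open Classical in
theorem trans_smooth {f : N → Jet π l} (hf : ContMDiff 𝓘(ℝ, V) 𝓘(ℝ, X × JetFib X Y l) ∞ f)
    {e e' : OpenPartialHomeomorph N V} (he : e ∈ IsManifold.maximalAtlas 𝓘(ℝ, V) ∞ N)
    (he' : e' ∈ IsManifold.maximalAtlas 𝓘(ℝ, V) ∞ N) (c c' : BundleChart π) :
    ContDiffOn ℝ ∞ ((chart (d := d) f e c).symm.trans (chart f e' c'))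
      ((chart (d := d) f e c).symm.trans (chart f e' c')).source := by
  intro q hq
  obtain ⟨⟨h1, h2⟩, h3, h4⟩ := (mem_trans_source f e e' c c' q).1 hq
  have hs : ContMDiffAt 𝓘(ℝ, V) 𝓘(ℝ, V) ∞ e.symm q.1 := contMDiffAt_symm_of_mem_maximalAtlas he h1
  let y := f (e.symm q.1)
  have k1 : ContDiffAt ℝ ∞ (fun a => e' (e.symm a)) q.1 :=
    (ContMDiffAt.comp q.1 (contMDiffAt_of_mem_maximalAtlas he' h3) hs).contDiffAt
  have k2 : ContDiffAt ℝ ∞ (fun a => Jet.homeo c' y (f (e.symm a))) q.1 := by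
    have k3 : ContMDiffAt 𝓘(ℝ, X × JetFib X Y l) 𝓘(ℝ, X × JetFib X Y l) ∞ (Jet.homeo c' y)
        (f (e.symm q.1)) := contMDiffAt_of_mem_maximalAtlas (Jet.homeo_mem c' y) h4
    exact (ContMDiffAt.comp q.1 (g := Jet.homeo c' y) k3
      (ContMDiffAt.comp q.1 (g := f) (hf _) hs)).contDiffAt
  have k4 : ContDiffAt ℝ ∞ (fun r : V × DagModel X Y l d =>
      (e' (e.symm r.1), fibTrans d c c' y y (Jet.homeo c' y (f (e.symm r.1))) r.2)) q := by
    refine (ContDiffAt.comp q (g := fun a => e' (e.symm a)) k1 contDiffAt_fst).prodMk ?_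
    exact ContDiffAt.comp q (g := fun r : (X × JetFib X Y l) × DagModel X Y l d =>
      fibTrans d c c' y y r.1 r.2) (contDiffAt_fibTrans c c' y y y h2 h4 q.2)
      ((ContDiffAt.comp q (g := fun a => Jet.homeo c' y (f (e.symm a))) k2
        contDiffAt_fst).prodMk contDiffAt_snd)
  refine k4.contDiffWithinAt.congr_of_mem ?_ hq
  intro r hr
  obtain ⟨⟨h1, h2⟩, h3, h4⟩ := (mem_trans_source f e e' c c' r).1 hr
  refine Prod.ext rfl ?_
  show (if h : (f (e.symm r.1)).value ∈ c'.total.source then _ else _) = _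
  rw [dif_pos h4]
  exact fibCoord_change c c' y y _ h2 h4 r.2

/-- The smooth atlas on the pull-back of `J†π_l` along a smooth map. -/
def atlas (d : ℕ) (f : N → Jet π l) (hf : ContMDiff 𝓘(ℝ, V) 𝓘(ℝ, X × JetFib X Y l) ∞ f) :
    SmoothAtlas (V × DagModel X Y l d) (DagOver d f) where
  Index := {e : OpenPartialHomeomorph N V // e ∈ IsManifold.maximalAtlas 𝓘(ℝ, V) ∞ N} ×
    BundleChart π
  chart i := chart f i.1.1 i.2
  index w := (⟨chartAt V w.point, IsManifold.chart_mem_maximalAtlas _⟩,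
    (exists_bundleChart π (f w.point).value).choose)
  mem_source w := ⟨mem_chart_source V w.point,
    (exists_bundleChart π (f w.point).value).choose_spec⟩
  open_source i j := isOpen_trans_source hf.continuous _ _ _ _
  smooth i j := trans_smooth hf i.1.2 j.1.2 _ _

end DagOver

/-- The reduced multimomentum bundle `J†π_l`, with `d + 1 = dim M`. -/
abbrev JDag (π : SmoothFiberBundle X Y A M E F) (l d : ℕ) : Type _ :=
  DagOver d (fun y : Jet π l => y)

/-- The induced bundle `π_{l+1,l}°(J†π_l)`. -/
abbrev NDag (π : SmoothFiberBundle X Y A M E F) (l d : ℕ) : Type _ :=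
  DagOver d (Jet.trunc : Jet π (l + 1) → Jet π l)

/-- The model space of `J†π_l`. -/
abbrev JDagModel (X Y : Type*) [NormedAddCommGroup X] [NormedSpace ℝ X] [NormedAddCommGroup Y]
    [NormedSpace ℝ Y] (l d : ℕ) : Type _ := (X × JetFib X Y l) × DagModel X Y l d

/-- The model space of `π_{l+1,l}°(J†π_l)`. -/
abbrev NDagModel (X Y : Type*) [NormedAddCommGroup X] [NormedSpace ℝ X] [NormedAddCommGroup Y]
    [NormedSpace ℝ Y] (l d : ℕ) : Type _ := (X × JetFib X Y (l + 1)) × DagModel X Y l d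

namespace JDag

instance : TopologicalSpace (JDag π l d) := (DagOver.atlas d _ contMDiff_id).topology
instance : ChartedSpace (JDagModel X Y l d) (JDag π l d) :=
  (DagOver.atlas d _ contMDiff_id).chartedSpace
instance : IsManifold 𝓘(ℝ, JDagModel X Y l d) ∞ (JDag π l d) :=
  (DagOver.atlas d _ contMDiff_id).isManifold

end JDag

namespace NDag

instance : TopologicalSpace (NDag π l d) := (DagOver.atlas d _ Jet.contMDiff_trunc).topology
instance : ChartedSpace (NDagModel X Y l d) (NDag π l d) :=
  (DagOver.atlas d _ Jet.contMDiff_trunc).chartedSpace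
instance : IsManifold 𝓘(ℝ, NDagModel X Y l d) ∞ (NDag π l d) :=
  (DagOver.atlas d _ Jet.contMDiff_trunc).isManifold

end NDag

end DagOver

section FirstJets

variable {X V M N : Type*} [NormedAddCommGroup X] [NormedSpace ℝ X]
  [NormedAddCommGroup V] [NormedSpace ℝ V]
  [TopologicalSpace M] [ChartedSpace X M] [TopologicalSpace N] [ChartedSpace V N]

/-- The fibre over `p` of the first jet bundle `J^1 ξ → N` of a bundle `ξ : N → M`. A first jet
`j_1 s (x)` with `s x = p` is identified with the tangent map `T_x s`, i.e. with a right inverse of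
`T_p ξ` (equivalently, with a horizontal `n`-plane in `T_p N`). -/
@[ext] structure FirstJetAt (X V : Type*) [NormedAddCommGroup X] [NormedSpace ℝ X]
    [NormedAddCommGroup V] [NormedSpace ℝ V] {M N : Type*} [TopologicalSpace M]
    [ChartedSpace X M] [TopologicalSpace N] [ChartedSpace V N] (ξ : N → M) (p : N) where
  lift : TangentSpace 𝓘(ℝ, X) (ξ p) →L[ℝ] TangentSpace 𝓘(ℝ, V) p
  isLift : (mfderiv 𝓘(ℝ, V) 𝓘(ℝ, X) ξ p).comp lift = ContinuousLinearMap.id ℝ _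

/-- `i^{1,n}(z)(Ω) = 0` for an `(n+1)`-form `Ω` at `p`, where `n = d + 1`: the contraction of `Ω`
with one vertical vector and with `n` vectors of the horizontal plane `z` vanishes. -/
def FirstJetAt.Annihilates {d : ℕ} {ξ : N → M} {p : N} (z : FirstJetAt X V ξ p)
    (Ω : TangentSpace 𝓘(ℝ, V) p [⋀^Fin (d + 1 + 1)]→L[ℝ] ℝ) : Prop :=
  ∀ v : TangentSpace 𝓘(ℝ, V) p, mfderiv 𝓘(ℝ, V) 𝓘(ℝ, X) ξ p v = 0 →
    ∀ w : Fin (d + 1) → TangentSpace 𝓘(ℝ, X) (ξ p), Ω (Fin.cons v fun i => z.lift (w i)) = 0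

/-- The exterior derivative of a differential form on a manifold, computed in the preferred
chart at each point. -/
def mextDeriv {k : ℕ} (α : ∀ p : N, TangentSpace 𝓘(ℝ, V) p [⋀^Fin k]→L[ℝ] ℝ) (p : N) :
    TangentSpace 𝓘(ℝ, V) p [⋀^Fin (k + 1)]→L[ℝ] ℝ :=
  (extDeriv (fun q : V => (α ((chartAt V p).symm q)).compContinuousLinearMap
    (dchartInv (chartAt V p) ((chartAt V p).symm q))) (chartAt V p p)).compContinuousLinearMap
      (dchart (chartAt V p) p)

end FirstJets

section Theory

variable {X Y A M E F : Type*}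
  [NormedAddCommGroup X] [NormedSpace ℝ X] [NormedAddCommGroup Y] [NormedSpace ℝ Y]
  [NormedAddCommGroup A] [NormedSpace ℝ A]
  [TopologicalSpace M] [ChartedSpace X M] [TopologicalSpace E] [ChartedSpace A E]
  [TopologicalSpace F] [ChartedSpace Y F]
  [IsManifold 𝓘(ℝ, X) ∞ M] [IsManifold 𝓘(ℝ, Y) ∞ F]
  {π : SmoothFiberBundle X Y A M E F} {l d : ℕ}

/-- The fibre over `y ∈ J^l π` of the first jet bundle `J^1 π_l → J^l π`. -/
abbrev JetFirstJetAt (y : Jet π l) : Type _ :=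
  FirstJetAt X (X × JetFib X Y l) (Jet.base : Jet π l → M) y

/-- The first jet bundle `J^1 π_l`. -/
structure JetFirstJet (π : SmoothFiberBundle X Y A M E F) (l : ℕ) where
  point : Jet π l
  jet : JetFirstJetAt point

theorem mfderiv_base_prolong (s : SectionAt π) :
    (mfderiv 𝓘(ℝ, X × JetFib X Y l) 𝓘(ℝ, X) (Jet.base : Jet π l → M) (Jet.mk l s)).comp
      (mfderiv 𝓘(ℝ, X) 𝓘(ℝ, X × JetFib X Y l) (Jet.prolong l s) s.base :
        TangentSpace 𝓘(ℝ, X) s.base →L[ℝ] TangentSpace 𝓘(ℝ, X × JetFib X Y l) (Jet.mk l s)) =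
    ContinuousLinearMap.id ℝ _ := by
  have h1 := mfderiv_comp s.base
    ((Jet.contMDiff_base (π := π) (k := l) (Jet.prolong l s s.base)).mdifferentiableAt (by simp))
    ((Jet.contMDiffAt_prolong (k := l) s).mdifferentiableAt (by simp))
  have h2 : mfderiv 𝓘(ℝ, X) 𝓘(ℝ, X) ((Jet.base : Jet π l → M) ∘ Jet.prolong l s) s.base =
      mfderiv 𝓘(ℝ, X) 𝓘(ℝ, X) (id : M → M) s.base :=
    Filter.EventuallyEq.mfderiv_eq (Jet.base_prolong s)
  have h3 : ∀ y : Jet π l, y = Jet.prolong l s s.base →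
      (mfderiv 𝓘(ℝ, X × JetFib X Y l) 𝓘(ℝ, X) (Jet.base : Jet π l → M) y :
        X × JetFib X Y l →L[ℝ] X) =
      mfderiv 𝓘(ℝ, X × JetFib X Y l) 𝓘(ℝ, X) (Jet.base : Jet π l → M) (Jet.prolong l s s.base) := by
    rintro _ rfl; rfl
  rw [mfderiv_id] at h2
  ext v
  have h4 := congrArg (fun L => L v) (h1.symm.trans h2)
  have h5 := h3 _ (Jet.prolong_base (k := l) s).symm
  exact (congrArg (fun L : X × JetFib X Y l →L[ℝ] X =>
    L (mfderiv 𝓘(ℝ, X) 𝓘(ℝ, X × JetFib X Y l) (Jet.prolong l s) s.base v)) h5).trans h4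

/-- The first jet `j_1 (j_l s)` at the base point of a local section `s`. -/
def SectionAt.jetTangent (l : ℕ) (s : SectionAt π) : JetFirstJetAt (Jet.mk l s) where
  lift := (mfderiv 𝓘(ℝ, X) 𝓘(ℝ, X × JetFib X Y l) (Jet.prolong l s) s.base :
    TangentSpace 𝓘(ℝ, X) s.base →L[ℝ] TangentSpace 𝓘(ℝ, X × JetFib X Y l) (Jet.mk l s))
  isLift := mfderiv_base_prolong s

theorem Jet.mk_rep_trunc (z : Jet π (l + 1)) : Jet.mk l z.rep = z.trunc := by
  conv_rhs => rw [← Jet.mk_rep z]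
  rfl

/-- The Cartan connection `𝒞 : J^{l+1} π → J^1 π_l`, `j_{l+1} s (x) ↦ j_1 (j_l s) (x)`. -/
def cartan (z : Jet π (l + 1)) : JetFirstJetAt z.trunc :=
  Jet.mk_rep_trunc z ▸ z.rep.jetTangent l

/-- The vertical projection `v ↦ v - γ (T π_l v)` determined by a first jet `γ` at `y`. -/
def vertProj {y : Jet π l} (γ : JetFirstJetAt y) :
    TangentSpace 𝓘(ℝ, X × JetFib X Y l) y →L[ℝ] verticalSpace y :=
  (ContinuousLinearMap.id ℝ _ -
    γ.lift.comp (mfderiv 𝓘(ℝ, X × JetFib X Y l) 𝓘(ℝ, X) Jet.base y)).codRestrict _ fun v => by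
    show mfderiv 𝓘(ℝ, X × JetFib X Y l) 𝓘(ℝ, X) Jet.base y (v - _) = 0
    have h := congrArg (fun L => L (mfderiv 𝓘(ℝ, X × JetFib X Y l) 𝓘(ℝ, X) Jet.base y v)) γ.isLift
    rw [map_sub]
    exact sub_eq_zero.2 h.symm

/-- The embedding `e^{1,n-1}(γ) : V*_y π_l ⊗ Λ^{n-1} T*_x M → Λ^n T*_y J^l π` determined by a first
jet `γ` at `y`, with `n = d + 1`: the wedge product of the vertical covector part, precomposed
with the vertical projection along `γ`, with the pulled back `(n-1)`-form part. -/
def embedForm {y : Jet π l} (γ : JetFirstJetAt y) (p : DagFiber d y) :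
    TangentSpace 𝓘(ℝ, X × JetFib X Y l) y [⋀^Fin (d + 1)]→L[ℝ] ℝ :=
  ContinuousAlternatingMap.alternatizeUncurryFin (E := X × JetFib X Y l)
    ((ContinuousAlternatingMap.compContinuousLinearMapCLM
      (mfderiv 𝓘(ℝ, X × JetFib X Y l) 𝓘(ℝ, X) Jet.base y)).comp (p.comp (vertProj γ)))

end Theory

section FieldTheory

variable {X Y A M E F : Type*}
  [NormedAddCommGroup X] [NormedSpace ℝ X] [NormedAddCommGroup Y] [NormedSpace ℝ Y]
  [NormedAddCommGroup A] [NormedSpace ℝ A]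
  [TopologicalSpace M] [ChartedSpace X M] [TopologicalSpace E] [ChartedSpace A E]
  [TopologicalSpace F] [ChartedSpace Y F]
  [IsManifold 𝓘(ℝ, X) ∞ M] [IsManifold 𝓘(ℝ, Y) ∞ F]
  {π : SmoothFiberBundle X Y A M E F} {l d : ℕ}

theorem DagOver.contMDiff_point {V N : Type*} [NormedAddCommGroup V] [NormedSpace ℝ V]
    [TopologicalSpace N] [ChartedSpace V N] [IsManifold 𝓘(ℝ, V) ∞ N] (f : N → Jet π l)
    (hf : ContMDiff 𝓘(ℝ, V) 𝓘(ℝ, X × JetFib X Y l) ∞ f) :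
    letI := (DagOver.atlas d f hf).topology
    letI := (DagOver.atlas d f hf).chartedSpace
    ContMDiff 𝓘(ℝ, V × DagModel X Y l d) 𝓘(ℝ, V) ∞ (DagOver.point : DagOver d f → N) := by
  letI := (DagOver.atlas d f hf).topology
  letI := (DagOver.atlas d f hf).chartedSpace
  haveI := (DagOver.atlas d f hf).isManifold
  intro w
  let i := (DagOver.atlas d f hf).index w
  refine contMDiffAt_of_charts ((DagOver.atlas d f hf).homeo i) i.1.1
    ((DagOver.atlas d f hf).homeo_mem i) i.1.2 ((DagOver.atlas d f hf).mem_source w) Prod.fst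
    contDiffAt_fst ?_
  filter_upwards [((DagOver.atlas d f hf).homeo i).open_source.mem_nhds
    ((DagOver.atlas d f hf).mem_source w)] with y hy
  exact ⟨hy.1, rfl⟩

theorem JDag.contMDiff_point : ContMDiff 𝓘(ℝ, JDagModel X Y l d) 𝓘(ℝ, X × JetFib X Y l) ∞
    (fun P : JDag π l d => P.point) := DagOver.contMDiff_point _ contMDiff_id

/-- The projection `τ† : J†π_l → M`. -/
abbrev tauDag (P : JDag π l d) : M := P.point.base

/-- The value `(τ₀†)_[1](z) ∈ J^1 π_l` at `z ∈ J^1 τ†` of the first jet prolongation of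
`τ₀† : J†π_l → J^l π`. -/
def tauZeroProl {P : JDag π l d} (z : FirstJetAt X (JDagModel X Y l d) tauDag P) :
    JetFirstJetAt P.point where
  lift := (mfderiv 𝓘(ℝ, JDagModel X Y l d) 𝓘(ℝ, X × JetFib X Y l)
    (fun Q : JDag π l d => Q.point) P).comp z.lift
  isLift := by
    have h := mfderiv_comp P
      ((Jet.contMDiff_base (π := π) (k := l) P.point).mdifferentiableAt (by simp))
      ((JDag.contMDiff_point (π := π) (l := l) (d := d) P).mdifferentiableAt (by simp))
    rw [← ContinuousLinearMap.comp_assoc]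
    refine Eq.trans ?_ z.isLift
    exact congrArg (fun L => ContinuousLinearMap.comp L z.lift) h.symm

/-- Smoothness of a map from `J†π_l` to `J^1 π_l`, the latter seen as a subbundle of
`Hom(π_l° TM, T J^l π)`: the projection to `J^l π` is smooth, and so is the linear map read in
tangent coordinates. -/
def JetFirstJet.IsSmoothMap (G : JDag π l d → JetFirstJet π l) : Prop :=
  ContMDiff 𝓘(ℝ, JDagModel X Y l d) 𝓘(ℝ, X × JetFib X Y l) ∞ (fun P => (G P).point) ∧
  ∀ P₀ : JDag π l d, ContMDiffAt 𝓘(ℝ, JDagModel X Y l d) 𝓘(ℝ, X →L[ℝ] X × JetFib X Y l) ∞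
    (inTangentCoordinates 𝓘(ℝ, X) 𝓘(ℝ, X × JetFib X Y l)
      (fun P => (G P).point.base) (fun P => (G P).point) (fun P => (G P).jet.lift) P₀) P₀

/-- The projection of `π_{l+1,l}°(J†π_l)` to `J†π_l`. -/
def NDag.toDag (w : NDag π l d) : JDag π l d := ⟨w.point.trunc, w.form⟩

/-- A Lagrangian density of order `l + 1`: a smooth section of `π_{l+1}°(Λ^n T*M)`, that is, a
horizontal `n`-form on `J^{l+1} π`, with `n = d + 1`. -/
structure LagrangianDensity (π : SmoothFiberBundle X Y A M E F) (l d : ℕ) where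
  toFun : ∀ z : Jet π (l + 1), TangentSpace 𝓘(ℝ, X) z.base [⋀^Fin (d + 1)]→L[ℝ] ℝ
  smooth : ∀ φ ∈ IsManifold.maximalAtlas 𝓘(ℝ, X) ∞ M,
    ContMDiffOn 𝓘(ℝ, X × JetFib X Y (l + 1)) 𝓘(ℝ, X [⋀^Fin (d + 1)]→L[ℝ] ℝ) ∞
      (fun z : Jet π (l + 1) => (toFun z).compContinuousLinearMap (dchartInv φ z.base))
      (Jet.base ⁻¹' φ.source)

/-- The map `h` from `π_{l+1,l}°(J†π_l)` to `n`-forms on `J^l π`, induced by the Cartan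
connection. -/
def hForm (w : NDag π l d) :
    TangentSpace 𝓘(ℝ, X × JetFib X Y l) w.point.trunc [⋀^Fin (d + 1)]→L[ℝ] ℝ :=
  embedForm (cartan w.point) w.form

namespace LagrangianDensity

variable (L : LagrangianDensity π l d)

/-- The `n`-form `θ' = h^* Θ + 𝔭^* ℒ` on `π_{l+1,l}°(J†π_l)`. -/
def thetaPrime (w : NDag π l d) :
    TangentSpace 𝓘(ℝ, NDagModel X Y l d) w [⋀^Fin (d + 1)]→L[ℝ] ℝ :=
  (hForm w).compContinuousLinearMap
    (mfderiv 𝓘(ℝ, NDagModel X Y l d) 𝓘(ℝ, X × JetFib X Y l)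
      (fun w : NDag π l d => w.point.trunc) w) +
  (L.toFun w.point).compContinuousLinearMap
    (mfderiv 𝓘(ℝ, NDagModel X Y l d) 𝓘(ℝ, X) (fun w : NDag π l d => w.point.base) w)

/-- The first constraint set `𝒫` of `dθ'` on `π_{l+1,l}°(J†π_l) → M`. -/
def constraintSet : Set (NDag π l d) :=
  {w | ∃ z : FirstJetAt X (NDagModel X Y l d) (fun w : NDag π l d => w.point.base) w,
    z.Annihilates (mextDeriv L.thetaPrime w)}

/-- `s` is a smooth map `J†π_l → π_{l+1,l}°(J†π_l)` with values in `𝒫` which is a two-sided inverse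
of the projection `𝒫 → J†π_l`. -/
structure IsInverseSection (s : JDag π l d → NDag π l d) : Prop where
  smooth : ContMDiff 𝓘(ℝ, JDagModel X Y l d) 𝓘(ℝ, NDagModel X Y l d) ∞ s
  mem : ∀ P, s P ∈ L.constraintSet
  toDag_apply : ∀ P, (s P).toDag = P
  apply_toDag : ∀ w ∈ L.constraintSet, s w.toDag = w

/-- Hyperregularity: the projection `𝒫 → J†π_l` is a diffeomorphism, i.e. it is bijective and its
inverse is smooth as a map to `π_{l+1,l}°(J†π_l)`. -/
def IsHyperregular : Prop := ∃ s : JDag π l d → NDag π l d, L.IsInverseSection s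

variable {L}

/-- The section `𝔰 : J†π_l → π_{l+1,l}°(J†π_l)` inverting `𝒫 → J†π_l`. -/
def IsHyperregular.sec (hL : L.IsHyperregular) : JDag π l d → NDag π l d := hL.choose

theorem IsHyperregular.isInverseSection (hL : L.IsHyperregular) : L.IsInverseSection hL.sec :=
  hL.choose_spec

/-- The `n`-form `θ = 𝔰^* θ'` on `J†π_l`. -/
def IsHyperregular.theta (hL : L.IsHyperregular) (P : JDag π l d) :
    TangentSpace 𝓘(ℝ, JDagModel X Y l d) P [⋀^Fin (d + 1)]→L[ℝ] ℝ :=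
  (L.thetaPrime (hL.sec P)).compContinuousLinearMap
    (mfderiv 𝓘(ℝ, JDagModel X Y l d) 𝓘(ℝ, NDagModel X Y l d) hL.sec P)

/-- The `(n+1)`-form `ω = dθ` on `J†π_l`. -/
def IsHyperregular.omega (hL : L.IsHyperregular) (P : JDag π l d) :
    TangentSpace 𝓘(ℝ, JDagModel X Y l d) P [⋀^Fin (d + 1 + 1)]→L[ℝ] ℝ :=
  mextDeriv hL.theta P

/-- `Ker ω|_P`: the first jets `z ∈ J^1 τ†` at `P` with `i^{1,n}(z)(ω_P) = 0`. -/
def IsHyperregular.kerOmega (hL : L.IsHyperregular) (P : JDag π l d) :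
    Set (FirstJetAt X (JDagModel X Y l d) tauDag P) :=
  {z | z.Annihilates (hL.omega P)}

/-- The map `h + 𝕃` from `π_{l+1,l}°(J†π_l)` to the multimomentum bundle, with values regarded as
`n`-forms on `J^l π`; here `𝕃 w` is the pull-back of `ℒ` along `T π_l`. -/
def hPlus (L : LagrangianDensity π l d) (w : NDag π l d) :
    TangentSpace 𝓘(ℝ, X × JetFib X Y l) w.point.trunc [⋀^Fin (d + 1)]→L[ℝ] ℝ :=
  hForm w + ((w.point.base_trunc ▸ L.toFun w.point :
    TangentSpace 𝓘(ℝ, X) w.point.trunc.base [⋀^Fin (d + 1)]→L[ℝ] ℝ)).compContinuousLinearMap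
      (mfderiv 𝓘(ℝ, X × JetFib X Y l) 𝓘(ℝ, X) Jet.base w.point.trunc)

theorem IsHyperregular.trunc_sec (hL : L.IsHyperregular) (P : JDag π l d) :
    (hL.sec P).point.trunc = P.point :=
  congrArg (fun Q : JDag π l d => Q.point) (hL.isInverseSection.toDag_apply P)

/-- The Hamiltonian section `ℋ = (h + 𝕃) ∘ 𝔰` of the multimomentum bundle over `J†π_l`, as an
`n`-form at the point `τ₀†(P)` of `J^l π`. -/
def IsHyperregular.hamiltonian (hL : L.IsHyperregular) (P : JDag π l d) :
    TangentSpace 𝓘(ℝ, X × JetFib X Y l) P.point [⋀^Fin (d + 1)]→L[ℝ] ℝ :=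
  hL.trunc_sec P ▸ L.hPlus (hL.sec P)

/-- `γ` is the fibre derivative of `ℋ` at `P`: the derivative at `P` of `ℋ` along the fibre of
`τ₀†` is the linear map `e^{1,n-1}(γ)`. -/
def IsHyperregular.IsFiberDerivAt (hL : L.IsHyperregular) (P : JDag π l d)
    (γ : JetFirstJetAt P.point) : Prop :=
  ∀ (q : DagFiber d P.point) (v : Fin (d + 1) → TangentSpace 𝓘(ℝ, X × JetFib X Y l) P.point),
    HasDerivAt (fun t : ℝ => hL.hamiltonian ⟨P.point, P.form + t • q⟩ v) (embedForm γ q v) 0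

end LagrangianDensity

end FieldTheory

end HigherField

end

open HigherField

/-! In bundle coordinates everything reduces to one computation with constant-coefficient forms. Let
`X` model `M` and `J` the fibres of `J^l`, so that `J†` is modelled on `(X × J) × Hom(J, Λ^d X*)`
with points `((x, u), p)`. By `hPlus_apply`, the Cartan connection turns `h + 𝕃` into `p ∧ du + h
dx`, where `h` is now the horizontal coefficient: the Lagrangian minus the contraction of `p` with
the derivative of the `l`-jet (`jetShift`). Both summands of `θ'` factor through `J^l`, and `𝔰` is a
section over `J†`, so `θ` is the pull-back of the tautological form along `ℋ` (`theta_apply`). In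
the chart it is therefore `coordForm` of the smooth function `hamChart`.

Contracting `dθ` with a vertical vector `(u, p)` and a horizontal plane `Z` gives an expression
linear in `(u, p)`, hence two independent conditions (`annihilates_coordForm_iff`). The `p`-part
says `wedgeContr Z_u = -∂h/∂p`, where `Z_u` is the `J^l`-component of the plane. The `u`-part says
that the alternation of the momentum component of the plane equals `∂h/∂u`. They are the two
Hamilton equations.

The first condition fixes `Z_u`, because `Z ↦ wedgeContr Z` is injective: testing on `f ⊗ (b_k ⌟
vol)` recovers `f (Z b_k)`. In finite dimensions it also has a linear right inverse, since such
tensors span `Hom(J, Λ^d X*)` and `Λ^{d+1} X*` is a line; this solves the first condition, and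
smoothly in the point. The second condition is always solvable, generally not uniquely, by dividing
`∂h/∂u` by `d + 1`. Thus the kernel is non-empty, and all its elements have the same image `Z_u` in
`J^1 π_l`.

Finally, differentiating `p ∧ du + h dx` along the fibre in the direction `q` gives `q ∧ du +
(∂h/∂p)(q) dx`, while `e^{1,n-1}(γ)(q)` is `q ∧ du - wedgeContr γ q`. The two agree for all `q`
exactly when `γ` satisfies the first Hamilton equation (`isFiberDerivAt_iff`). So the fibre
derivative and the uniqueness of the projected jet are the same linear equation. -/

noncomputable section

set_option maxSynthPendingDepth 3

namespace HigherField

/-! ### Multilinear algebra: the wedge contraction `Z ↦ wedgeContr Z` and its inversion. -/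

section WedgeContraction

variable {X J : Type*} [NormedAddCommGroup X] [NormedSpace ℝ X]
  [NormedAddCommGroup J] [NormedSpace ℝ J] {d : ℕ}

/-- The `(d + 1)`-form `∑ⱼ (-1)ʲ p (Z wⱼ) (w₀, …, ŵⱼ, …, w_d)` on `X`, linear in `p`. -/
def wedgeContr (Z : X →L[ℝ] J) :
    (J →L[ℝ] (X [⋀^Fin d]→L[ℝ] ℝ)) →L[ℝ] (X [⋀^Fin (d + 1)]→L[ℝ] ℝ) :=
  (ContinuousAlternatingMap.alternatizeUncurryFinCLM ℝ X ℝ).comp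
    ((ContinuousLinearMap.compL ℝ X J (X [⋀^Fin d]→L[ℝ] ℝ)).flip Z)

theorem wedgeContr_apply (Z : X →L[ℝ] J) (p : J →L[ℝ] (X [⋀^Fin d]→L[ℝ] ℝ))
    (w : Fin (d + 1) → X) :
    wedgeContr Z p w = ∑ i : Fin (d + 1), (-1) ^ (i : ℕ) • p (Z (w i)) (i.removeNth w) :=
  ContinuousAlternatingMap.alternatizeUncurryFin_apply _ _

/-- The dependence on `Z` is itself linear and continuous, being composition followed by
alternation. -/
theorem contDiff_wedgeContr : ContDiff ℝ ∞ (fun Z : X →L[ℝ] J =>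
    (wedgeContr Z : (J →L[ℝ] (X [⋀^Fin d]→L[ℝ] ℝ)) →L[ℝ] (X [⋀^Fin (d + 1)]→L[ℝ] ℝ))) :=
  contDiff_const.clm_comp
    (ContinuousLinearMap.compL ℝ X J (X [⋀^Fin d]→L[ℝ] ℝ)).flip.contDiff

/-- The form `p ∧ du` on `X × J`, linear in `p`. -/
def liouville : (J →L[ℝ] (X [⋀^Fin d]→L[ℝ] ℝ)) →L[ℝ] ((X × J) [⋀^Fin (d + 1)]→L[ℝ] ℝ) :=
  (ContinuousAlternatingMap.alternatizeUncurryFinCLM ℝ (X × J) ℝ).comp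
    ((ContinuousLinearMap.compL ℝ (X × J) (X [⋀^Fin d]→L[ℝ] ℝ) ((X × J) [⋀^Fin d]→L[ℝ] ℝ)
      (ContinuousAlternatingMap.compContinuousLinearMapCLM (ContinuousLinearMap.fst ℝ X J))).comp
      ((ContinuousLinearMap.compL ℝ (X × J) J (X [⋀^Fin d]→L[ℝ] ℝ)).flip
        (ContinuousLinearMap.snd ℝ X J)))

theorem liouville_apply (p : J →L[ℝ] (X [⋀^Fin d]→L[ℝ] ℝ)) (v : Fin (d + 1) → X × J) :
    liouville p v =
      ∑ i : Fin (d + 1), (-1) ^ (i : ℕ) • p (v i).2 (i.removeNth fun j => (v j).1) :=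
  ContinuousAlternatingMap.alternatizeUncurryFin_apply _ _

/-- The volume form of a basis. -/
def volForm (b : Module.Basis (Fin (d + 1)) ℝ X) : X [⋀^Fin (d + 1)]→L[ℝ] ℝ :=
  { b.det with
    cont := by
      have : FiniteDimensional ℝ X := b.finiteDimensional_of_finite
      change Continuous fun v : Fin (d + 1) → X => (b.toMatrix v).det
      refine Continuous.matrix_det (continuous_matrix fun i j => ?_)
      exact (b.coord i).continuous_of_finiteDimensional.comp (continuous_apply j) }

theorem eq_smul_volForm (b : Module.Basis (Fin (d + 1)) ℝ X) (f : X [⋀^Fin (d + 1)]→L[ℝ] ℝ) :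
    f = f b • volForm b := by
  ext v
  exact congrArg (fun g => g v) (f.toAlternatingMap.eq_smul_basis_det b)

theorem volForm_self (b : Module.Basis (Fin (d + 1)) ℝ X) : volForm b b = 1 := b.det_self

/-- Moving `b m` from the front into slot `n` costs the sign `(-1)^n` and produces the basis with
its `n`-th vector replaced by `b m`. This has a repeated entry unless `m = n`. Up to sign, the
contractions `b_m ⌟ vol` are thus dual to the `d`-tuples of basis vectors with one omitted. -/
theorem volForm_curryLeft_apply (b : Module.Basis (Fin (d + 1)) ℝ X) (m n : Fin (d + 1)) :
    (volForm b).curryLeft (b m) (fun j => b (n.succAbove j)) =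
      if m = n then (-1) ^ (n : ℕ) else 0 := by
  rw [ContinuousAlternatingMap.curryLeft_apply_apply,
    ← ContinuousAlternatingMap.neg_one_pow_smul_map_insertNth _ n]
  have e : (n.insertNth (b m) fun j => b (n.succAbove j) : Fin (d + 1) → X) =
      Function.update b n (b m) :=
    Fin.insertNth_removeNth n (b m) b
  rw [e]
  split_ifs with h
  · rw [h, Function.update_eq_self, volForm_self]
    simp
  · rw [(volForm b).map_eq_zero_of_eq _ (i := n) (j := m) _ (Ne.symm h), smul_zero]
    rw [Function.update_self, Function.update_of_ne h]

/-- In codimension one, contracting the volume form yields all of `Λ^d X*`. An alternating form is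
determined by its values on injective tuples of basis vectors, and the duality of
`volForm_curryLeft_apply` gives the coefficients. -/
theorem eq_sum_volForm (b : Module.Basis (Fin (d + 1)) ℝ X) (η : X [⋀^Fin d]→L[ℝ] ℝ) :
    η = ∑ m : Fin (d + 1), ((-1) ^ (m : ℕ) * η (fun j => b (m.succAbove j))) •
      (volForm b).curryLeft (b m) := by
  apply ContinuousAlternatingMap.toAlternatingMap_injective
  refine b.ext_alternating fun v hv => ?_
  -- An injective `Fin d → Fin (d + 1)` misses exactly one index `n`, so the tuple is a permutation
  -- of the basis with `b n` omitted. Both sides pick up the sign of that permutation.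
  obtain ⟨n, hn⟩ : ∃ n, n ∉ range v := by
    by_contra! h
    have := Fintype.card_le_of_surjective v h
    simp at this
  have h1 : ∀ i, ∃ j, n.succAbove j = v i := fun i =>
    Fin.exists_succAbove_eq fun h => hn ⟨i, h⟩
  choose τ hτ using h1
  have hτi : Function.Injective τ := fun i j hij => hv (by rw [← hτ, ← hτ, hij])
  let σ : Equiv.Perm (Fin d) := Equiv.ofBijective τ (Finite.injective_iff_bijective.1 hτi)
  have e : (fun i => b (v i)) = (fun j => b (n.succAbove j)) ∘ σ := by
    funext i
    show b (v i) = b (n.succAbove (τ i))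
    rw [hτ]
  rw [e, AlternatingMap.map_perm, AlternatingMap.map_perm]
  congr 1
  show η _ = (∑ m : Fin (d + 1), ((-1) ^ (m : ℕ) * η (fun j => b (m.succAbove j))) •
      (volForm b).curryLeft (b m)) (fun j => b (n.succAbove j))
  rw [ContinuousAlternatingMap.sum_apply]
  simp only [ContinuousAlternatingMap.smul_apply, volForm_curryLeft_apply, smul_eq_mul, mul_ite,
    mul_zero, Finset.sum_ite_eq', Finset.mem_univ, if_true]
  rw [mul_right_comm, ← mul_pow]
  simp

/-- Only the summand `i = k` survives by `volForm_curryLeft_apply`, and its two signs cancel. In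
coordinates this extracts the component `u_{|k}` of `Z`. -/
theorem wedgeContr_apply_basis (b : Module.Basis (Fin (d + 1)) ℝ X) (Z : X →L[ℝ] J)
    (f : J →L[ℝ] ℝ) (k : Fin (d + 1)) :
    wedgeContr Z (f.smulRight ((volForm b).curryLeft (b k))) b = f (Z (b k)) := by
  rw [wedgeContr_apply]
  have h : ∀ i : Fin (d + 1), (-1 : ℤ) ^ (i : ℕ) •
      (f.smulRight ((volForm b).curryLeft (b k))) (Z (b i)) (i.removeNth b) =
      if k = i then f (Z (b k)) else 0 := by
    intro i
    rw [ContinuousLinearMap.smulRight_apply, ContinuousAlternatingMap.smul_apply]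
    rw [show i.removeNth b = fun j => b (i.succAbove j) from rfl, volForm_curryLeft_apply]
    split_ifs with hk
    · subst hk
      rw [zsmul_eq_mul, smul_eq_mul, mul_left_comm]
      push_cast
      rw [← mul_pow]
      simp
    · simp
  refine (Finset.sum_congr rfl fun i _ => h i).trans ?_
  simp

/-- Rank-one `p` of the form `f ⊗ (b_k ⌟ vol)` already recover every `f (Z b_k)`, and continuous
functionals separate the points of `J`. This gives the uniqueness of the projected jet. -/
theorem wedgeContr_injective (b : Module.Basis (Fin (d + 1)) ℝ X)
    {Z Z' : X →L[ℝ] J}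
    (h : ∀ p : J →L[ℝ] (X [⋀^Fin d]→L[ℝ] ℝ), wedgeContr Z p = wedgeContr Z' p) : Z = Z' := by
  refine ContinuousLinearMap.coe_injective (b.ext fun k => ?_)
  show Z (b k) = Z' (b k)
  refine (SeparatingDual.eq_iff_forall_dual_eq (R := ℝ)).2 fun f => ?_
  rw [← wedgeContr_apply_basis b Z f k, h, wedgeContr_apply_basis]

/-- The formula `wedgeContr_apply_basis` leaves only one possible value for the preimage of `B`. It
is correct because the test tensors span `Hom(J, Λ^d X*)` and top forms are determined on the basis.
Having the inverse as a continuous linear map in `B` gives solvability and smooth dependence at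
once. -/
theorem exists_wedgeContr_rightInverse (b : Module.Basis (Fin (d + 1)) ℝ X)
    [FiniteDimensional ℝ J] :
    ∃ R : ((J →L[ℝ] (X [⋀^Fin d]→L[ℝ] ℝ)) →L[ℝ] (X [⋀^Fin (d + 1)]→L[ℝ] ℝ)) →L[ℝ] (X →L[ℝ] J),
      ∀ B, wedgeContr (R B) = B := by
  have : FiniteDimensional ℝ X := b.finiteDimensional_of_finite
  let β := Module.finBasis ℝ J
  let g : Fin (d + 1) → Fin (Module.finrank ℝ J) → (J →L[ℝ] (X [⋀^Fin d]→L[ℝ] ℝ)) := fun k i =>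
    (LinearMap.toContinuousLinearMap (β.coord i)).smulRight ((volForm b).curryLeft (b k))
  -- The `β i`-component of `R B (b k)` must be `B (g k i) b`, by `wedgeContr_apply_basis` with `f`
  -- the `i`-th coordinate.
  let R : ((J →L[ℝ] (X [⋀^Fin d]→L[ℝ] ℝ)) →L[ℝ] (X [⋀^Fin (d + 1)]→L[ℝ] ℝ)) →L[ℝ] (X →L[ℝ] J) :=
    ∑ k, ∑ i, ((ContinuousAlternatingMap.apply ℝ X ℝ b).comp
      (ContinuousLinearMap.apply ℝ _ (g k i))).smulRight
        ((LinearMap.toContinuousLinearMap (b.coord k)).smulRight (β i))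
  have hR : ∀ B k, R B (b k) = ∑ i, (B (g k i) b) • β i := by
    intro B k
    simp only [R, _root_.sum_apply]
    rw [Finset.sum_eq_single k]
    · refine Finset.sum_congr rfl fun i _ => ?_
      simp
    · intro k' _ hk
      refine Finset.sum_eq_zero fun i _ => ?_
      simp [Finsupp.single_eq_of_ne, hk]
    · simp
  refine ⟨R, fun B => ?_⟩
  ext1 p
  rw [eq_smul_volForm b (wedgeContr (R B) p), eq_smul_volForm b (B p)]
  congr 1
  -- The `g k i` span: expand each `p (β i)` by `eq_sum_volForm`.
  have hp : p = ∑ k : Fin (d + 1), ∑ i, ((-1) ^ (k : ℕ) * p (β i) (fun j => b (k.succAbove j))) • g k i := by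
    refine ContinuousLinearMap.coe_injective (β.ext fun i => ?_)
    show p (β i) = (∑ k : Fin (d + 1), ∑ i, ((-1) ^ (k : ℕ) * p (β i) (fun j => b (k.succAbove j))) • g k i) (β i)
    conv_lhs => rw [eq_sum_volForm b (p (β i))]
    simp only [_root_.sum_apply]
    refine Finset.sum_congr rfl fun k _ => ?_
    rw [Finset.sum_eq_single i]
    · simp [g]
    · intro i' _ hi
      simp [g, Finsupp.single_eq_of_ne, hi]
    · simp
  have key : ∀ k i, wedgeContr (R B) (g k i) b = B (g k i) b := by
    intro k i
    rw [show g k i = (LinearMap.toContinuousLinearMap (β.coord i)).smulRight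
      ((volForm b).curryLeft (b k)) from rfl, wedgeContr_apply_basis, hR]
    simp [g, map_sum, Finsupp.single_apply]
  rw [hp]
  simp only [map_sum, map_smul, ContinuousAlternatingMap.sum_apply,
    ContinuousAlternatingMap.smul_apply, key]

end WedgeContraction

/-! ### The form `p ∧ du + h dx` and Hamilton's equations in a model space. -/

section CoordinateForm

variable {X J : Type*} [NormedAddCommGroup X] [NormedSpace ℝ X]
  [NormedAddCommGroup J] [NormedSpace ℝ J] {d : ℕ}

/-- Every summand other than the first feeds the zero horizontal part of `v` into an alternating
form. -/
theorem liouville_cons (p : J →L[ℝ] (X [⋀^Fin d]→L[ℝ] ℝ)) {v : X × J} (hv : v.1 = 0)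
    (u : Fin d → X × J) :
    liouville p (Fin.cons v u) = p v.2 fun i => (u i).1 := by
  rw [liouville_apply, Fin.sum_univ_succ, Finset.sum_eq_zero, add_zero]
  · simp only [Fin.val_zero, pow_zero, one_smul, Fin.cons_zero]
    rfl
  · intro j _
    -- After deleting entry `j + 1`, the vector `v` is still present, in position `k`.
    obtain ⟨k, hk⟩ := Fin.exists_succAbove_eq (Fin.succ_ne_zero j).symm
    rw [ContinuousAlternatingMap.map_coord_zero _ k, smul_zero]
    show (Matrix.vecCons v u (j.succ.succAbove k)).1 = 0
    rw [hk, Matrix.cons_val_zero, hv]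

/-- This is the geometric meaning of `wedgeContr`: it is the pull-back of `p ∧ du` along the graph
of `Z`. -/
theorem liouville_prodMk (p : J →L[ℝ] (X [⋀^Fin d]→L[ℝ] ℝ)) (Z : X →L[ℝ] J)
    (w : Fin (d + 1) → X) : liouville p (fun i => (w i, Z (w i))) = wedgeContr Z p w := by
  rw [liouville_apply, wedgeContr_apply]

/-- The `(d + 1)`-form `p ∧ du + h dx` on `(X × J) × Hom(J, Λ^d X*)`. -/
def coordForm (h : (X × J) × (J →L[ℝ] (X [⋀^Fin d]→L[ℝ] ℝ)) → X [⋀^Fin (d + 1)]→L[ℝ] ℝ)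
    (q : (X × J) × (J →L[ℝ] (X [⋀^Fin d]→L[ℝ] ℝ))) :
    ((X × J) × (J →L[ℝ] (X [⋀^Fin d]→L[ℝ] ℝ))) [⋀^Fin (d + 1)]→L[ℝ] ℝ :=
  (liouville q.2).compContinuousLinearMap (ContinuousLinearMap.fst ℝ _ _) +
    (h q).compContinuousLinearMap
      ((ContinuousLinearMap.fst ℝ _ _).comp (ContinuousLinearMap.fst ℝ _ _))

variable {h : (X × J) × (J →L[ℝ] (X [⋀^Fin d]→L[ℝ] ℝ)) → X [⋀^Fin (d + 1)]→L[ℝ] ℝ}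
  {q : (X × J) × (J →L[ℝ] (X [⋀^Fin d]→L[ℝ] ℝ))}

/-- The derivative of `coordForm h` in terms of that of `h`. -/
def coordFormDeriv (h' : ((X × J) × (J →L[ℝ] (X [⋀^Fin d]→L[ℝ] ℝ))) →L[ℝ]
      (X [⋀^Fin (d + 1)]→L[ℝ] ℝ)) :
    ((X × J) × (J →L[ℝ] (X [⋀^Fin d]→L[ℝ] ℝ))) →L[ℝ]
      (((X × J) × (J →L[ℝ] (X [⋀^Fin d]→L[ℝ] ℝ))) [⋀^Fin (d + 1)]→L[ℝ] ℝ) :=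
  (ContinuousAlternatingMap.compContinuousLinearMapCLM (ContinuousLinearMap.fst ℝ _ _)).comp
      (liouville.comp (ContinuousLinearMap.snd ℝ _ _)) +
    (ContinuousAlternatingMap.compContinuousLinearMapCLM
      ((ContinuousLinearMap.fst ℝ _ _).comp (ContinuousLinearMap.fst ℝ _ _))).comp h'

/-- The Liouville part is linear in the point, through its momentum component alone, so it is its
own derivative. The rest is a fixed linear map applied to `h`. -/
theorem hasFDerivAt_coordForm (hh : DifferentiableAt ℝ h q) :
    HasFDerivAt (coordForm h) (coordFormDeriv (fderiv ℝ h q)) q := by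
  let T₁ : ((X × J) × (J →L[ℝ] (X [⋀^Fin d]→L[ℝ] ℝ))) →L[ℝ]
      (((X × J) × (J →L[ℝ] (X [⋀^Fin d]→L[ℝ] ℝ))) [⋀^Fin (d + 1)]→L[ℝ] ℝ) :=
    (ContinuousAlternatingMap.compContinuousLinearMapCLM (ContinuousLinearMap.fst ℝ _ _)).comp
      (liouville.comp (ContinuousLinearMap.snd ℝ _ _))
  let T₂ : (X [⋀^Fin (d + 1)]→L[ℝ] ℝ) →L[ℝ]
      (((X × J) × (J →L[ℝ] (X [⋀^Fin d]→L[ℝ] ℝ))) [⋀^Fin (d + 1)]→L[ℝ] ℝ) :=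
    ContinuousAlternatingMap.compContinuousLinearMapCLM
      ((ContinuousLinearMap.fst ℝ _ _).comp (ContinuousLinearMap.fst ℝ _ _))
  have h1 : HasFDerivAt (fun r => T₁ r) T₁ q := T₁.hasFDerivAt
  have h2 : HasFDerivAt (fun r => T₂ (h r)) (T₂.comp (fderiv ℝ h q)) q :=
    T₂.hasFDerivAt.comp q hh.hasFDerivAt
  exact h1.add h2

/-- In the alternating sum defining `d`, the derivative along `v` gives the first two terms. The
derivatives along the plane give the last one, with the opposite sign because `v` stays as first
argument of the form. -/
theorem extDeriv_coordForm (hh : DifferentiableAt ℝ h q)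
    (v : (X × J) × (J →L[ℝ] (X [⋀^Fin d]→L[ℝ] ℝ))) (hv : v.1.1 = 0)
    (Z : X →L[ℝ] (X × J) × (J →L[ℝ] (X [⋀^Fin d]→L[ℝ] ℝ))) (hZ : ∀ x, (Z x).1.1 = x)
    (w : Fin (d + 1) → X) :
    extDeriv (coordForm h) q (Fin.cons v fun i => Z (w i)) =
      wedgeContr ((ContinuousLinearMap.snd ℝ X J).comp
        ((ContinuousLinearMap.fst ℝ _ _).comp Z)) v.2 w + fderiv ℝ h q v w -
      ContinuousAlternatingMap.alternatizeUncurryFin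
        ((ContinuousLinearMap.apply ℝ (X [⋀^Fin d]→L[ℝ] ℝ) v.1.2).comp
          ((ContinuousLinearMap.snd ℝ _ _).comp Z)) w := by
  rw [extDeriv, (hasFDerivAt_coordForm hh).fderiv,
    ContinuousAlternatingMap.alternatizeUncurryFin_apply, Fin.sum_univ_succ, sub_eq_add_neg]
  congr 1
  · simp only [Fin.val_zero, pow_zero, one_smul, Fin.cons_zero]
    show liouville v.2 (fun i => (Z (w i)).1) + fderiv ℝ h q v (fun i => (Z (w i)).1.1) = _
    simp only [hZ]
    rw [← liouville_prodMk]
    congr 2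
    funext i
    exact Prod.ext (hZ _) rfl
  · rw [ContinuousAlternatingMap.alternatizeUncurryFin_apply, ← Finset.sum_neg_distrib]
    refine Finset.sum_congr rfl fun i _ => ?_
    have e : i.succ.removeNth (Matrix.vecCons v fun i => Z (w i)) =
        Matrix.vecCons v fun j => Z (i.removeNth w j) :=
      Fin.cons_comp_succ_succAbove v (fun i => Z (w i)) i
    have e2 : (fun j => (Matrix.vecCons v (fun j => Z (i.removeNth w j)) j).1) =
        Matrix.vecCons v.1 (fun j => (Z (i.removeNth w j)).1) :=
      funext fun j => Fin.cases rfl (fun j => rfl) j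
    show _ • (_ : ((X × J) × (J →L[ℝ] (X [⋀^Fin d]→L[ℝ] ℝ))) [⋀^Fin (d + 1)]→L[ℝ] ℝ)
      (i.succ.removeNth (Matrix.vecCons v fun i => Z (w i))) = _
    rw [e, Fin.cons_succ]
    show _ • (liouville (Z (w i)).2 (fun j => (Matrix.vecCons v
      (fun j => Z (i.removeNth w j)) j).1) + fderiv ℝ h q (Z (w i)) (fun j =>
        (Matrix.vecCons v (fun j => Z (i.removeNth w j)) j).1.1)) = _
    -- The term with `h` is horizontal and has the vertical vector `v` among its arguments, so it
    -- vanishes; `liouville_cons` evaluates the other term.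
    rw [ContinuousAlternatingMap.map_coord_zero (fderiv ℝ h q (Z (w i))) 0
      (by rw [Matrix.cons_val_zero]; exact hv), add_zero, e2, Matrix.vecCons, liouville_cons _ hv]
    simp only [hZ, Fin.val_succ, pow_succ, mul_neg, mul_one, neg_smul]
    rfl

/-- The conditions on a horizontal plane `Z` for the contraction with the differential of
`p ∧ du + h dx` to vanish. -/
theorem annihilates_coordForm_iff (hh : DifferentiableAt ℝ h q)
    (Z : X →L[ℝ] (X × J) × (J →L[ℝ] (X [⋀^Fin d]→L[ℝ] ℝ))) (hZ : ∀ x, (Z x).1.1 = x) :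
    (∀ v : (X × J) × (J →L[ℝ] (X [⋀^Fin d]→L[ℝ] ℝ)), v.1.1 = 0 → ∀ w : Fin (d + 1) → X,
      extDeriv (coordForm h) q (Fin.cons v fun i => Z (w i)) = 0) ↔
    (∀ p, wedgeContr ((ContinuousLinearMap.snd ℝ X J).comp
        ((ContinuousLinearMap.fst ℝ _ _).comp Z)) p = -fderiv ℝ h q (0, p)) ∧
    ∀ u, ContinuousAlternatingMap.alternatizeUncurryFin
        ((ContinuousLinearMap.apply ℝ (X [⋀^Fin d]→L[ℝ] ℝ) u).comp
          ((ContinuousLinearMap.snd ℝ _ _).comp Z)) = fderiv ℝ h q ((0, u), 0) := by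
  constructor
  · intro H
    constructor
    · intro p
      ext w
      -- A pure momentum direction makes the alternation term vanish; in the other half, a pure
      -- `u`-direction makes the wedge contraction vanish. By linearity the two cases together cover
      -- all vertical vectors.
      have := H (0, p) rfl w
      rw [extDeriv_coordForm hh _ rfl Z hZ] at this
      have e : (ContinuousLinearMap.apply ℝ (X [⋀^Fin d]→L[ℝ] ℝ)) (0 : J) = 0 := map_zero _
      rw [show (((0 : X × J), p).1.2 : J) = 0 from rfl, e, ContinuousLinearMap.zero_comp,
        ← ContinuousAlternatingMap.alternatizeUncurryFinCLM_apply, map_zero] at this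
      exact eq_neg_of_add_eq_zero_left ((sub_zero _).symm.trans this)
    · intro u
      ext w
      have := H ((0, u), 0) rfl w
      rw [extDeriv_coordForm hh _ rfl Z hZ, map_zero] at this
      exact (sub_eq_zero.1 this).symm.trans (zero_add _)
  · rintro ⟨H1, H2⟩ ⟨⟨x, u⟩, p⟩ hv w
    obtain rfl : x = 0 := hv
    rw [extDeriv_coordForm hh _ rfl Z hZ, H1, H2]
    have e : fderiv ℝ h q ((0, u), p) = fderiv ℝ h q ((0, u), 0) + fderiv ℝ h q (0, p) := by
      rw [← map_add]
      simp
    rw [e]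
    show -(fderiv ℝ h q (0, p) w) + (fderiv ℝ h q ((0, u), 0) w + fderiv ℝ h q (0, p) w) -
      fderiv ℝ h q ((0, u), 0) w = 0
    ring

/-- The two Hamilton equations constrain different components of `Z`, so they can be solved
separately. -/
theorem exists_annihilates_coordForm (b : Module.Basis (Fin (d + 1)) ℝ X)
    [FiniteDimensional ℝ J] (hh : DifferentiableAt ℝ h q) :
    ∃ Z : X →L[ℝ] (X × J) × (J →L[ℝ] (X [⋀^Fin d]→L[ℝ] ℝ)), (∀ x, (Z x).1.1 = x) ∧
      ∀ v : (X × J) × (J →L[ℝ] (X [⋀^Fin d]→L[ℝ] ℝ)), v.1.1 = 0 → ∀ w : Fin (d + 1) → X,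
        extDeriv (coordForm h) q (Fin.cons v fun i => Z (w i)) = 0 := by
  obtain ⟨R, hR⟩ := exists_wedgeContr_rightInverse (d := d) (J := J) b
  let Zu := R (-(fderiv ℝ h q).comp (ContinuousLinearMap.inr ℝ _ _))
  -- Alternating the currying of a `(d + 1)`-form multiplies it by `d + 1`; hence the normalisation
  -- of this solution of the second equation.
  let T : J →L[ℝ] (X →L[ℝ] (X [⋀^Fin d]→L[ℝ] ℝ)) :=
    ((d + 1 : ℝ)⁻¹) • (ContinuousAlternatingMap.curryLeftLI (𝕜 := ℝ)).toContinuousLinearMap.comp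
      ((fderiv ℝ h q).comp ((ContinuousLinearMap.inl ℝ _ _).comp (ContinuousLinearMap.inr ℝ _ _)))
  let Z := ((ContinuousLinearMap.id ℝ X).prod Zu).prod T.flip
  have hZ : ∀ x, (Z x).1.1 = x := fun x => rfl
  refine ⟨Z, hZ, (annihilates_coordForm_iff hh Z hZ).2 ⟨fun p => ?_, fun u => ?_⟩⟩
  · show wedgeContr Zu p = _
    rw [hR]
    rfl
  · show ContinuousAlternatingMap.alternatizeUncurryFin (((d + 1 : ℝ)⁻¹) •
      (fderiv ℝ h q ((0, u), 0)).curryLeft) = _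
    rw [ContinuousAlternatingMap.alternatizeUncurryFin_smul,
      ContinuousAlternatingMap.alternatizeUncurryFin_curryLeft, ← Nat.cast_smul_eq_nsmul ℝ,
      smul_smul]
    push_cast
    rw [inv_mul_cancel₀ (by positivity), one_smul]

end CoordinateForm

/-! ### The derivative of an `l`-jet as a linear function of the `(l + 1)`-jet. -/

section JetShift

variable {X Y : Type*} [NormedAddCommGroup X] [NormedSpace ℝ X]
  [NormedAddCommGroup Y] [NormedSpace ℝ Y] {l : ℕ}

instance finiteDimensional_jetFib [FiniteDimensional ℝ X] [FiniteDimensional ℝ Y] (k : ℕ) :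
    FiniteDimensional ℝ (JetFib X Y k) := by
  have h (j : ℕ) : FiniteDimensional ℝ (X [×j]→L[ℝ] Y) :=
    FiniteDimensional.of_injective
      (ContinuousMultilinearMap.toMultilinearMapLinear :
        (X [×j]→L[ℝ] Y) →ₗ[ℝ] MultilinearMap ℝ (fun _ : Fin j => X) Y)
      ContinuousMultilinearMap.toMultilinearMap_injective
  exact inferInstanceAs (FiniteDimensional ℝ (∀ j : Fin (k + 1), SymMult X Y j))

/-- The component of order `j` of a jet, as a continuous linear map. -/
def jetProj (k : ℕ) (j : Fin (k + 1)) : JetFib X Y k →L[ℝ] SymMult X Y j :=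
  ContinuousLinearMap.proj (R := ℝ) (φ := fun j : Fin (k + 1) => SymMult X Y j) j

/-- A family of linear maps into the components of a jet. -/
def jetPi {V : Type*} [NormedAddCommGroup V] [NormedSpace ℝ V] {k : ℕ}
    (f : ∀ j : Fin (k + 1), V →L[ℝ] SymMult X Y j) : V →L[ℝ] JetFib X Y k :=
  ContinuousLinearMap.pi (R := ℝ) (φ := fun j : Fin (k + 1) => SymMult X Y j) f

/-- The derivative of the `l`-jet of a map, as a function of its `(l + 1)`-jet. -/
def jetShift (u : JetFib X Y (l + 1)) : X →L[ℝ] JetFib X Y l :=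
  jetPi fun j => (symmetrize X Y j).comp
    (ContinuousMultilinearMap.curryLeft (n := (j : ℕ)) (u j.succ).1)

/-- Each component of `jetShift` is a composite of continuous linear maps of the jet, and the
components are reassembled by the coordinate inclusions `ι`. -/
theorem contDiff_jetShift : ContDiff ℝ ∞ (jetShift : JetFib X Y (l + 1) → X →L[ℝ] JetFib X Y l) := by
  let T : ∀ j : Fin (l + 1), JetFib X Y (l + 1) →L[ℝ] (X →L[ℝ] SymMult X Y j) := fun j =>
    (ContinuousLinearMap.compL ℝ X (X [×(j : ℕ)]→L[ℝ] Y) (SymMult X Y j) (symmetrize X Y j)).comp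
      (((continuousMultilinearCurryLeftEquiv ℝ (fun _ : Fin ((j : ℕ) + 1) => X)
        Y).toContinuousLinearEquiv.toContinuousLinearMap).comp
        ((SymMult X Y ((j : ℕ) + 1)).subtypeL.comp (jetProj (l + 1) j.succ)))
  let ι : ∀ j : Fin (l + 1), SymMult X Y j →L[ℝ] JetFib X Y l := fun j =>
    ContinuousLinearMap.single ℝ (fun j : Fin (l + 1) => SymMult X Y j) j
  have h : (jetShift : JetFib X Y (l + 1) → X →L[ℝ] JetFib X Y l) =
      fun u => ∑ j, (ι j).comp (T j u) := by
    funext u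
    ext1 x
    rw [_root_.sum_apply]
    exact (Finset.univ_sum_single (fun j : Fin (l + 1) => jetProj l j (jetShift u x))).symm
  rw [h]
  exact ContDiff.sum fun j _ => contDiff_const.clm_comp (T j).contDiff

end JetShift

/-! ### First jets of `π_l`, the Cartan connection and `e^{1,n-1}` in jet coordinates. -/

section JetCoordinates

variable {X Y A M E F : Type*}
  [NormedAddCommGroup X] [NormedSpace ℝ X] [NormedAddCommGroup Y] [NormedSpace ℝ Y]
  [NormedAddCommGroup A] [NormedSpace ℝ A]
  [TopologicalSpace M] [ChartedSpace X M] [TopologicalSpace E] [ChartedSpace A E]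
  [TopologicalSpace F] [ChartedSpace Y F]
  [IsManifold 𝓘(ℝ, X) ∞ M] [IsManifold 𝓘(ℝ, Y) ∞ F]
  {π : SmoothFiberBundle X Y A M E F} {l d : ℕ}

/-- In jet coordinates the prolongation of `s` lists the derivatives of its local representative.
Differentiating the entry of order `j` produces the derivative of order `j + 1`, which the `(l +
1)`-jet records. -/
theorem djet_jetTangent (c : BundleChart π) {s : SectionAt π} (hs : s.value ∈ c.total.source)
    (x : TangentSpace 𝓘(ℝ, X) s.base) :
    djet c (Jet.mk l s) ((s.jetTangent l).lift x) =
      (dchart c.base s.base x,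
        jetShift (Jet.secCoord c (l + 1) s).2 (dchart c.base s.base x)) := by
  let g : X → X × JetFib X Y l := fun a =>
    (a, fun j => symmetrize X Y j (iteratedFDeriv ℝ j (c.rep s.toFun) a))
  have hb := c.base_mem_source hs
  have hg : HasFDerivAt g ((ContinuousLinearMap.id ℝ X).prod
      (jetShift (Jet.secCoord c (l + 1) s).2)) (c.base s.base) := by
    refine (hasFDerivAt_id _).prodMk ?_
    refine hasFDerivAt_pi (φ := fun (j : Fin (l + 1)) a => symmetrize X Y j (iteratedFDeriv ℝ j (c.rep s.toFun) a))
      (φ' := fun j : Fin (l + 1) => (symmetrize X Y j).comp (ContinuousMultilinearMap.curryLeft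
        (n := (j : ℕ)) ((Jet.secCoord c (l + 1) s).2 j.succ).1)) |>.2 fun j => ?_
    have h1 : HasFDerivAt (iteratedFDeriv ℝ j (c.rep s.toFun))
        (fderiv ℝ (iteratedFDeriv ℝ j (c.rep s.toFun)) (c.base s.base)) (c.base s.base) :=
      (((c.rep_smooth hs).self_of_nhds.iteratedFDeriv_right (m := 1) (i := (j : ℕ))
        (by exact_mod_cast le_top)).differentiableAt (by simp)).hasFDerivAt
    have h2 : fderiv ℝ (iteratedFDeriv ℝ j (c.rep s.toFun)) (c.base s.base) =
        ContinuousMultilinearMap.curryLeft (n := (j : ℕ))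
          ((Jet.secCoord c (l + 1) s).2 j.succ).1 := by
      have h3 := Jet.secCoord_coe (k := l + 1) hs j.succ
      ext v w
      rw [ContinuousMultilinearMap.curryLeft_apply]
      refine Eq.trans ?_ (congrArg (fun f : X [×((j : ℕ) + 1)]→L[ℝ] Y => f (Fin.cons v w)) h3).symm
      exact (iteratedFDeriv_succ_apply_left (𝕜 := ℝ) (n := (j : ℕ)) (f := c.rep s.toFun)
        (x := c.base s.base) (Fin.cons v w)).symm
    rw [h2] at h1
    exact (symmetrize X Y j).hasFDerivAt.comp _ h1
  have h1 : MDifferentiableAt 𝓘(ℝ, X) 𝓘(ℝ, X × JetFib X Y l) (Jet.prolong l s) s.base :=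
    (Jet.contMDiffAt_prolong (k := l) s).mdifferentiableAt (by simp)
  have hm : Jet.prolong l s s.base ∈ (Jet.homeo c (Jet.mk l s)).source := by
    rw [Jet.prolong_base]; exact hs
  have h2 : MDifferentiableAt 𝓘(ℝ, X × JetFib X Y l) 𝓘(ℝ, X × JetFib X Y l)
      (Jet.homeo c (Jet.mk l s)) (Jet.prolong l s s.base) :=
    (contMDiffAt_of_mem_maximalAtlas (Jet.homeo_mem c _) hm).mdifferentiableAt (by simp)
  have h3 := mfderiv_comp s.base h2 h1
  have h4 : (Jet.homeo c (Jet.mk l s) ∘ Jet.prolong l s) =ᶠ[𝓝 s.base] g ∘ c.base := by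
    filter_upwards [s.smooth.eventually_nhds, s.isSection.eventually_nhds, c.eventually_mem hs]
      with y k1 k2 k3
    have e : Jet.prolong l s y = Jet.mk l ⟨y, s.toFun, k1, k2⟩ := dif_pos ⟨k1, k2⟩
    rw [Function.comp_apply, e]
    exact Jet.coord_mk (s := ⟨y, s.toFun, k1, k2⟩) c k3
  have h5 := mfderiv_comp s.base (hg.differentiableAt.mdifferentiableAt)
    ((contMDiffAt_of_mem_maximalAtlas c.base_mem hb).mdifferentiableAt (by simp))
  rw [← h4.mfderiv_eq, h3, mfderiv_eq_fderiv, hg.fderiv] at h5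
  -- `Jet.mk l s` and `Jet.prolong l s s.base` are equal but not definitionally, so the derivative
  -- at one is transported to the other.
  have h6 : ∀ y : Jet π l, y = Jet.prolong l s s.base →
      (mfderiv 𝓘(ℝ, X × JetFib X Y l) 𝓘(ℝ, X × JetFib X Y l) (Jet.homeo c (Jet.mk l s)) y :
        X × JetFib X Y l →L[ℝ] X × JetFib X Y l) =
      mfderiv 𝓘(ℝ, X × JetFib X Y l) 𝓘(ℝ, X × JetFib X Y l) (Jet.homeo c (Jet.mk l s))
        (Jet.prolong l s s.base) := by
    rintro _ rfl; rfl
  have h7 := h6 _ (Jet.prolong_base (k := l) s).symm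
  exact (congrArg (fun L : X × JetFib X Y l →L[ℝ] X × JetFib X Y l =>
    L (mfderiv 𝓘(ℝ, X) 𝓘(ℝ, X × JetFib X Y l) (Jet.prolong l s) s.base x)) h7).trans
    (congrArg (fun L => L x) h5)

/-- The Cartan connection in jet coordinates. -/
theorem djet_cartan (c : BundleChart π) {z : Jet π (l + 1)} (hz : z.value ∈ c.total.source)
    (x : TangentSpace 𝓘(ℝ, X) z.trunc.base) :
    djet c z.trunc ((cartan z).lift x) =
      (dchart c.base z.trunc.base x,
        jetShift (Jet.coord c z).2 (dchart c.base z.trunc.base x)) := by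
  have hs : z.rep.value ∈ c.total.source := by rw [← Jet.mk_rep z] at hz; exact hz
  -- With the base point generalised, the transport in the definition of `cartan` disappears.
  have key : ∀ (y : Jet π l) (e : Jet.mk l z.rep = y) (x : TangentSpace 𝓘(ℝ, X) y.base),
      djet c y ((e ▸ z.rep.jetTangent l : JetFirstJetAt y).lift x) =
      (dchart c.base y.base x, jetShift (Jet.coord c z).2 (dchart c.base y.base x)) := by
    rintro _ rfl x
    exact djet_jetTangent c hs x
  exact key _ (Jet.mk_rep_trunc z) x

/-- The coordinates of a first jet of `π_l`. -/
def jetFirstCoord (c : BundleChart π) {y : Jet π l} (γ : JetFirstJetAt y) : X →L[ℝ] JetFib X Y l :=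
  (ContinuousLinearMap.snd ℝ X (JetFib X Y l)).comp
    ((djet c y).comp (γ.lift.comp (dchartInv c.base y.base)))

/-- The horizontal component is forced by the right-inverse condition, so `jetFirstCoord` carries
all the information of `γ`. -/
theorem djet_lift (c : BundleChart π) {y : Jet π l} (hy : y.value ∈ c.total.source)
    (γ : JetFirstJetAt y) (x : TangentSpace 𝓘(ℝ, X) y.base) :
    djet c y (γ.lift x) =
      (dchart c.base y.base x, jetFirstCoord c γ (dchart c.base y.base x)) := by
  refine Prod.ext ?_ ?_
  · rw [← dchart_mfderiv_base c hy]
    exact congrArg (fun L => dchart c.base y.base (L x)) γ.isLift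
  · show _ = (djet c y (γ.lift (dchartInv c.base y.base (dchart c.base y.base x)))).2
    rw [dchartInv_dchart c.base_mem (Jet.base_mem c hy)]

theorem jetFirst_ext (c : BundleChart π) {y : Jet π l} (hy : y.value ∈ c.total.source)
    {γ γ' : JetFirstJetAt y} (h : jetFirstCoord c γ = jetFirstCoord c γ') : γ = γ' := by
  refine FirstJetAt.ext (ContinuousLinearMap.ext fun x => ?_)
  rw [← djetInv_djet c hy (γ.lift x), ← djetInv_djet c hy (γ'.lift x), djet_lift c hy,
    djet_lift c hy, h]

theorem jetFirstCoord_cartan (c : BundleChart π) {z : Jet π (l + 1)}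
    (hz : z.value ∈ c.total.source) :
    jetFirstCoord c (cartan z) = jetShift (Jet.coord c z).2 := by
  have hz' : z.trunc.value ∈ c.total.source := by rw [Jet.value_trunc]; exact hz
  ext1 x
  show (djet c z.trunc ((cartan z).lift (dchartInv c.base z.trunc.base x))).2 = _
  rw [djet_cartan c hz, dchart_dchartInv c.base_mem (Jet.base_mem c hz')]

theorem vertOut_vertProj (c : BundleChart π) {y : Jet π l} (hy : y.value ∈ c.total.source)
    (γ : JetFirstJetAt y) (v : TangentSpace 𝓘(ℝ, X × JetFib X Y l) y) :
    vertOut c y (vertProj γ v) = (djet c y v).2 - jetFirstCoord c γ (djet c y v).1 := by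
  show (djet c y (v - γ.lift (mfderiv 𝓘(ℝ, X × JetFib X Y l) 𝓘(ℝ, X) Jet.base y v))).2 = _
  rw [map_sub, djet_lift c hy, dchart_mfderiv_base c hy]
  rfl

/-- The map `e^{1,n-1}(γ)` in coordinates. -/
theorem embedForm_apply (c : BundleChart π) {y : Jet π l} (hy : y.value ∈ c.total.source)
    (γ : JetFirstJetAt y) (p : DagFiber d y)
    (v : Fin (d + 1) → TangentSpace 𝓘(ℝ, X × JetFib X Y l) y) :
    embedForm γ p v = liouville (fibCoord d c y hy p) (fun i => djet c y (v i)) -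
      wedgeContr (jetFirstCoord c γ) (fibCoord d c y hy p) (fun i => (djet c y (v i)).1) := by
  rw [liouville_apply, wedgeContr_apply, ← Finset.sum_sub_distrib]
  refine (ContinuousAlternatingMap.alternatizeUncurryFin_apply _ _).trans
    (Finset.sum_congr rfl fun i _ => ?_)
  rw [← smul_sub]
  congr 1
  show p (vertProj γ (v i)) (fun j => mfderiv 𝓘(ℝ, X × JetFib X Y l) 𝓘(ℝ, X) Jet.base y
    (i.removeNth v j)) = _
  conv_lhs => rw [← fibCoordInv_fibCoord c y hy p]
  show fibCoord d c y hy p (vertOut c y (vertProj γ (v i))) (fun j => dchart c.base y.base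
    (mfderiv 𝓘(ℝ, X × JetFib X Y l) 𝓘(ℝ, X) Jet.base y (i.removeNth v j))) = _
  simp only [dchart_mfderiv_base c hy]
  rw [vertOut_vertProj c hy, map_sub]
  rfl

end JetCoordinates

/-! ### The Hamiltonian section in coordinates, and `θ` as its pull-back of the tautological form.
-/

section FieldTheory

variable {X Y A M E F : Type*}
  [NormedAddCommGroup X] [NormedSpace ℝ X] [NormedAddCommGroup Y] [NormedSpace ℝ Y]
  [NormedAddCommGroup A] [NormedSpace ℝ A]
  [TopologicalSpace M] [ChartedSpace X M] [TopologicalSpace E] [ChartedSpace A E]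
  [TopologicalSpace F] [ChartedSpace Y F]
  [IsManifold 𝓘(ℝ, X) ∞ M] [IsManifold 𝓘(ℝ, Y) ∞ F]
  {π : SmoothFiberBundle X Y A M E F} {l d : ℕ}

/-- All tangent spaces are definitionally the model space, so transporting a form along an equality
of points leaves its values unchanged. This and the next two lemmas remove the casts caused by
points that are only propositionally equal. -/
theorem cast_form_apply {V N : Type*} [NormedAddCommGroup V] [NormedSpace ℝ V]
    [TopologicalSpace N] [ChartedSpace V N] {k : ℕ} {x x' : N} (h : x = x')
    (f : TangentSpace 𝓘(ℝ, V) x [⋀^Fin k]→L[ℝ] ℝ) (v : Fin k → V) :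
    (h ▸ f : TangentSpace 𝓘(ℝ, V) x' [⋀^Fin k]→L[ℝ] ℝ) v = f v := by
  subst h; rfl

theorem dchart_congr {V N : Type*} [NormedAddCommGroup V] [NormedSpace ℝ V]
    [TopologicalSpace N] [ChartedSpace V N] (e : OpenPartialHomeomorph N V) {x x' : N}
    (h : x = x') : (dchart e x : V →L[ℝ] V) = dchart e x' := by
  subst h; rfl

theorem mfderiv_congr_fun {V W N N' : Type*} [NormedAddCommGroup V] [NormedSpace ℝ V]
    [NormedAddCommGroup W] [NormedSpace ℝ W] [TopologicalSpace N] [ChartedSpace V N]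
    [TopologicalSpace N'] [ChartedSpace W N'] {f g : N → N'} (h : f = g) (x : N) :
    (mfderiv 𝓘(ℝ, V) 𝓘(ℝ, W) f x : V →L[ℝ] W) = mfderiv 𝓘(ℝ, V) 𝓘(ℝ, W) g x := by
  subst h; rfl

namespace LagrangianDensity

variable (L : LagrangianDensity π l d)

/-- A Lagrangian density in the coordinates of a bundle chart. -/
def coord (c : BundleChart π) (z : Jet π (l + 1)) : X [⋀^Fin (d + 1)]→L[ℝ] ℝ :=
  (L.toFun z).compContinuousLinearMap (dchartInv c.base z.base)

/-- The horizontal part of `h + 𝕃` in the coordinates of a bundle chart. -/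
def hamCoord (c : BundleChart π) (z : Jet π (l + 1)) (p : DagModel X Y l d) :
    X [⋀^Fin (d + 1)]→L[ℝ] ℝ :=
  L.coord c z - wedgeContr (jetShift (Jet.coord c z).2) p

/-- The Cartan jet has coordinates `jetShift`, so `embedForm_apply` gives `p ∧ du` minus a wedge
contraction. That contraction and the Lagrangian are both horizontal and combine into `hamCoord`. -/
theorem hPlus_apply (c : BundleChart π) (w : NDag π l d)
    (hw : w.point.trunc.value ∈ c.total.source)
    (v : Fin (d + 1) → TangentSpace 𝓘(ℝ, X × JetFib X Y l) w.point.trunc) :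
    L.hPlus w v =
      liouville (fibCoord d c w.point.trunc hw w.form) (fun i => djet c w.point.trunc (v i)) +
      L.hamCoord c w.point (fibCoord d c w.point.trunc hw w.form)
        (fun i => (djet c w.point.trunc (v i)).1) := by
  have hz : w.point.value ∈ c.total.source := by rw [← Jet.value_trunc]; exact hw
  have h1 := embedForm_apply c hw (cartan w.point) w.form v
  rw [jetFirstCoord_cartan c hz] at h1
  have h2 : L.toFun w.point (fun i => mfderiv 𝓘(ℝ, X × JetFib X Y l) 𝓘(ℝ, X) Jet.base
      w.point.trunc (v i)) = L.coord c w.point (fun i => (djet c w.point.trunc (v i)).1) := by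
    show _ = L.toFun w.point (fun i => dchartInv c.base w.point.base
      (djet c w.point.trunc (v i)).1)
    congr 1
    funext i
    rw [← dchart_mfderiv_base c hw, dchart_congr c.base (Jet.base_trunc w.point)]
    exact (dchartInv_dchart c.base_mem (Jet.base_mem c hz) _).symm
  have h3 : L.hPlus w v = hForm w v + L.toFun w.point
      (fun i => mfderiv 𝓘(ℝ, X × JetFib X Y l) 𝓘(ℝ, X) Jet.base w.point.trunc (v i)) :=
    congrArg (hForm w v + ·) (cast_form_apply _ _ _)
  rw [h3, h2]
  show embedForm (cartan w.point) w.form v + _ = _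
  rw [h1]
  show _ = _ + (L.coord c w.point _ - wedgeContr _ _ _)
  ring

variable {L}

/-- The Hamiltonian section in the coordinates of a bundle chart. -/
theorem IsHyperregular.hamiltonian_apply (hL : L.IsHyperregular) (c : BundleChart π)
    (P : JDag π l d) (hP : P.point.value ∈ c.total.source)
    (v : Fin (d + 1) → TangentSpace 𝓘(ℝ, X × JetFib X Y l) P.point) :
    hL.hamiltonian P v =
      liouville (fibCoord d c P.point hP P.form) (fun i => djet c P.point (v i)) +
      L.hamCoord c (hL.sec P).point (fibCoord d c P.point hP P.form)
        (fun i => (djet c P.point (v i)).1) := by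
  -- Stated for an arbitrary `w` over `Q`, so that `Q` can be replaced by `w.toDag` and the cast in
  -- `hamiltonian` vanishes.
  have key : ∀ (w : NDag π l d) (Q : JDag π l d), w.toDag = Q →
      ∀ (h' : w.point.trunc = Q.point) (hQ : Q.point.value ∈ c.total.source)
      (v : Fin (d + 1) → TangentSpace 𝓘(ℝ, X × JetFib X Y l) Q.point),
      (h' ▸ L.hPlus w : TangentSpace 𝓘(ℝ, X × JetFib X Y l) Q.point [⋀^Fin (d + 1)]→L[ℝ] ℝ) v =
      liouville (fibCoord d c Q.point hQ Q.form) (fun i => djet c Q.point (v i)) +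
      L.hamCoord c w.point (fibCoord d c Q.point hQ Q.form)
        (fun i => (djet c Q.point (v i)).1) := by
    rintro w _ rfl h' hQ v
    exact L.hPlus_apply c w hQ v
  exact key _ P (hL.isInverseSection.toDag_apply P) _ hP v

theorem IsHyperregular.contMDiff_sec_point (hL : L.IsHyperregular) :
    ContMDiff 𝓘(ℝ, JDagModel X Y l d) 𝓘(ℝ, X × JetFib X Y (l + 1)) ∞
      (fun P => (hL.sec P).point) :=
  (DagOver.contMDiff_point (d := d) (Jet.trunc : Jet π (l + 1) → Jet π l)
    Jet.contMDiff_trunc).comp hL.isInverseSection.smooth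

/-- The projection of `N†` to `M` factors through `J^l`, so the Lagrangian term is pulled back from
`J^l` as well. By the chain rule, `θ'` is the pull-back of `h + 𝕃`. -/
theorem thetaPrime_apply (L : LagrangianDensity π l d) (w : NDag π l d)
    (v : Fin (d + 1) → TangentSpace 𝓘(ℝ, NDagModel X Y l d) w) :
    L.thetaPrime w v = L.hPlus w (fun i => mfderiv 𝓘(ℝ, NDagModel X Y l d)
      𝓘(ℝ, X × JetFib X Y l) (fun w : NDag π l d => w.point.trunc) w (v i)) := by
  have h3 : ∀ u, L.hPlus w u = hForm w u + L.toFun w.point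
      (fun i => mfderiv 𝓘(ℝ, X × JetFib X Y l) 𝓘(ℝ, X) Jet.base w.point.trunc (u i)) :=
    fun u => congrArg (hForm w u + ·) (cast_form_apply _ _ _)
  rw [h3]
  have hp : ContMDiff 𝓘(ℝ, NDagModel X Y l d) 𝓘(ℝ, X × JetFib X Y (l + 1)) ∞
      (fun w : NDag π l d => w.point) :=
    DagOver.contMDiff_point (d := d) (Jet.trunc : Jet π (l + 1) → Jet π l) Jet.contMDiff_trunc
  have ht : ContMDiff 𝓘(ℝ, NDagModel X Y l d) 𝓘(ℝ, X × JetFib X Y l) ∞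
      (fun w : NDag π l d => w.point.trunc) := Jet.contMDiff_trunc.comp hp
  have h4 := mfderiv_comp w ((Jet.contMDiff_base (π := π) (k := l)
    w.point.trunc).mdifferentiableAt (by simp)) ((ht w).mdifferentiableAt (by simp))
  have h5 := mfderiv_congr_fun (V := NDagModel X Y l d) (W := X)
    (f := (Jet.base : Jet π l → M) ∘ fun w : NDag π l d => w.point.trunc)
    (g := fun w : NDag π l d => w.point.base) (funext fun w => Jet.base_trunc w.point) w
  have h6 : ∀ u, mfderiv 𝓘(ℝ, NDagModel X Y l d) 𝓘(ℝ, X)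
      (fun w : NDag π l d => w.point.base) w u = mfderiv 𝓘(ℝ, X × JetFib X Y l) 𝓘(ℝ, X) Jet.base
        w.point.trunc (mfderiv 𝓘(ℝ, NDagModel X Y l d)
      𝓘(ℝ, X × JetFib X Y l) (fun w : NDag π l d => w.point.trunc) w u) :=
    fun u => congrArg (fun T : NDagModel X Y l d →L[ℝ] X => T u) (h5.symm.trans h4)
  show hForm w _ + L.toFun w.point (fun i => mfderiv 𝓘(ℝ, NDagModel X Y l d) 𝓘(ℝ, X)
      (fun w : NDag π l d => w.point.base) w (v i)) = _
  congr 2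
  funext i
  exact h6 (v i)

/-- `θ` is the pull-back of the tautological form along the Hamiltonian section. -/
theorem IsHyperregular.theta_apply (hL : L.IsHyperregular) (P : JDag π l d)
    (v : Fin (d + 1) → TangentSpace 𝓘(ℝ, JDagModel X Y l d) P) :
    hL.theta P v = hL.hamiltonian P (fun i => mfderiv 𝓘(ℝ, JDagModel X Y l d)
      𝓘(ℝ, X × JetFib X Y l) (fun Q : JDag π l d => Q.point) P (v i)) := by
  have h1 : hL.theta P v = L.thetaPrime (hL.sec P) (fun i => mfderiv 𝓘(ℝ, JDagModel X Y l d)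
    𝓘(ℝ, NDagModel X Y l d) hL.sec P (v i)) := rfl
  have hp : ContMDiff 𝓘(ℝ, NDagModel X Y l d) 𝓘(ℝ, X × JetFib X Y (l + 1)) ∞
      (fun w : NDag π l d => w.point) :=
    DagOver.contMDiff_point (d := d) (Jet.trunc : Jet π (l + 1) → Jet π l) Jet.contMDiff_trunc
  have ht : ContMDiff 𝓘(ℝ, NDagModel X Y l d) 𝓘(ℝ, X × JetFib X Y l) ∞
      (fun w : NDag π l d => w.point.trunc) := Jet.contMDiff_trunc.comp hp
  -- Following `𝔰` by the projection to `J^l` gives `τ₀†`, so the derivative of `𝔰` enters `θ` only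
  -- through that of `τ₀†`.
  have h4 := mfderiv_comp P ((ht (hL.sec P)).mdifferentiableAt (by simp))
    ((hL.isInverseSection.smooth P).mdifferentiableAt (by simp))
  have h5 := mfderiv_congr_fun (V := JDagModel X Y l d) (W := X × JetFib X Y l)
    (f := (fun w : NDag π l d => w.point.trunc) ∘ hL.sec)
    (g := fun Q : JDag π l d => Q.point) (funext fun Q => hL.trunc_sec Q) P
  rw [h1, thetaPrime_apply]
  refine Eq.trans ?_ (cast_form_apply (hL.trunc_sec P) (L.hPlus (hL.sec P)) _).symm
  congr 1
  funext i
  exact congrArg (fun T : JDagModel X Y l d →L[ℝ] X × JetFib X Y l => T (v i)) (h4.symm.trans h5)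

end LagrangianDensity

end FieldTheory

/-! ### Charts of `J†` and coordinates of first jets of `τ†`. -/

section FieldTheory

variable {X Y A M E F : Type*}
  [NormedAddCommGroup X] [NormedSpace ℝ X] [NormedAddCommGroup Y] [NormedSpace ℝ Y]
  [NormedAddCommGroup A] [NormedSpace ℝ A]
  [TopologicalSpace M] [ChartedSpace X M] [TopologicalSpace E] [ChartedSpace A E]
  [TopologicalSpace F] [ChartedSpace Y F]
  [IsManifold 𝓘(ℝ, X) ∞ M] [IsManifold 𝓘(ℝ, Y) ∞ F]
  {π : SmoothFiberBundle X Y A M E F} {l d : ℕ}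

/-- The chart of `J†π_l` given by a bundle chart. -/
def JDag.homeo (d : ℕ) (c : BundleChart π) (y : Jet π l) :
    OpenPartialHomeomorph (JDag π l d) (JDagModel X Y l d) :=
  (DagOver.atlas d (fun y : Jet π l => y) contMDiff_id).homeo
    (⟨Jet.homeo c y, Jet.homeo_mem c y⟩, c)

theorem JDag.homeo_mem (c : BundleChart π) (y : Jet π l) :
    JDag.homeo d c y ∈ IsManifold.maximalAtlas 𝓘(ℝ, JDagModel X Y l d) ∞ (JDag π l d) :=
  (DagOver.atlas d (fun y : Jet π l => y) contMDiff_id).homeo_mem _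

theorem JDag.mem_homeo_source {c : BundleChart π} {y : Jet π l} {P : JDag π l d} :
    P ∈ (JDag.homeo d c y).source ↔ P.point.value ∈ c.total.source :=
  ⟨fun h => h.2, fun h => ⟨h, h⟩⟩

theorem JDag.homeo_apply (c : BundleChart π) (y : Jet π l) (P : JDag π l d)
    (hP : P.point.value ∈ c.total.source) :
    JDag.homeo d c y P = (Jet.coord c P.point, fibCoord d c P.point hP P.form) :=
  Prod.ext rfl (dif_pos hP)

/-- The atlases of `J†` and `J^l` choose the same bundle chart at corresponding points. This matters
because `mextDeriv` and `inTangentCoordinates` are computed in preferred charts. -/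
theorem JDag.exists_chartAt_eq (P : JDag π l d) : ∃ c : BundleChart π,
    P.point.value ∈ c.total.source ∧
    chartAt (JDagModel X Y l d) P = JDag.homeo d c P.point ∧
    chartAt (X × JetFib X Y l) P.point = Jet.homeo c P.point :=
  ⟨(exists_bundleChart π P.point.value).choose,
    (exists_bundleChart π P.point.value).choose_spec, rfl, rfl⟩

/-- In these charts `τ₀†` is the first projection, which is linear. -/
theorem JDag.djet_mfderiv_point (c : BundleChart π) (y : Jet π l) {P : JDag π l d}
    (hP : P.point.value ∈ c.total.source) (v : TangentSpace 𝓘(ℝ, JDagModel X Y l d) P) :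
    djet c P.point (mfderiv 𝓘(ℝ, JDagModel X Y l d) 𝓘(ℝ, X × JetFib X Y l)
      (fun Q : JDag π l d => Q.point) P v) = (dchart (JDag.homeo d c y) P v).1 := by
  have h1 := mfderiv_comp P
    ((contMDiffAt_of_mem_maximalAtlas (Jet.homeo_mem c P.point)
      (show P.point ∈ _ from hP)).mdifferentiableAt (by simp))
    ((JDag.contMDiff_point (π := π) (l := l) (d := d) P).mdifferentiableAt (by simp))
  have h2 := mfderiv_comp (I := 𝓘(ℝ, JDagModel X Y l d)) (I' := 𝓘(ℝ, JDagModel X Y l d))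
    (I'' := 𝓘(ℝ, X × JetFib X Y l)) P (g := (Prod.fst : JDagModel X Y l d → X × JetFib X Y l))
    (f := JDag.homeo d c y) differentiableAt_fst.mdifferentiableAt
    ((contMDiffAt_of_mem_maximalAtlas (JDag.homeo_mem c y)
      (JDag.mem_homeo_source.2 hP)).mdifferentiableAt (by simp))
  have h3 := h1.symm.trans h2
  have h4 := congrArg (fun T => T v) h3
  rw [mfderiv_eq_fderiv, fderiv_fst] at h4
  exact h4

theorem JDag.dchart_mfderiv_tauDag (c : BundleChart π) (y : Jet π l) {P : JDag π l d}
    (hP : P.point.value ∈ c.total.source) (v : TangentSpace 𝓘(ℝ, JDagModel X Y l d) P) :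
    dchart c.base P.point.base (mfderiv 𝓘(ℝ, JDagModel X Y l d) 𝓘(ℝ, X)
      (tauDag : JDag π l d → M) P v) = (dchart (JDag.homeo d c y) P v).1.1 := by
  have h := mfderiv_comp P
    ((Jet.contMDiff_base (π := π) (k := l) P.point).mdifferentiableAt (by simp))
    ((JDag.contMDiff_point (π := π) (l := l) (d := d) P).mdifferentiableAt (by simp))
  rw [← JDag.djet_mfderiv_point c y hP, ← dchart_mfderiv_base c hP]
  exact congrArg (fun T => dchart c.base P.point.base (T v)) h

/-- The coordinates of a first jet of `τ†`. -/
def firstJetCoord (c : BundleChart π) {P : JDag π l d}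
    (z : FirstJetAt X (JDagModel X Y l d) tauDag P) : X →L[ℝ] JDagModel X Y l d :=
  (dchart (JDag.homeo d c P.point) P).comp (z.lift.comp (dchartInv c.base P.point.base))

theorem firstJetCoord_fst_fst (c : BundleChart π) {P : JDag π l d}
    (hP : P.point.value ∈ c.total.source)
    (z : FirstJetAt X (JDagModel X Y l d) tauDag P) (x : X) :
    (firstJetCoord c z x).1.1 = x := by
  have h := JDag.dchart_mfderiv_tauDag c P.point hP (z.lift (dchartInv c.base P.point.base x))
  refine h.symm.trans ?_
  refine Eq.trans ?_ (dchart_dchartInv c.base_mem (Jet.base_mem c hP) x)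
  exact congrArg (fun T => dchart c.base P.point.base (T (dchartInv c.base P.point.base x)))
    z.isLift

theorem jetFirstCoord_tauZeroProl (c : BundleChart π) {P : JDag π l d}
    (hP : P.point.value ∈ c.total.source) (z : FirstJetAt X (JDagModel X Y l d) tauDag P) :
    jetFirstCoord c (tauZeroProl z) = (ContinuousLinearMap.snd ℝ X (JetFib X Y l)).comp
      ((ContinuousLinearMap.fst ℝ _ _).comp (firstJetCoord c z)) := by
  ext1 x
  exact congrArg Prod.snd (JDag.djet_mfderiv_point c P.point hP
    (z.lift (dchartInv c.base P.point.base x)))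

/-- Conjugating `Z` by the chart differentials gives the jet; the condition on `Z` is exactly the
right-inverse condition read in coordinates. -/
theorem exists_firstJetCoord_eq (c : BundleChart π) {P : JDag π l d}
    (hP : P.point.value ∈ c.total.source) (Z : X →L[ℝ] JDagModel X Y l d)
    (hZ : ∀ x, (Z x).1.1 = x) :
    ∃ z : FirstJetAt X (JDagModel X Y l d) (tauDag : JDag π l d → M) P,
      firstJetCoord c z = Z := by
  have hs : P ∈ (JDag.homeo d c P.point).source := JDag.mem_homeo_source.2 hP
  refine ⟨⟨(dchartInv (JDag.homeo d c P.point) P).comp (Z.comp (dchart c.base P.point.base)), ?_⟩,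
    ?_⟩
  · ext1 x
    show mfderiv 𝓘(ℝ, JDagModel X Y l d) 𝓘(ℝ, X) (tauDag : JDag π l d → M) P
      (dchartInv (JDag.homeo d c P.point) P (Z (dchart c.base P.point.base x))) = x
    have h := JDag.dchart_mfderiv_tauDag c P.point hP
      (dchartInv (JDag.homeo d c P.point) P (Z (dchart c.base P.point.base x)))
    rw [dchart_dchartInv (JDag.homeo_mem c P.point) hs, hZ] at h
    have h' := congrArg (dchartInv c.base P.point.base) h
    rwa [dchartInv_dchart c.base_mem (Jet.base_mem c hP),
      dchartInv_dchart c.base_mem (Jet.base_mem c hP)] at h'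
  · ext1 x
    show dchart (JDag.homeo d c P.point) P (dchartInv (JDag.homeo d c P.point) P
      (Z (dchart c.base P.point.base (dchartInv c.base P.point.base x)))) = Z x
    rw [dchart_dchartInv (JDag.homeo_mem c P.point) hs,
      dchart_dchartInv c.base_mem (Jet.base_mem c hP)]

/-! ### The forms `θ` and `ω`, and the kernel condition, in a chart of `J†`. -/

namespace LagrangianDensity

variable {L : LagrangianDensity π l d}

theorem contMDiffAt_coord (L : LagrangianDensity π l d) (c : BundleChart π) {z : Jet π (l + 1)}
    (hz : z.value ∈ c.total.source) :
    ContMDiffAt 𝓘(ℝ, X × JetFib X Y (l + 1)) 𝓘(ℝ, X [⋀^Fin (d + 1)]→L[ℝ] ℝ) ∞ (L.coord c) z :=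
  (L.smooth c.base c.base_mem).contMDiffAt ((c.base.open_source.preimage
    (Jet.contMDiff_base (π := π) (k := l + 1)).continuous).mem_nhds (Jet.base_mem c hz))

/-- The horizontal part of the Hamiltonian section in a chart of `J†π_l`. -/
def IsHyperregular.hamChart (hL : L.IsHyperregular) (c : BundleChart π) (y : Jet π l)
    (q : JDagModel X Y l d) : X [⋀^Fin (d + 1)]→L[ℝ] ℝ :=
  L.hamCoord c (hL.sec ((JDag.homeo d c y).symm q)).point q.2

/-- Smoothness of `𝔰` and of the Lagrangian enters here. The remaining ingredients, `jetShift` and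
the wedge contraction, are smooth in the jet coordinates and linear in `p`. -/
theorem IsHyperregular.contDiffAt_hamChart (hL : L.IsHyperregular) (c : BundleChart π)
    (y : Jet π l) {P : JDag π l d} (hP : P.point.value ∈ c.total.source) :
    ContDiffAt ℝ ∞ (hL.hamChart c y) (JDag.homeo d c y P) := by
  have hs : P ∈ (JDag.homeo d c y).source := JDag.mem_homeo_source.2 hP
  have hz : (hL.sec P).point.value ∈ c.total.source := by
    rw [← Jet.value_trunc, hL.trunc_sec]; exact hP
  have h1 : ContMDiffAt 𝓘(ℝ, JDagModel X Y l d) 𝓘(ℝ, X × JetFib X Y (l + 1)) ∞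
      (fun q => (hL.sec ((JDag.homeo d c y).symm q)).point) (JDag.homeo d c y P) :=
    (hL.contMDiff_sec_point _).comp (JDag.homeo d c y P)
      (contMDiffAt_symm_of_mem_maximalAtlas (JDag.homeo_mem c y)
        ((JDag.homeo d c y).map_source hs))
  have hz' : (hL.sec ((JDag.homeo d c y).symm (JDag.homeo d c y P))).point.value ∈
      c.total.source := by rw [(JDag.homeo d c y).left_inv hs]; exact hz
  have h2 : ContDiffAt ℝ ∞ (fun q => L.coord c (hL.sec ((JDag.homeo d c y).symm q)).point)
      (JDag.homeo d c y P) :=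
    (ContMDiffAt.comp (JDag.homeo d c y P) (L.contMDiffAt_coord c hz') h1).contDiffAt
  have h3 : ContDiffAt ℝ ∞ (fun q => Jet.coord c (hL.sec ((JDag.homeo d c y).symm q)).point)
      (JDag.homeo d c y P) := by
    have k : ContMDiffAt 𝓘(ℝ, X × JetFib X Y (l + 1)) 𝓘(ℝ, X × JetFib X Y (l + 1)) ∞
        (Jet.homeo c (hL.sec P).point)
        (hL.sec ((JDag.homeo d c y).symm (JDag.homeo d c y P))).point :=
      contMDiffAt_of_mem_maximalAtlas (Jet.homeo_mem c _) hz'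
    exact (ContMDiffAt.comp (JDag.homeo d c y P) k h1).contDiffAt
  have h4 : ContDiffAt ℝ ∞
      (fun q => jetShift (Jet.coord c (hL.sec ((JDag.homeo d c y).symm q)).point).2)
      (JDag.homeo d c y P) :=
    contDiff_jetShift.contDiffAt.comp _ (contDiffAt_snd.comp _ h3)
  have h5 := ContDiffAt.comp (JDag.homeo d c y P)
    (contDiff_wedgeContr (X := X) (J := JetFib X Y l) (d := d)).contDiffAt h4
  exact h2.sub (h5.clm_apply contDiffAt_snd)

theorem IsHyperregular.hamiltonian_eq (hL : L.IsHyperregular) (c : BundleChart π) (y : Jet π l)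
    {P : JDag π l d} (hP : P.point.value ∈ c.total.source)
    (v : Fin (d + 1) → TangentSpace 𝓘(ℝ, X × JetFib X Y l) P.point) :
    hL.hamiltonian P v =
      liouville (JDag.homeo d c y P).2 (fun i => djet c P.point (v i)) +
      hL.hamChart c y (JDag.homeo d c y P) (fun i => (djet c P.point (v i)).1) := by
  rw [hL.hamiltonian_apply c P hP, hamChart,
    (JDag.homeo d c y).left_inv (JDag.mem_homeo_source.2 hP), JDag.homeo_apply c y P hP]

/-- `θ` in a chart of `J†π_l`. -/
theorem IsHyperregular.theta_chart (hL : L.IsHyperregular) (c : BundleChart π) (y : Jet π l)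
    {q : JDagModel X Y l d} (hq : q ∈ (JDag.homeo d c y).target) :
    (hL.theta ((JDag.homeo d c y).symm q)).compContinuousLinearMap
      (dchartInv (JDag.homeo d c y) ((JDag.homeo d c y).symm q)) =
    coordForm (hL.hamChart c y) q := by
  have hs := (JDag.homeo d c y).map_target hq
  have hP := JDag.mem_homeo_source.1 hs
  ext v
  show hL.theta ((JDag.homeo d c y).symm q)
    (fun i => dchartInv (JDag.homeo d c y) ((JDag.homeo d c y).symm q) (v i)) = _
  rw [hL.theta_apply, hL.hamiltonian_eq c y hP]
  simp only [JDag.djet_mfderiv_point c y hP, dchart_dchartInv (JDag.homeo_mem c y) hs]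
  rw [(JDag.homeo d c y).right_inv hq]
  rfl

theorem IsHyperregular.omega_eq (hL : L.IsHyperregular) (c : BundleChart π) {P : JDag π l d}
    (hP : P.point.value ∈ c.total.source)
    (hc : chartAt (JDagModel X Y l d) P = JDag.homeo d c P.point) :
    hL.omega P = (extDeriv (coordForm (hL.hamChart c P.point))
      (JDag.homeo d c P.point P)).compContinuousLinearMap
        (dchart (JDag.homeo d c P.point) P) := by
  have hs : P ∈ (JDag.homeo d c P.point).source := JDag.mem_homeo_source.2 hP
  rw [omega, mextDeriv, hc]
  congr 1
  unfold extDeriv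
  congr 1
  -- The coordinate expression of `θ` holds on the open chart target only, which suffices for the
  -- derivative at one of its points.
  apply Filter.EventuallyEq.fderiv_eq
  filter_upwards [(JDag.homeo d c P.point).open_target.mem_nhds
    ((JDag.homeo d c P.point).map_source hs)] with q hq
  exact hL.theta_chart c P.point hq

/-- Chart differentials are invertible and match vertical vectors of `τ†` with vectors having zero
`X`-component. The test vectors `v` and `w` can therefore be taken in the model spaces. -/
theorem IsHyperregular.mem_kerOmega_iff (hL : L.IsHyperregular) (c : BundleChart π)
    {P : JDag π l d} (hP : P.point.value ∈ c.total.source)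
    (hc : chartAt (JDagModel X Y l d) P = JDag.homeo d c P.point)
    (z : FirstJetAt X (JDagModel X Y l d) tauDag P) :
    z ∈ hL.kerOmega P ↔ ∀ v : JDagModel X Y l d, v.1.1 = 0 → ∀ w : Fin (d + 1) → X,
      extDeriv (coordForm (hL.hamChart c P.point)) (JDag.homeo d c P.point P)
        (Fin.cons v fun i => firstJetCoord c z (w i)) = 0 := by
  have hs : P ∈ (JDag.homeo d c P.point).source := JDag.mem_homeo_source.2 hP
  have hb := Jet.base_mem c hP
  show (∀ v, _ → ∀ w : Fin (d + 1) → TangentSpace 𝓘(ℝ, X) (tauDag P), _) ↔ _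
  have e : ∀ (v : TangentSpace 𝓘(ℝ, JDagModel X Y l d) P)
      (w : Fin (d + 1) → TangentSpace 𝓘(ℝ, X) (tauDag P)),
      hL.omega P (Fin.cons v fun i => z.lift (w i)) =
      extDeriv (coordForm (hL.hamChart c P.point)) (JDag.homeo d c P.point P)
        (Fin.cons (dchart (JDag.homeo d c P.point) P v) fun i => firstJetCoord c z
          (dchart c.base P.point.base (w i))) := by
    intro v w
    rw [hL.omega_eq c hP hc]
    refine congrArg (extDeriv (coordForm (hL.hamChart c P.point)) (JDag.homeo d c P.point P)) ?_
    funext j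
    refine Fin.cases rfl (fun i => ?_) j
    show dchart (JDag.homeo d c P.point) P (z.lift (w i)) = dchart (JDag.homeo d c P.point) P
      (z.lift (dchartInv c.base P.point.base (dchart c.base P.point.base (w i))))
    rw [dchartInv_dchart c.base_mem hb]
  constructor
  · intro H v hv w
    have h1 := H (dchartInv (JDag.homeo d c P.point) P v) ?_
      (fun i => dchartInv c.base P.point.base (w i))
    · rw [e, dchart_dchartInv (JDag.homeo_mem c P.point) hs] at h1
      simpa only [dchart_dchartInv c.base_mem hb] using h1
    · have h2 := JDag.dchart_mfderiv_tauDag c P.point hP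
        (dchartInv (JDag.homeo d c P.point) P v)
      rw [dchart_dchartInv (JDag.homeo_mem c P.point) hs, hv] at h2
      have h3 := congrArg (dchartInv c.base P.point.base) h2
      rwa [dchartInv_dchart c.base_mem hb, map_zero] at h3
  · intro H v hv w
    rw [e]
    refine H _ ?_ _
    have h2 := JDag.dchart_mfderiv_tauDag c P.point hP v
    rw [← h2]
    exact (congrArg (dchart c.base P.point.base) hv).trans (map_zero _)

end LagrangianDensity

end FieldTheory

/-! ### Affine structure of the fibres, and smoothness of maps into `J^1 π_l`. -/

section FieldTheory

variable {X Y A M E F : Type*}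
  [NormedAddCommGroup X] [NormedSpace ℝ X] [NormedAddCommGroup Y] [NormedSpace ℝ Y]
  [NormedAddCommGroup A] [NormedSpace ℝ A]
  [TopologicalSpace M] [ChartedSpace X M] [TopologicalSpace E] [ChartedSpace A E]
  [TopologicalSpace F] [ChartedSpace Y F]
  [IsManifold 𝓘(ℝ, X) ∞ M] [IsManifold 𝓘(ℝ, Y) ∞ F]
  {π : SmoothFiberBundle X Y A M E F} {l d : ℕ}

theorem JDag.homeo_add_smul (c : BundleChart π) (y : Jet π l) {P : JDag π l d}
    (hP : P.point.value ∈ c.total.source) (t : ℝ) (q : DagFiber d P.point) :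
    JDag.homeo d c y ⟨P.point, P.form + t • q⟩ =
      JDag.homeo d c y P + t • (0, fibCoord d c P.point hP q) := by
  rw [JDag.homeo_apply c y P hP, JDag.homeo_apply c y ⟨P.point, P.form + t • q⟩ hP]
  refine Prod.ext ?_ ?_
  · show Jet.coord c P.point = Jet.coord c P.point + t • 0
    rw [smul_zero, add_zero]
  · show fibCoord d c P.point hP (P.form + t • q) =
      fibCoord d c P.point hP P.form + t • fibCoord d c P.point hP q
    rfl

/-- The two centres are kept separate because `inTangentCoordinates` uses the chart at `(G
P₀).point`, which is only propositionally equal to `P₀.point`. -/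
theorem mfderiv_extChartAt_eq_dchart {V N : Type*} [NormedAddCommGroup V] [NormedSpace ℝ V]
    [TopologicalSpace N] [ChartedSpace V N] {x₀ x₁ : N} (h : x₀ = x₁) (x : N) :
    (mfderiv 𝓘(ℝ, V) 𝓘(ℝ, V) (extChartAt 𝓘(ℝ, V) x₀) x : V →L[ℝ] V) =
      dchart (chartAt V x₁) x := by
  subst h
  rfl

theorem dchart_mfderivWithin_extChartAt_symm {V N : Type*} [NormedAddCommGroup V]
    [NormedSpace ℝ V] [TopologicalSpace N] [ChartedSpace V N] [IsManifold 𝓘(ℝ, V) ∞ N]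
    {e : OpenPartialHomeomorph N V} (he : e ∈ IsManifold.maximalAtlas 𝓘(ℝ, V) ∞ N) {x₀ x₁ x : N}
    (h : x₀ = x₁) (hx : x ∈ e.source) (hx' : x ∈ (chartAt V x₁).source) (v : V) :
    dchart e x (mfderivWithin 𝓘(ℝ, V) 𝓘(ℝ, V) (extChartAt 𝓘(ℝ, V) x₀).symm (range 𝓘(ℝ, V))
      (extChartAt 𝓘(ℝ, V) x₀ x) v) =
    fderiv ℝ (e ∘ (chartAt V x₁).symm) (chartAt V x₁ x) v := by
  subst h
  have hinv := (chartAt V x₀).left_inv hx'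
  have h1 : MDifferentiableAt 𝓘(ℝ, V) 𝓘(ℝ, V) e ((chartAt V x₀).symm (chartAt V x₀ x)) := by
    rw [hinv]
    exact (contMDiffAt_of_mem_maximalAtlas he hx).mdifferentiableAt (by simp)
  have h2 : MDifferentiableAt 𝓘(ℝ, V) 𝓘(ℝ, V) (chartAt V x₀).symm (chartAt V x₀ x) :=
    (contMDiffAt_symm_of_mem_maximalAtlas (IsManifold.chart_mem_maximalAtlas (n := ∞) x₀)
      ((chartAt V x₀).map_source hx')).mdifferentiableAt (by simp)
  have h3 := mfderiv_comp _ h1 h2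
  rw [mfderiv_eq_fderiv] at h3
  have h4 : mfderivWithin 𝓘(ℝ, V) 𝓘(ℝ, V) (extChartAt 𝓘(ℝ, V) x₀).symm (range 𝓘(ℝ, V))
      (extChartAt 𝓘(ℝ, V) x₀ x) =
      mfderiv 𝓘(ℝ, V) 𝓘(ℝ, V) (chartAt V x₀).symm (chartAt V x₀ x) := by
    rw [modelWithCornersSelf_coe, range_id, mfderivWithin_univ]
    rfl
  have h5 := dchart_congr e hinv
  refine Eq.trans ?_ (congrArg (fun T : V →L[ℝ] V => T v) h3.symm)
  refine (congrArg (dchart e x) (congrArg (fun T : V →L[ℝ] V => T v) h4)).trans ?_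
  exact (congrArg (fun T : V →L[ℝ] V => T _) h5).symm

/-- A map into `J^1 π_l` is smooth if its coordinates in bundle charts are. -/
theorem JetFirstJet.isSmoothMap_of_coord {G : JDag π l d → JetFirstJet π l}
    (hG : ∀ P, (G P).point = P.point)
    (h : ∀ (P₀ : JDag π l d) (c : BundleChart π), P₀.point.value ∈ c.total.source →
      ContMDiffAt 𝓘(ℝ, JDagModel X Y l d) 𝓘(ℝ, X →L[ℝ] JetFib X Y l) ∞
        (fun P => jetFirstCoord c (G P).jet) P₀) :
    JetFirstJet.IsSmoothMap G := by
  have hp : ContMDiff 𝓘(ℝ, JDagModel X Y l d) 𝓘(ℝ, X × JetFib X Y l) ∞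
      (fun P => (G P).point) := by
    simp only [hG]
    exact JDag.contMDiff_point
  refine ⟨hp, fun P₀ => ?_⟩
  obtain ⟨c, hc, -, hchart⟩ := JDag.exists_chartAt_eq P₀
  have hs : P₀ ∈ (JDag.homeo d c P₀.point).source := JDag.mem_homeo_source.2 hc
  let e := chartAt X P₀.point.base
  have he : e ∈ IsManifold.maximalAtlas 𝓘(ℝ, X) ∞ M := IsManifold.chart_mem_maximalAtlas _
  have hbase : ContMDiff 𝓘(ℝ, JDagModel X Y l d) 𝓘(ℝ, X) ∞ (fun P : JDag π l d => P.point.base) :=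
    Jet.contMDiff_base.comp JDag.contMDiff_point
  have k1 : ContMDiffAt 𝓘(ℝ, JDagModel X Y l d) 𝓘(ℝ, X →L[ℝ] X) ∞
      (fun P : JDag π l d => fderiv ℝ (c.base ∘ e.symm) (e P.point.base)) P₀ := by
    have h1 := (contDiffAt_trans c.base_mem he (Jet.base_mem c hc)
      (mem_chart_source X P₀.point.base)).fderiv_right (m := ∞) (by simp)
    exact ContMDiffAt.comp P₀ (g := fun a => fderiv ℝ (c.base ∘ e.symm) (e a))
      (ContMDiffAt.comp _ h1.contMDiffAt
        (contMDiffAt_of_mem_maximalAtlas he (mem_chart_source X P₀.point.base))) (hbase P₀)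
  -- In tangent coordinates the jet is `u ↦ (u, γ u)` precomposed with the derivative of a change of
  -- charts of `M`, since `c.base` need not be the preferred chart of `M`. On `J^l` no such
  -- correction is needed, by `hchart`.
  have k2 : ContMDiffAt 𝓘(ℝ, JDagModel X Y l d) 𝓘(ℝ, X →L[ℝ] X × JetFib X Y l) ∞
      (fun P : JDag π l d => ((ContinuousLinearMap.inl ℝ X (JetFib X Y l)) +
        (ContinuousLinearMap.inr ℝ X (JetFib X Y l)).comp (jetFirstCoord c (G P).jet)).comp
        (fderiv ℝ (c.base ∘ e.symm) (e P.point.base))) P₀ := by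
    refine ContMDiffAt.clm_comp ?_ k1
    refine contMDiffAt_const.add ?_
    exact ContMDiffAt.clm_comp contMDiffAt_const (h P₀ c hc)
  refine k2.congr_of_eventuallyEq ?_
  filter_upwards [(JDag.homeo d c P₀.point).open_source.mem_nhds hs,
    hbase.continuous.continuousAt.eventually_mem (e.open_source.mem_nhds
      (mem_chart_source X P₀.point.base))] with P hP heP
  have hP : P.point.value ∈ c.total.source := JDag.mem_homeo_source.1 hP
  have hGP : (G P).point.value ∈ c.total.source := by rw [hG]; exact hP
  have heG : (G P).point.base ∈ e.source := by rw [hG]; exact heP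
  have hx : (G P).point.base ∈ (chartAt X (G P₀).point.base).source := by rw [hG P₀]; exact heG
  have hy : (G P).point ∈ (chartAt (X × JetFib X Y l) (G P₀).point).source := by
    rw [hG P₀, hchart]; exact hGP
  have key := inTangentCoordinates_eq_mfderiv_comp (I := 𝓘(ℝ, X)) (I' := 𝓘(ℝ, X × JetFib X Y l))
    (f := fun P => (G P).point.base) (g := fun P => (G P).point) (ϕ := fun P => (G P).jet.lift)
    (x₀ := P₀) (x := P) hx hy
  refine key.trans ?_
  rw [← hG P]
  ext1 x
  have h1 := mfderiv_extChartAt_eq_dchart (V := X × JetFib X Y l) (hG P₀) (G P).point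
  rw [hchart] at h1
  refine (congrArg (fun T : X × JetFib X Y l →L[ℝ] X × JetFib X Y l => T _) h1).trans ?_
  refine (djet_lift c hGP (G P).jet _).trans ?_
  have h2 := dchart_mfderivWithin_extChartAt_symm c.base_mem
    (congrArg Jet.base (hG P₀)) (Jet.base_mem c hGP) heG x
  refine (congrArg (fun u : X => (u, jetFirstCoord c (G P).jet u)) h2).trans ?_
  refine Prod.ext ?_ ?_
  · exact (add_zero _).symm
  · exact (zero_add _).symm

/-! ### The fibre derivative as the first Hamilton equation: existence, uniqueness and smoothness.
-/

namespace LagrangianDensity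

variable {L : LagrangianDensity π l d}

/-- The fibre derivative of the Hamiltonian section in coordinates. -/
theorem IsHyperregular.isFiberDerivAt_iff (hL : L.IsHyperregular) (c : BundleChart π)
    (y : Jet π l) {P : JDag π l d} (hP : P.point.value ∈ c.total.source)
    (γ : JetFirstJetAt P.point) :
    hL.IsFiberDerivAt P γ ↔ ∀ p, wedgeContr (jetFirstCoord c γ) p =
      -fderiv ℝ (hL.hamChart c y) (JDag.homeo d c y P) (0, p) := by
  have hd : ∀ (q : DagFiber d P.point)
      (v : Fin (d + 1) → TangentSpace 𝓘(ℝ, X × JetFib X Y l) P.point),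
      HasDerivAt (fun t : ℝ => hL.hamiltonian ⟨P.point, P.form + t • q⟩ v)
        (liouville (fibCoord d c P.point hP q) (fun i => djet c P.point (v i)) +
          fderiv ℝ (hL.hamChart c y) (JDag.homeo d c y P) (0, fibCoord d c P.point hP q)
            (fun i => (djet c P.point (v i)).1)) 0 := by
    intro q v
    let r : JDagModel X Y l d := (0, fibCoord d c P.point hP q)
    let v' : Fin (d + 1) → X × JetFib X Y l := fun i => djet c P.point (v i)
    let v'' : Fin (d + 1) → X := fun i => (v' i).1
    have h0 : ∀ t : ℝ, hL.hamiltonian ⟨P.point, P.form + t • q⟩ v =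
        liouville (JDag.homeo d c y P + t • r).2 v' +
          hL.hamChart c y (JDag.homeo d c y P + t • r) v'' := by
      intro t
      rw [hL.hamiltonian_eq c y (P := ⟨P.point, P.form + t • q⟩) hP,
        JDag.homeo_add_smul c y hP]
    simp only [h0]
    have h1 : HasDerivAt (fun t : ℝ => JDag.homeo d c y P + t • r) r 0 := by
      simpa using ((hasDerivAt_id (0 : ℝ)).smul_const r).const_add (JDag.homeo d c y P)
    have h2 : HasFDerivAt (hL.hamChart c y) (fderiv ℝ (hL.hamChart c y) (JDag.homeo d c y P))
        (JDag.homeo d c y P + (0 : ℝ) • r) := by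
      rw [zero_smul, add_zero]
      exact ((hL.contDiffAt_hamChart c y hP).differentiableAt (by simp)).hasFDerivAt
    have h3 := (ContinuousAlternatingMap.apply ℝ X ℝ v'').hasFDerivAt.comp_hasDerivAt (0 : ℝ)
      (h2.comp_hasDerivAt (0 : ℝ) h1)
    -- The chart is affine on the fibre, so the Liouville term is affine in `t` and only `hamChart`
    -- has to be differentiated.
    have h4 := ((ContinuousAlternatingMap.apply ℝ (X × JetFib X Y l) ℝ v').comp
      (liouville.comp (ContinuousLinearMap.snd ℝ _ _))).hasFDerivAt.comp_hasDerivAt (0 : ℝ) h1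
    exact h4.add h3
  constructor
  · intro H p
    ext w
    -- The Liouville terms of the two derivatives cancel, so any vectors with horizontal coordinates
    -- `w` would do; the vertical part is taken to be zero.
    have h1 := (hd (fibCoordInv c P.point p) fun i => djetInv c P.point (w i, 0)).unique
      (H (fibCoordInv c P.point p) fun i => djetInv c P.point (w i, 0))
    rw [embedForm_apply c hP, fibCoord_fibCoordInv] at h1
    simp only [djet_djetInv c hP] at h1
    show _ = -(fderiv ℝ (hL.hamChart c y) (JDag.homeo d c y P) (0, p) w)
    linarith
  · intro H q v
    convert hd q v using 1
    rw [embedForm_apply c hP, H, sub_eq_add_neg]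
    congr 1
    exact neg_neg _

/-- Of the two equations satisfied by a kernel element, the first involves only its image in `J^1
π_l` and is the coordinate form of the fibre derivative. -/
theorem IsHyperregular.isFiberDerivAt_of_mem_kerOmega (hL : L.IsHyperregular) {P : JDag π l d}
    {z : FirstJetAt X (JDagModel X Y l d) tauDag P} (hz : z ∈ hL.kerOmega P) :
    hL.IsFiberDerivAt P (tauZeroProl z) := by
  obtain ⟨c, hP, hc, -⟩ := JDag.exists_chartAt_eq P
  rw [hL.isFiberDerivAt_iff c P.point hP, jetFirstCoord_tauZeroProl c hP]
  exact ((annihilates_coordForm_iff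
    ((hL.contDiffAt_hamChart c P.point hP).differentiableAt (by simp)) _
    (firstJetCoord_fst_fst c hP z)).1 ((hL.mem_kerOmega_iff c hP hc z).1 hz)).1

/-- The right-hand side of `isFiberDerivAt_iff` does not involve `γ`, so `wedgeContr_injective`
applies. -/
theorem IsHyperregular.isFiberDerivAt_unique (hL : L.IsHyperregular)
    (b : Module.Basis (Fin (d + 1)) ℝ X) {P : JDag π l d} {γ γ' : JetFirstJetAt P.point}
    (h : hL.IsFiberDerivAt P γ) (h' : hL.IsFiberDerivAt P γ') : γ = γ' := by
  obtain ⟨c, hP, -, -⟩ := JDag.exists_chartAt_eq P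
  refine jetFirst_ext c hP (wedgeContr_injective (d := d) b fun p => ?_)
  rw [(hL.isFiberDerivAt_iff c P.point hP γ).1 h, (hL.isFiberDerivAt_iff c P.point hP γ').1 h']

theorem IsHyperregular.kerOmega_nonempty [FiniteDimensional ℝ X] [FiniteDimensional ℝ Y]
    (hL : L.IsHyperregular) (b : Module.Basis (Fin (d + 1)) ℝ X) (P : JDag π l d) :
    (hL.kerOmega P).Nonempty := by
  obtain ⟨c, hP, hc, -⟩ := JDag.exists_chartAt_eq P
  obtain ⟨Z, hZ, hZ'⟩ := exists_annihilates_coordForm b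
    ((hL.contDiffAt_hamChart c P.point hP).differentiableAt (by simp))
  obtain ⟨z, rfl⟩ := exists_firstJetCoord_eq c hP Z hZ
  exact ⟨z, (hL.mem_kerOmega_iff c hP hc z).2 hZ'⟩

/-- Near each point the coordinates of `γ` are the fixed linear map `R` applied to `-∂h/∂p`, which
is smooth because `hamChart` is. Uniqueness identifies this formula with the given `γ`. -/
theorem IsHyperregular.isSmoothMap_of_isFiberDerivAt [FiniteDimensional ℝ X]
    [FiniteDimensional ℝ Y] (hL : L.IsHyperregular) (b : Module.Basis (Fin (d + 1)) ℝ X)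
    {γ : ∀ P : JDag π l d, JetFirstJetAt P.point} (h : ∀ P, hL.IsFiberDerivAt P (γ P)) :
    JetFirstJet.IsSmoothMap fun P : JDag π l d => ⟨P.point, γ P⟩ := by
  refine JetFirstJet.isSmoothMap_of_coord (fun P => rfl) fun P₀ c hc => ?_
  obtain ⟨R, hR⟩ := exists_wedgeContr_rightInverse (d := d) (J := JetFib X Y l) b
  have hs : P₀ ∈ (JDag.homeo d c P₀.point).source := JDag.mem_homeo_source.2 hc
  have h1 : ContDiffAt ℝ ∞ (fun q : JDagModel X Y l d =>
      R (-(fderiv ℝ (hL.hamChart c P₀.point) q).comp (ContinuousLinearMap.inr ℝ _ _)))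
      (JDag.homeo d c P₀.point P₀) := by
    have k := (hL.contDiffAt_hamChart c P₀.point hc).fderiv_right (m := ∞) (by simp)
    exact R.contDiff.contDiffAt.comp _ ((k.clm_comp contDiffAt_const).neg)
  have h2 := ContMDiffAt.comp P₀ h1.contMDiffAt
    (contMDiffAt_of_mem_maximalAtlas (JDag.homeo_mem c P₀.point) hs)
  refine h2.congr_of_eventuallyEq ?_
  filter_upwards [(JDag.homeo d c P₀.point).open_source.mem_nhds hs] with P hP
  refine wedgeContr_injective (d := d) b fun p => ?_
  rw [Function.comp_apply, hR]
  exact (hL.isFiberDerivAt_iff c P₀.point (JDag.mem_homeo_source.1 hP) _).1 (h P) p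

end LagrangianDensity

end FieldTheory
end HigherField

end

/-! ### The proposition, for models of dimension `d + 1` and `m`. -/

theorem mainTheorem8 {d m l : ℕ} {M E F : Type*}
    [TopologicalSpace M] [ChartedSpace (EuclideanSpace ℝ (Fin (d + 1))) M]
    [IsManifold 𝓘(ℝ, EuclideanSpace ℝ (Fin (d + 1))) ∞ M]
    [TopologicalSpace E] [ChartedSpace (EuclideanSpace ℝ (Fin (d + 1 + m))) E]
    [IsManifold 𝓘(ℝ, EuclideanSpace ℝ (Fin (d + 1 + m))) ∞ E]
    [TopologicalSpace F] [ChartedSpace (EuclideanSpace ℝ (Fin m)) F]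
    [IsManifold 𝓘(ℝ, EuclideanSpace ℝ (Fin m)) ∞ F]
    (π : SmoothFiberBundle (EuclideanSpace ℝ (Fin (d + 1))) (EuclideanSpace ℝ (Fin m))
      (EuclideanSpace ℝ (Fin (d + 1 + m))) M E F)
    (L : LagrangianDensity π l d) (hL : L.IsHyperregular) :
    (∀ P : JDag π l d, (hL.kerOmega P).Nonempty ∧
      ∀ z ∈ hL.kerOmega P, ∀ z' ∈ hL.kerOmega P, tauZeroProl z = tauZeroProl z') ∧
    ∃ FH : JDag π l d → JetFirstJet π l,
      (∀ P, ∀ z ∈ hL.kerOmega P, FH P = ⟨P.point, tauZeroProl z⟩) ∧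
      (∀ P, (FH P).point = P.point) ∧
      JetFirstJet.IsSmoothMap FH ∧
      ∀ P, ∀ z ∈ hL.kerOmega P, hL.IsFiberDerivAt P (tauZeroProl z) := by
  let b := (EuclideanSpace.basisFun (Fin (d + 1)) ℝ).toBasis
  have hne : ∀ P, (hL.kerOmega P).Nonempty := hL.kerOmega_nonempty b
  have hder : ∀ P, ∀ z ∈ hL.kerOmega P, hL.IsFiberDerivAt P (tauZeroProl z) :=
    fun P z hz => hL.isFiberDerivAt_of_mem_kerOmega hz
  have huniq : ∀ P, ∀ z ∈ hL.kerOmega P, ∀ z' ∈ hL.kerOmega P,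
      tauZeroProl z = tauZeroProl z' :=
    fun P z hz z' hz' => hL.isFiberDerivAt_unique b (hder P z hz) (hder P z' hz')
  -- The kernel element chosen at each point is arbitrary; `huniq` makes its image independent of
  -- the choice, and smoothness follows from the fibre derivative equation.
  refine ⟨fun P => ⟨hne P, huniq P⟩, fun P => ⟨P.point, tauZeroProl (hne P).some⟩,
    fun P z hz => ?_, fun P => rfl, ?_, hder⟩
  · show (⟨P.point, tauZeroProl (hne P).some⟩ : JetFirstJet π l) = _
    rw [huniq P _ (hne P).some_mem z hz]
  · exact hL.isSmoothMap_of_isFiberDerivAt b fun P => hder P _ (hne P).some_mem
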